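/- **Theorem (streaming continual release $\ell_2$ frequency estimators).** Let $\mathcal U$ be a finite non-empty universe and $T\ge 2$. A stream is $\mathcal S=(a_1,\dots,a_T)$ with $a_i\in\mathcal U\cup\{\perp\}$; two streams are neighbouring if they differ in at most one timestamp. For a timestamp $t$ let $f_a=f_a(t)=|\{i\le t: a_i=a\}|$ and $\|\mathcal S_t\|_2=\big(\sum_{a\in\mathcal U}f_a(t)^2\big)^{1/2}$. An algorithm that produces an output at every timestamp $t$ from $a_1,\dots,a_t$ is $\varepsilon$-DP if $\Pr[A(\mathcal S)\in\mathcal O]\le e^{\varepsilon}\Pr[A(\mathcal S')\in\mathcal O]$ for all neighbouring $\mathcal S,\mathcal S'$ and all sets $\mathcal O$, where $A(\mathcal S)$ is the entire output history. Let $\varepsilon>0$ and $\eta,\xi\in(0,0.5)$, and put $L=\log(T/\xi)+\log|\mathcal U|$. There is an $\varepsilon$-DP streaming algorithm which at every timestamp $t\in[T]$ outputs numbers $\hat f_a$ $(a\in\mathcal U)$ and $\hat F_2$ such that, for every stream, with probability at least $1-\xi$ the following holds simultaneously for all $t\in[T]$: 1. for every $a\in\mathcal U$, $$|f_a-\hat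 f_a|\le \eta\|\mathcal S_t\|_2+O\!\left(\frac{L}{\varepsilon}\cdot\log^{2.5}(T)\cdot\log\frac{L}{\xi\eta}\right);$$ 2. $$\big|\hat F_2-\|\mathcal S_t\|_2^2\big|\le \eta\|\mathcal S_t\|_2^2+O\!\left(\frac{L^2}{\varepsilon^2\eta^3}\cdot\log^{5}(T)\cdot\log^2\frac{L}{\xi\eta}\right).$$ The algorithm uses $O\!\left(\frac{L}{\eta^2}\cdot\log T\right)$ words of memory, each word having $O\!\left(\log\frac{T|\mathcal U|}{\xi\eta}\right)$ bits. Here the algorithm may depend on $\mathcal U,T,\varepsilon,\eta,\xi$; it is a straight-line program on a word memory, run once at every timestamp, each of whose instructions replaces one word by a (possibly random) function of $O(1)$ words, and all data kept between instructions (hash functions, clocks, intermediate results) count as memory. The output is write-only; each released number is a fixed function of one memory word. All constants hidden in $O(\cdot)$ are absolute. -/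

import Mathlib

/-! ### Streams, frequencies and neighbouring streams -/

/-- A stream with `T` timestamps over the universe `U`; `none` is the empty input `⊥`. -/
abbrev ElementStream (U : Type*) (T : ℕ) : Type _ := Fin T → Option U

namespace ElementStream

variable {U : Type*} {T : ℕ}

open Classical in
/-- The number of occurrences of `a` among the inputs up to and including timestamp `t`. -/
noncomputable def freq (S : ElementStream U T) (t : Fin T) (a : U) : ℕ :=
  (Finset.univ.filter fun i : Fin T => i ≤ t ∧ S i = some a).card

/-- The second frequency moment of the stream up to timestamp `t`. -/
noncomputable def secondMoment [Fintype U] (S : ElementStream U T) (t : Fin T) : ℝ :=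
  ∑ a : U, (S.freq t a : ℝ) ^ 2

/-- The `ℓ₂` norm of the frequency vector of the stream up to timestamp `t`. -/
noncomputable def l2norm [Fintype U] (S : ElementStream U T) (t : Fin T) : ℝ :=
  Real.sqrt (S.secondMoment t)

/-- Two streams are neighbouring if they differ in at most one timestamp. -/
def Neighboring (S S' : ElementStream U T) : Prop :=
  {t : Fin T | S t ≠ S' t}.Subsingleton

end ElementStream

/-- What is released at one timestamp: an estimate of the frequency of every element of the
universe and an estimate of the second frequency moment. -/
structure Estimates (U : Type*) where
  freq : U → ℝ
  moment : ℝ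

/-! ### A word machine for randomised streaming algorithms

The memory consists of finitely many cells, each holding one word from a finite set of words.  An
instruction reads at most `r` cells and overwrites one cell by a (possibly random) function of the
words it has read; `r` will be an absolute constant.  Programs are straight-line (a loop is
unrolled, a conditional is part of an instruction), since only memory and not time is measured.
Everything the algorithm remembers from one instruction to the next, hence also hash functions,
clocks and intermediate results, has to be stored in the cells.  The output is write-only. -/

/-- Overwrite the cell `dst` by a word drawn from the distribution `op v`, where `v` lists the
words in the cells `src 0, …, src (r - 1)`. -/
structure WordInstr (Cell Word : Type) (r : ℕ) where
  dst : Cell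
  src : Fin r → Cell
  op : (Fin r → Word) → PMF Word

namespace WordInstr

variable {Cell Word : Type} {r : ℕ}

open Classical in
/-- Execution of one instruction; its random choice is fresh. -/
noncomputable def exec (c : WordInstr Cell Word r) (m : Cell → Word) : PMF (Cell → Word) :=
  (c.op fun j => m (c.src j)).map fun x => Function.update m c.dst x

/-- Execution of a straight-line program. -/
noncomputable def execList : List (WordInstr Cell Word r) → (Cell → Word) → PMF (Cell → Word)
  | [], m => PMF.pure m
  | c :: cs, m => (c.exec m).bind (execList cs)

end WordInstr

/-- The commands of the program that is run at every timestamp: a memory instruction, or the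
release of an estimate that is a fixed function `val` of the word in one cell. -/
inductive StreamCommand (U : Type*) (Cell Word : Type) (r : ℕ) where
  | compute (c : WordInstr Cell Word r)
  | emitFreq (a : U) (src : Cell) (val : Word → ℝ)
  | emitMoment (src : Cell) (val : Word → ℝ)

namespace StreamCommand

variable {U : Type*} {Cell Word : Type} {r : ℕ}

open Classical in
/-- Execution of one command on a memory and the estimates released so far at this timestamp. -/
noncomputable def exec : StreamCommand U Cell Word r → (Cell → Word) × Estimates U →
    PMF ((Cell → Word) × Estimates U)
  | compute c, x => PMF.bind (c.exec x.1) fun m => PMF.pure (m, x.2)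
  | emitFreq a i val, x => PMF.pure (x.1, { x.2 with freq := Function.update x.2.freq a (val (x.1 i)) })
  | emitMoment i val, x => PMF.pure (x.1, { x.2 with moment := val (x.1 i) })

/-- Execution of a straight-line program. -/
noncomputable def execList : List (StreamCommand U Cell Word r) → (Cell → Word) × Estimates U →
    PMF ((Cell → Word) × Estimates U)
  | [], x => PMF.pure x
  | c :: cs, x => (c.exec x).bind (execList cs)

end StreamCommand

/-- A randomised streaming algorithm in the continual release model over the universe `U`, all of
whose instructions read at most `r` memory cells. -/
structure StreamAlgorithm (U : Type*) (r : ℕ) where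
  /-- the memory cells -/
  Cell : Type
  /-- the possible contents of one memory cell -/
  Word : Type
  [cellFintype : Fintype Cell]
  [wordFintype : Fintype Word]
  /-- the memory when the machine is switched on -/
  start : Cell → Word
  /-- the program that is run once, before the stream arrives -/
  setup : List (WordInstr Cell Word r)
  /-- the cell into which the current input is written -/
  inputCell : Cell
  /-- the word that represents an input -/
  inputWord : Option U → Word
  /-- the program that is run at every timestamp -/
  program : List (StreamCommand U Cell Word r)

attribute [instance] StreamAlgorithm.cellFintype StreamAlgorithm.wordFintype

namespace StreamAlgorithm

variable {U : Type*} {r : ℕ}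

/-- The space of the algorithm: its number of memory cells. -/
def space (A : StreamAlgorithm U r) : ℕ := Fintype.card A.Cell

/-- The number of bits that are needed for one word. -/
def wordBits (A : StreamAlgorithm U r) : ℕ := Nat.clog 2 (Fintype.card A.Word)

open Classical in
/-- One timestamp: the input is written into the input cell, then the program is run.  The result
is the new memory together with the released estimates (`0` where nothing is released). -/
noncomputable def step (A : StreamAlgorithm U r) (a : Option U) (m : A.Cell → A.Word) :
    PMF ((A.Cell → A.Word) × Estimates U) :=
  StreamCommand.execList A.program
    (Function.update m A.inputCell (A.inputWord a), { freq := fun _ => 0, moment := 0 })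

/-- The joint distribution of the memory after `T` timestamps and of the output history. -/
noncomputable def run (A : StreamAlgorithm U r) : (T : ℕ) → ElementStream U T →
    PMF ((A.Cell → A.Word) × (Fin T → Estimates U))
  | 0, _ => PMF.bind (WordInstr.execList A.setup A.start) fun m => PMF.pure (m, Fin.elim0)
  | T + 1, S => PMF.bind (A.run T fun i => S i.castSucc) fun x =>
      PMF.bind (A.step (S (Fin.last T)) x.1) fun y => PMF.pure (y.1, Fin.snoc x.2 y.2)

/-- The distribution of the entire output history on the stream `S`. -/
noncomputable def outputs (A : StreamAlgorithm U r) {T : ℕ} (S : ElementStream U T) :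
    PMF (Fin T → Estimates U) :=
  (A.run T S).map Prod.snd

/-- The probability that the output history on the stream `S` lies in `O`. -/
noncomputable def prob (A : StreamAlgorithm U r) {T : ℕ} (S : ElementStream U T)
    (O : Set (Fin T → Estimates U)) : ENNReal :=
  (A.outputs S).toOuterMeasure O

/-- Pure differential privacy of the output history on streams with `T` timestamps. -/
def IsDP (A : StreamAlgorithm U r) (T : ℕ) (ε : ℝ) : Prop :=
  ∀ S S' : ElementStream U T, S.Neighboring S' → ∀ O : Set (Fin T → Estimates U),
    A.prob S O ≤ ENNReal.ofReal (Real.exp ε) * A.prob S' O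

end StreamAlgorithm

/-! ### Products of finitely many copies of a distribution -/

namespace PMF

open scoped ENNReal

/-! The algorithm is a CountSketch whose counters are released through the binary tree mechanism.
There are d = O(L) rows, each hashing the universe into w = Θ(1/η²) signed buckets. A frequency is
estimated by the median over the rows of sign times bucket, the moment by the median of the sums of
squared buckets. A bucket is a running sum, cut into dyadic blocks on J = O(log T) levels, and every
block carries its own discrete Laplace noise. A prefix of length n is the union of one completed
block per binary digit 1 of n, so a released bucket contains at most J noise terms.

Privacy (`Sketch.isDP`): fix the hash functions. Changing one input moves the buckets of a row by at
most 2 in total, and each move touches one block per level. Hence the history on one stream equals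
the history on the other with the noise translated by integers of total size at most 2dJ
(`history_shift`, `sum_abs_shift_le`). A translation by k costs a factor exp(c|k|), so c = ε/(2dJ)
suffices.

Accuracy (`Sketch.accurate`): four-wise independence enters only through `SignedHash`. Flipping the
sign of one point permutes the keys and kills the mixed moments, which leaves second moments F₂/w
and 2F₂²/w of the two collision errors. By Chebyshev a row is bad with probability at most 1/16, and
half of the rows are bad with probability at most 2^(-d) (`PMF.prob_half_bad_le`), small enough for
a union bound over timestamps and elements. For the noise, E exp(c|X|/2) ≤ 3 gives the tail 3^J
exp(-cN/2) in every bucket (`prob_bucketNoise_le`). Taking N = 4dJM/ε with M = O(log T ·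
log(L/(ξη))) makes this small enough; the resulting power of log T is 2, which is weakened to 5/2.

Finite words: numbers are kept modulo some m > 8wT² + 4T + d that does not depend on ε. If N ≤ T,
true values and noise fit without wrapping. If N > T, zeros are released, and these are accurate to
within the allowed error (`Sketch.cubic_accurate`). The link to the machine is `Sketch.outputs_eq`:
the output is a deterministic function of independent keys and noise. -/

theorem sum_coe {α : Type*} [Fintype α] (p : PMF α) : ∑ x, p x = 1 := by
  rw [← tsum_fintype (L := .unconditional α), p.tsum_coe]

theorem sum_prod_coe {ι α : Type*} [Fintype ι] [DecidableEq ι] [Fintype α] (p : PMF α)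
    (g : ι → α → ℝ≥0∞) :
    ∑ z : ι → α, (∏ k, p (z k)) * ∏ k, g k (z k) = ∏ k, ∑ x, p x * g k x := by
  rw [Finset.prod_univ_sum, Fintype.piFinset_univ]
  exact Finset.sum_congr rfl fun z _ => by rw [Finset.prod_mul_distrib]

open Classical in
/-- Independent draws, one for every index, from the same distribution. -/
noncomputable def iid (ι : Type*) [Fintype ι] {α : Type*} [Fintype α] (p : PMF α) :
    PMF (ι → α) :=
  PMF.ofFintype (fun z => ∏ k, p (z k)) (by
    simpa [sum_coe] using sum_prod_coe p fun (_ : ι) _ => 1)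

theorem iid_apply {ι α : Type*} [Fintype ι] [Fintype α] (p : PMF α) (z : ι → α) :
    p.iid ι z = ∏ k, p (z k) := rfl

theorem sum_iid_mul_prod {ι α : Type*} [Fintype ι] [DecidableEq ι] [Fintype α] (p : PMF α)
    (g : ι → α → ℝ≥0∞) :
    ∑ z, p.iid ι z * ∏ k, g k (z k) = ∏ k, ∑ x, p x * g k x :=
  sum_prod_coe p g

/-- Used twice: to split one coordinate off an independent family, and to append one more draw at
its end. -/
theorem eq_bind_map_of_equiv {α β γ : Type*} (e : γ ≃ α × β) (P : PMF γ) (p : PMF α)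
    (q : PMF β) (h : ∀ c, P c = p (e c).1 * q (e c).2) :
    P = p.bind fun x => q.map fun z => e.symm (x, z) := by
  classical
  ext c
  rw [bind_apply, tsum_eq_single (e c).1, map_apply, tsum_eq_single (e c).2]
  · simp [h]
  · intro z hz
    rw [if_neg]
    intro hc
    exact hz (by rw [hc]; simp)
  · intro x hx
    rw [map_apply]
    convert mul_zero _
    rw [ENNReal.tsum_eq_zero]
    intro z
    rw [if_neg]
    intro hc
    exact hx (by rw [hc]; simp)

theorem iid_eq_bind_split {ι α : Type*} [Fintype ι] [Fintype α] [DecidableEq ι] (p : PMF α)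
    (k : ι) :
    p.iid ι = p.bind fun x =>
      (p.iid {j // j ≠ k}).map fun z => (Equiv.funSplitAt k α).symm (x, z) := by
  refine eq_bind_map_of_equiv _ _ _ _ fun z => ?_
  rw [iid_apply, iid_apply, ← Finset.mul_prod_erase _ _ (Finset.mem_univ k)]
  simp only [Equiv.funSplitAt_apply]
  congr 1
  rw [← Finset.prod_subtype (Finset.univ.erase k) (by simp) (fun j => p (z j))]

/-- Coordinate `k` is independent of the others, so overwriting it by a fresh draw cannot be
noticed. This absorbs the fresh draw of an instruction into a family drawn in advance. -/
theorem bind_map_update_iid {ι α β : Type*} [Fintype ι] [Fintype α] [DecidableEq ι]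
    (p : PMF α) (k : ι) (G : (ι → α) → β) :
    (p.bind fun x => (p.iid ι).map fun z => G (Function.update z k x)) = (p.iid ι).map G := by
  have hu : ∀ x x' : α, ∀ z : {j // j ≠ k} → α,
      Function.update ((Equiv.funSplitAt k α).symm (x', z)) k x =
        (Equiv.funSplitAt k α).symm (x, z) := by
    intro x x' z
    ext j
    by_cases hj : j = k
    · subst hj; simp
    · simp [hj]
  rw [iid_eq_bind_split p k, map_bind]
  congr 1
  ext1 x
  rw [map_bind]
  simp only [map_comp, Function.comp_def, hu, bind_const]

theorem iid_fin_succ {α : Type*} [Fintype α] (p : PMF α) (n : ℕ) :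
    p.iid (Fin (n + 1)) =
      (p.iid (Fin n)).bind fun z => p.map fun x => (Fin.snoc z x : Fin (n + 1) → α) := by
  have h := eq_bind_map_of_equiv (Fin.snocEquiv fun _ : Fin (n + 1) => α).symm
    (p.iid (Fin (n + 1))) p (p.iid (Fin n)) (fun c => by
      rw [iid_apply, iid_apply, Fin.prod_univ_castSucc, mul_comm]
      rfl)
  rw [h]
  simp only [PMF.map]
  rw [bind_comm]
  rfl

theorem iid_fin_zero {α : Type*} [Fintype α] (p : PMF α) :
    p.iid (Fin 0) = PMF.pure Fin.elim0 := by
  ext z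
  rw [iid_apply, pure_apply, if_pos (Subsingleton.elim _ _)]
  simp

theorem toOuterMeasure_add_compl {α : Type*} (p : PMF α) (s : Set α) :
    p.toOuterMeasure s + p.toOuterMeasure sᶜ = 1 := by
  rw [toOuterMeasure_apply, toOuterMeasure_apply, ← ENNReal.tsum_add, ← p.tsum_coe]
  exact tsum_congr fun x => Set.indicator_self_add_compl_apply s p x

/-- Markov's inequality. -/
theorem mul_toOuterMeasure_le_sum {α : Type*} [Fintype α] (p : PMF α) (s : Set α) (c : ℝ≥0∞)
    (g : α → ℝ≥0∞) (h : ∀ x ∈ s, c ≤ g x) :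
    c * p.toOuterMeasure s ≤ ∑ x, p x * g x := by
  rw [toOuterMeasure_apply_fintype, Finset.mul_sum]
  refine Finset.sum_le_sum fun x _ => ?_
  by_cases hx : x ∈ s
  · rw [Set.indicator_of_mem hx, mul_comm]
    exact mul_le_mul_right (h x hx) _
  · simp [Set.indicator_of_notMem hx]

end PMF

/-! ### Semantics of straight-line programs -/

namespace WordInstr

variable {Cell Word : Type} {r : ℕ}

open Classical in
/-- The memory after the assignments `dst k ← F k memory (z k)`, for `k` in the list `l`. -/
noncomputable def scatter {ι α : Type*} (dst : ι → Cell) (F : ι → (Cell → Word) → α → Word)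
    (l : List ι) (m : Cell → Word) (z : ι → α) : Cell → Word :=
  l.foldl (fun m' k => Function.update m' (dst k) (F k m' (z k))) m

theorem scatter_update {ι α : Type*} [DecidableEq ι] (dst : ι → Cell)
    (F : ι → (Cell → Word) → α → Word) (l : List ι) (m : Cell → Word) (z : ι → α) {k : ι}
    (hk : k ∉ l) (x : α) :
    scatter dst F l m (Function.update z k x) = scatter dst F l m z := by
  induction l generalizing m with
  | nil => rfl
  | cons k' l ih =>
    simp only [List.mem_cons, not_or] at hk
    have h := fun m => ih m hk.2
    simp only [scatter, List.foldl_cons] at h ⊢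
    rw [Function.update_of_ne (Ne.symm hk.1), h]

theorem scatter_apply_of_forall_ne {ι α : Type*} (dst : ι → Cell)
    (F : ι → (Cell → Word) → α → Word) (l : List ι) (m : Cell → Word) (z : ι → α) {c : Cell}
    (hc : ∀ k, dst k ≠ c) : scatter dst F l m z c = m c := by
  classical
  induction l generalizing m with
  | nil => rfl
  | cons k' l ih =>
    simp only [scatter, List.foldl_cons] at ih ⊢
    rw [ih, Function.update_of_ne (hc k').symm]

/-- Sequential assignments act as simultaneous ones when each reads only its own target and cells
that no assignment writes, which is `hF`. Node updates have this shape. -/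
theorem scatter_apply_dst {ι α : Type*} (dst : ι → Cell) (hdst : Function.Injective dst)
    (F : ι → (Cell → Word) → α → Word)
    (hF : ∀ k m m' x, m (dst k) = m' (dst k) → (∀ c, (∀ k', dst k' ≠ c) → m c = m' c) →
      F k m x = F k m' x)
    (l : List ι) (hl : l.Nodup) (m : Cell → Word) (z : ι → α) (k : ι) :
    scatter dst F l m z (dst k) = open Classical in if k ∈ l then F k m (z k) else m (dst k) := by
  classical
  induction l generalizing m with
  | nil => simp [scatter]
  | cons k' l ih =>
    rw [List.nodup_cons] at hl
    have h := ih hl.2 (Function.update m (dst k') (F k' m (z k')))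
    have e : scatter dst F (k' :: l) m z =
        scatter dst F l (Function.update m (dst k') (F k' m (z k'))) z := by
      simp only [scatter, List.foldl_cons]
    rw [e, h]
    by_cases hk : k = k'
    · subst hk
      simp [hl.1]
    · have hne : dst k ≠ dst k' := fun h => hk (hdst h)
      simp only [List.mem_cons, hk, false_or, Function.update_of_ne hne]
      split_ifs
      · refine hF _ _ _ _ (Function.update_of_ne hne _ _) fun c hc => ?_
        exact Function.update_of_ne (hc k').symm _ _
      · rfl

/-- All randomness of a list of instructions may be drawn beforehand. The induction keeps the whole
index type: the head redraws its own coordinate, which the tail never reads because the list has no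
repetitions. -/
theorem execList_map {ι α : Type*} [Fintype ι] [Fintype α] (ν : PMF α)
    (instr : ι → WordInstr Cell Word r) (F : ι → (Cell → Word) → α → Word)
    (hop : ∀ k m, (instr k).op (fun j => m ((instr k).src j)) = ν.map (F k m))
    (l : List ι) (hl : l.Nodup) (m : Cell → Word) :
    execList (l.map instr) m =
      (ν.iid ι).map (scatter (fun k => (instr k).dst) F l m) := by
  classical
  induction l generalizing m with
  | nil =>
    rw [show scatter (fun k => (instr k).dst) F ([] : List ι) m = Function.const _ m from rfl,
      PMF.map_const]
    rfl
  | cons k l ih =>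
    rw [List.nodup_cons] at hl
    rw [← PMF.bind_map_update_iid ν k, List.map_cons, execList, exec, hop, PMF.map_comp,
      PMF.bind_map]
    congr 1
    ext1 x
    rw [Function.comp_apply, ih hl.2]
    congr 1
    ext1 z
    have e : scatter (fun k => (instr k).dst) F (k :: l) m (Function.update z k x) =
        scatter (fun k => (instr k).dst) F l
          (Function.update m (instr k).dst (F k m x)) (Function.update z k x) := by
      simp only [scatter, List.foldl_cons, Function.update_self]
    rw [e, scatter_update _ _ _ _ _ hl.1]
    rfl

end WordInstr

/-! ### Hoare-style rules for the deterministic commands -/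

namespace StreamCommand

variable {U : Type*} {Cell Word : Type} {r : ℕ}

theorem execList_append (cs cs' : List (StreamCommand U Cell Word r))
    (x : (Cell → Word) × Estimates U) :
    execList (cs ++ cs') x = (execList cs x).bind (execList cs') := by
  induction cs generalizing x with
  | nil => simp [execList]
  | cons c cs ih =>
    simp only [List.cons_append, execList, PMF.bind_bind]
    congr 1
    ext1 y
    exact ih y

theorem execList_compute (l : List (WordInstr Cell Word r)) (m : Cell → Word)
    (e : Estimates U) :
    execList (l.map compute) (m, e) = (WordInstr.execList l m).map fun m' => (m', e) := by
  induction l generalizing m with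
  | nil => simp [execList, WordInstr.execList, PMF.pure_map]
  | cons c l ih =>
    simp only [List.map_cons, execList, exec, WordInstr.execList, PMF.bind_bind, PMF.pure_bind,
      PMF.map_bind, ih]

/-- The program `cs` is deterministic and leads from states with `P` to states with `Q`. -/
def Det (cs : List (StreamCommand U Cell Word r)) (P Q : (Cell → Word) × Estimates U → Prop) :
    Prop :=
  ∀ x, P x → ∃ y, execList cs x = PMF.pure y ∧ Q y

theorem Det.append {cs cs' : List (StreamCommand U Cell Word r)}
    {P Q R : (Cell → Word) × Estimates U → Prop} (h : Det cs P Q) (h' : Det cs' Q R) :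
    Det (cs ++ cs') P R := by
  intro x hx
  obtain ⟨y, hy, hQ⟩ := h x hx
  obtain ⟨w, hw, hR⟩ := h' y hQ
  exact ⟨w, by rw [execList_append, hy, PMF.pure_bind, hw], hR⟩

theorem Det.imp {cs : List (StreamCommand U Cell Word r)}
    {P Q P' Q' : (Cell → Word) × Estimates U → Prop} (h : Det cs P Q) (hP : ∀ x, P' x → P x)
    (hQ : ∀ x, Q x → Q' x) : Det cs P' Q' := fun x hx =>
  let ⟨y, hy, h'⟩ := h x (hP x hx)
  ⟨y, hy, hQ y h'⟩

/-- The loop rule: `P v` is an invariant with a ghost value `v`, updated by `g` at each pass. -/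
theorem Det.flatMap {ι β : Type*} {body : ι → List (StreamCommand U Cell Word r)}
    {P : β → (Cell → Word) × Estimates U → Prop} {g : β → ι → β}
    (h : ∀ v i, Det (body i) (P v) (P (g v i))) (l : List ι) (v : β) :
    Det (l.flatMap body) (P v) (P (l.foldl g v)) := by
  induction l generalizing v with
  | nil => exact fun x hx => ⟨x, rfl, hx⟩
  | cons i l ih => exact (h v i).append (ih (g v i))

/-- An enumeration of a finite type. -/
noncomputable def enum (ι : Type*) [Fintype ι] : List ι := (Finset.univ : Finset ι).toList

theorem nodup_enum (ι : Type*) [Fintype ι] : (enum ι).Nodup := Finset.nodup_toList _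

theorem mem_enum {ι : Type*} [Fintype ι] (i : ι) : i ∈ enum ι := by simp [enum]

theorem foldl_add {ι M : Type*} [AddCommMonoid M] (f : ι → M) (l : List ι) (v : M) :
    l.foldl (fun v i => v + f i) v = v + (l.map f).sum := by
  induction l generalizing v with
  | nil => simp
  | cons i l ih => simp [ih, add_assoc]

theorem foldl_insert {ι : Type*} (l : List ι) (s : Set ι) :
    l.foldl (fun s i => insert i s) s = {i | i ∈ l} ∪ s := by
  induction l generalizing s with
  | nil => simp
  | cons i l ih =>
    rw [List.foldl_cons, ih]
    ext j
    simp only [Set.mem_union, Set.mem_ofPred_eq, Set.mem_insert_iff, List.mem_cons]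
    tauto

theorem Det.sum {ι M : Type*} [Fintype ι] [AddCommMonoid M]
    {body : ι → List (StreamCommand U Cell Word r)}
    {P : M → (Cell → Word) × Estimates U → Prop} {f : ι → M}
    (h : ∀ v i, Det (body i) (P v) (P (v + f i))) :
    Det ((enum ι).flatMap body) (P 0) (P (∑ i, f i)) := by
  have h' := Det.flatMap h (enum ι) 0
  rwa [foldl_add, zero_add, enum, Finset.sum_map_toList] at h'

/-- Here the ghost value is the set of indices already treated. -/
theorem Det.forall {ι : Type*} [Fintype ι] {body : ι → List (StreamCommand U Cell Word r)}
    {P : Set ι → (Cell → Word) × Estimates U → Prop}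
    (h : ∀ s i, Det (body i) (P s) (P (insert i s))) :
    Det ((enum ι).flatMap body) (P ∅) (P Set.univ) := by
  have h' := Det.flatMap (g := fun s i => insert i s) h (enum ι) ∅
  rw [foldl_insert] at h'
  simpa [enum] using h'

/-- The deterministic instruction `dst ← g (src 0, …, src (r - 1))`. -/
noncomputable def assign (dst : Cell) (src : Fin r → Cell) (g : (Fin r → Word) → Word) :
    StreamCommand U Cell Word r :=
  compute ⟨dst, src, fun v => PMF.pure (g v)⟩

open Classical in
theorem Det.assign {P Q : (Cell → Word) × Estimates U → Prop} {dst : Cell}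
    {src : Fin r → Cell} {g : (Fin r → Word) → Word}
    (h : ∀ m e, P (m, e) → Q (Function.update m dst (g fun j => m (src j)), e)) :
    Det [assign dst src g] P Q := by
  intro x hx
  refine ⟨_, ?_, h x.1 x.2 hx⟩
  simp [execList, exec, StreamCommand.assign, WordInstr.exec, PMF.pure_map]

open Classical in
theorem Det.emitFreq {P Q : (Cell → Word) × Estimates U → Prop} {a : U} {src : Cell}
    {val : Word → ℝ}
    (h : ∀ m e, P (m, e) → Q (m, ⟨Function.update e.freq a (val (m src)), e.moment⟩)) :
    Det [emitFreq (r := r) a src val] P Q := by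
  intro x hx
  refine ⟨_, ?_, h x.1 x.2 hx⟩
  simp [execList, exec]

theorem Det.emitMoment {P Q : (Cell → Word) × Estimates U → Prop} {src : Cell}
    {val : Word → ℝ} (h : ∀ m e, P (m, e) → Q (m, ⟨e.freq, val (m src)⟩)) :
    Det [emitMoment (U := U) (r := r) src val] P Q := by
  intro x hx
  refine ⟨_, ?_, h x.1 x.2 hx⟩
  simp [execList, exec]

end StreamCommand

/-- The values of a finite sequence, continued by a default value. -/
def Fin.extend {α : Type*} (d : α) {T : ℕ} (z : Fin T → α) (t : ℕ) : α :=
  if h : t < T then z ⟨t, h⟩ else d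

theorem Fin.extend_of_lt {α : Type*} (d : α) {T : ℕ} (z : Fin T → α) {t : ℕ} (h : t < T) :
    Fin.extend d z t = z ⟨t, h⟩ := dif_pos h

theorem Fin.extend_snoc_of_lt {α : Type*} (d : α) {T : ℕ} (z : Fin T → α) (x : α) {t : ℕ}
    (h : t < T) : Fin.extend d (Fin.snoc z x : Fin (T + 1) → α) t = Fin.extend d z t := by
  rw [Fin.extend_of_lt _ _ h, Fin.extend_of_lt _ _ (h.trans (Nat.lt_succ_self T))]
  simp [Fin.snoc, h]

theorem Fin.extend_snoc_self {α : Type*} (d : α) {T : ℕ} (z : Fin T → α) (x : α) :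
    Fin.extend d (Fin.snoc z x : Fin (T + 1) → α) T = x := by
  simp [Fin.extend_of_lt _ _ (Nat.lt_succ_self T), Fin.snoc]

/-! ### Runs as deterministic functions of pre-drawn randomness -/

namespace StreamAlgorithm

/-- The memory after `t` timestamps when the random choices are the sequence `z`. -/
def memAt {α M O Z : Type*} (step : α → M → Z → M × O) (m : M) (S : ℕ → α) (z : ℕ → Z) : ℕ → M
  | 0 => m
  | t + 1 => (step (S t) (memAt step m S z t) (z t)).1

/-- The output at a timestamp when the random choices are the sequence `z`. -/
def outAt {α M O Z : Type*} (step : α → M → Z → M × O) (m : M) (S : ℕ → α) (z : ℕ → Z)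
    (t : ℕ) : O :=
  (step (S t) (memAt step m S z t) (z t)).2

theorem memAt_congr {α M O Z : Type*} (step : α → M → Z → M × O) (m : M) (S : ℕ → α)
    {z z' : ℕ → Z} {t : ℕ} (h : ∀ s < t, z s = z' s) :
    memAt step m S z t = memAt step m S z' t := by
  induction t with
  | zero => rfl
  | succ t ih => rw [memAt, memAt, ih fun s hs => h s (by omega), h t (by omega)]

variable {U : Type*} {r : ℕ}

/-- Each timestamp uses fresh noise, so a run is the image of the setup randomness and an
independent noise sequence under a deterministic recursion. Extending the noise to `ℕ` makes the
recursion independent of the horizon; the default `d` is never read during the first `T` steps. -/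
theorem run_eq (A : StreamAlgorithm U r) {H Z : Type*} [Fintype Z] {σ : PMF H} {π : PMF Z}
    {init : H → A.Cell → A.Word}
    {stepFn : Option U → (A.Cell → A.Word) → Z → (A.Cell → A.Word) × Estimates U}
    (hsetup : WordInstr.execList A.setup A.start = σ.map init)
    (hstep : ∀ a m, A.step a m = π.map (stepFn a m)) (S : ℕ → Option U) (d : Z) (T : ℕ) :
    A.run T (fun t => S t) = σ.bind fun h => (π.iid (Fin T)).map fun z =>
      (memAt stepFn (init h) S (Fin.extend d z) T,
        fun t : Fin T => outAt stepFn (init h) S (Fin.extend d z) t) := by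
  induction T with
  | zero =>
    simp only [run, hsetup, PMF.iid_fin_zero, PMF.pure_map, PMF.bind_map]
    congr 1
    ext1 h
    simp only [Function.comp_apply]
    congr 2
    ext1 t
    exact t.elim0
  | succ T ih =>
    have ih' := ih
    simp only [run, Fin.val_castSucc, Fin.val_last] at ih' ⊢
    rw [ih', PMF.bind_bind]
    congr 1
    ext1 h
    rw [PMF.iid_fin_succ, PMF.map_bind, PMF.bind_map]
    congr 1
    ext1 z
    rw [Function.comp_apply, hstep, PMF.bind_map, PMF.map_comp, PMF.map]
    congr 1
    ext1 x
    have hm : ∀ t ≤ T, memAt stepFn (init h) S (Fin.extend d (Fin.snoc z x : Fin (T + 1) → Z)) t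
        = memAt stepFn (init h) S (Fin.extend d z) t := fun t ht =>
      memAt_congr _ _ _ fun s hs => Fin.extend_snoc_of_lt d z x (by omega)
    simp only [Function.comp_apply]
    congr 1
    refine Prod.ext ?_ ?_
    · simp only [memAt]
      rw [Fin.extend_snoc_self, hm T le_rfl]
    · ext1 t
      refine Fin.lastCases ?_ (fun t => ?_) t
      · simp only [Fin.snoc_last, outAt, Fin.val_last]
        rw [Fin.extend_snoc_self, hm T le_rfl]
      · simp only [Fin.snoc_castSucc, outAt, Fin.val_castSucc]
        rw [Fin.extend_snoc_of_lt d z x t.2, hm t t.2.le]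

end StreamAlgorithm

/-! ### The private sketch -/

/-- The memory cells of a sketch with `d` rows, `w` buckets and `J` levels. -/
inductive SketchCell (d w J : ℕ) : Type
  | input
  | clock
  | hash (i : Fin d)
  | node (k : Fin d × Fin w × Fin J)
  | val (k : Fin d × Fin w)
  | est (i : Fin d)
  | cnt
  | best

namespace SketchCell

/-- The cells as a sum type. -/
def equivSum (d w J : ℕ) : SketchCell d w J ≃
    Fin 4 ⊕ (Fin d ⊕ Fin d) ⊕ (Fin d × Fin w) ⊕ (Fin d × Fin w × Fin J) where
  toFun
    | input => .inl 0
    | clock => .inl 1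
    | cnt => .inl 2
    | best => .inl 3
    | hash i => .inr (.inl (.inl i))
    | est i => .inr (.inl (.inr i))
    | val k => .inr (.inr (.inl k))
    | node k => .inr (.inr (.inr k))
  invFun
    | .inl 0 => input
    | .inl 1 => clock
    | .inl 2 => cnt
    | .inl 3 => best
    | .inr (.inl (.inl i)) => hash i
    | .inr (.inl (.inr i)) => est i
    | .inr (.inr (.inl k)) => val k
    | .inr (.inr (.inr k)) => node k
  left_inv c := by cases c <;> rfl
  right_inv := by
    rintro (x | (x | x) | x | x)
    · fin_cases x <;> rfl
    all_goals rfl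

instance (d w J : ℕ) : Fintype (SketchCell d w J) := Fintype.ofEquiv _ (equivSum d w J).symm

theorem card (d w J : ℕ) :
    Fintype.card (SketchCell d w J) = 4 + (d + d + (d * w + d * (w * J))) := by
  rw [Fintype.card_congr (equivSum d w J)]
  simp

/-- Cells that hold intermediate results of one estimate. -/
def Scratch {d w J : ℕ} : SketchCell d w J → Prop
  | est _ | cnt | best => True
  | _ => False

end SketchCell

/-- The parameters of a private sketch: a family of hash functions into signed buckets, the
dimensions of the table, the modulus of the arithmetic and the distribution of the noise. -/
structure Sketch (U : Type*) where
  Key : Type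
  Letter : Type
  [keyFintype : Fintype Key]
  [keyInhabited : Inhabited Key]
  [letterFintype : Fintype Letter]
  rows : ℕ
  width : ℕ
  levels : ℕ
  modulus : ℕ
  [modulusNeZero : NeZero modulus]
  code : U → Letter
  bucket : Key → Letter → Fin width
  sign : Key → Letter → ℤ
  noise : PMF (ZMod modulus)
  decode : ZMod modulus → ℝ

attribute [instance] Sketch.keyFintype Sketch.keyInhabited Sketch.letterFintype
  Sketch.modulusNeZero

namespace Sketch

variable {U : Type*} (D : Sketch U)

/-- Numbers are kept modulo `modulus`. -/
abbrev Num : Type := ZMod D.modulus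

/-- A word holds an input, a hash function and two numbers. -/
abbrev Word : Type := Option D.Letter × D.Key × D.Num × D.Num

/-- The memory cells. -/
abbrev Cell : Type := SketchCell D.rows D.width D.levels

/-- The positions of the partial sums. -/
abbrev Node : Type := Fin D.rows × Fin D.width × Fin D.levels

/-- The word that holds two numbers. -/
def num (x y : D.Num) : D.Word := (none, default, x, y)

variable {D} in
/-- The first number in a word. -/
def fstNum (w : D.Word) : D.Num := w.2.2.1

variable {D} in
/-- The second number in a word. -/
def sndNum (w : D.Word) : D.Num := w.2.2.2

/-- The change of the bucket `b` caused by an input. -/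
def incr (κ : D.Key) (b : Fin D.width) : Option D.Letter → ℤ
  | none => 0
  | some x => if D.bucket κ x = b then D.sign κ x else 0

/-- The new content of a node: the first number accumulates the current dyadic block on top of
noise drawn at its start, the second number is the last completed block. -/
def nodeStep (b : Fin D.width) (j : ℕ) (own : D.Word) (κ : D.Key) (x : Option D.Letter) (t : ℕ)
    (z : D.Num) : D.Word :=
  let A := (if 2 ^ j ∣ t then z else fstNum own) + (D.incr κ b x : D.Num)
  D.num A (if 2 ^ j ∣ t + 1 then A else sndNum own)

open SketchCell

/-- The randomised instruction that updates a node. -/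
noncomputable def nodeInstr (k : D.Node) : WordInstr D.Cell D.Word 4 where
  dst := node k
  src := ![node k, hash k.1, input, clock]
  -- A draw is made at every timestamp although `nodeStep` discards it unless a block starts; this
  -- keeps the noise an independent family indexed by timestamps and nodes.
  op v := D.noise.map
    (D.nodeStep k.2.1 k.2.2 (v 0) (v 1).2.1 (v 2).1 (ZMod.val (fstNum (v 3))))

open StreamCommand

/-- Abbreviation for the commands of the sketch. -/
abbrev Cmd : Type _ := StreamCommand U D.Cell D.Word 4

/-- Recompute the contents of all buckets. -/
noncomputable def valProg : List D.Cmd :=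
  (enum (Fin D.rows × Fin D.width)).flatMap fun k =>
    [assign (val k) (fun _ => input) fun _ => D.num 0 0] ++
    (enum (Fin D.levels)).flatMap fun j =>
      [assign (val k) ![val k, clock, node (k.1, k.2, j), input] fun v =>
        -- The clock still shows the number of earlier inputs, since `tick` comes last; the `+ 1`
        -- counts the current one.
        D.num (fstNum (v 0) +
          if Nat.testBit (ZMod.val (fstNum (v 1)) + 1) j then sndNum (v 2) else 0) 0]

/-- Compute a sum over the buckets of every row. -/
noncomputable def estProg (g : Fin D.width → D.Key → D.Num → D.Num) : List D.Cmd :=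
  (enum (Fin D.rows)).flatMap fun i =>
    [assign (est i) (fun _ => input) fun _ => D.num 0 0] ++
    (enum (Fin D.width)).flatMap fun b =>
      [assign (est i) ![est i, hash i, val (i, b), input] fun v =>
        D.num (fstNum (v 0) + g b (v 1).2.1 (fstNum (v 2))) 0]

/-- Whether a number is at most another one, both read as small integers. -/
def le (x y : D.Num) : Prop := x.valMinAbs ≤ y.valMinAbs

/-- The pairs whose sum counts the rows below and above a value. -/
noncomputable def rank (x y : D.Num) : D.Num × D.Num :=
  open Classical in (if D.le x y then 1 else 0, if D.le y x then 1 else 0)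

/-- Whether a value of the given ranks is a median. -/
def Central (c : D.Num × D.Num) : Prop :=
  -- Only one inequality can be strict: among an even number of distinct values none has more than
  -- half on both sides.
  D.rows < 2 * ZMod.val c.1 ∧ D.rows ≤ 2 * ZMod.val c.2

open Classical in
/-- The median, as computed by the program. -/
noncomputable def median (v : Fin D.rows → D.Num) : D.Num :=
  (enum (Fin D.rows)).foldl
    (fun acc i => if D.Central (∑ i', D.rank (v i') (v i)) then v i else acc) 0

open Classical in
/-- Compute the median of the rows. -/
noncomputable def medianProg : List D.Cmd :=
  [assign best (fun _ => input) fun _ => D.num 0 0] ++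
  (enum (Fin D.rows)).flatMap fun i =>
    [assign cnt (fun _ => input) fun _ => D.num 0 0] ++
    ((enum (Fin D.rows)).flatMap fun i' =>
      [assign cnt ![cnt, est i', est i, input] fun v =>
        D.num (fstNum (v 0) + (D.rank (fstNum (v 1)) (fstNum (v 2))).1)
          (sndNum (v 0) + (D.rank (fstNum (v 1)) (fstNum (v 2))).2)] ) ++
    [assign best ![best, cnt, est i, input] fun v =>
      D.num (if D.Central (fstNum (v 1), sndNum (v 1)) then fstNum (v 2) else fstNum (v 0)) 0]

/-- The contribution of a bucket to the estimate of a frequency. -/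
noncomputable def freqTerm (x : D.Letter) (b : Fin D.width) (κ : D.Key) (y : D.Num) : D.Num :=
  if D.bucket κ x = b then (D.sign κ x : D.Num) * y else 0

/-- The part of the program after the random updates, without the advance of the clock. -/
noncomputable def releaseProg [Fintype U] : List D.Cmd :=
  D.valProg ++
  ((enum U).flatMap fun a =>
    D.estProg (D.freqTerm (D.code a)) ++ D.medianProg ++
      [emitFreq a best fun w => D.decode (fstNum w)]) ++
  (D.estProg (fun _ _ y => y ^ 2) ++ D.medianProg ++
      [emitMoment best fun w => D.decode (fstNum w)])

/-- Advance the clock. -/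
noncomputable def tick : D.Cmd :=
  assign clock (fun _ => clock) fun v => D.num (fstNum (v 0) + 1) 0

/-- The streaming algorithm. -/
noncomputable def algorithm [Fintype U] : StreamAlgorithm U 4 where
  Cell := D.Cell
  Word := D.Word
  start := fun _ => D.num 0 0
  setup := (enum (Fin D.rows)).map fun i =>
    { dst := hash i
      src := fun _ => input
      op := fun _ => (PMF.uniformOfFintype D.Key).map fun κ => (none, κ, 0, 0) }
  inputCell := input
  inputWord := fun a => (a.map D.code, default, 0, 0)
  program := (enum D.Node).map (fun k => compute (D.nodeInstr k)) ++
    (D.releaseProg ++ [D.tick])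

/-! ### Correctness of the deterministic part -/

variable {D}

/-- A property of states that does not depend on the scratch cells. -/
def Stable (R : (D.Cell → D.Word) × Estimates U → Prop) : Prop :=
  ∀ m m' e, (∀ c, ¬ c.Scratch → m c = m' c) → R (m, e) → R (m', e)

open Classical in
theorem Stable.update {R : (D.Cell → D.Word) × Estimates U → Prop} (hR : Stable R)
    {m : D.Cell → D.Word} {e : Estimates U} (h : R (m, e)) {c : D.Cell} (hc : c.Scratch)
    (w : D.Word) : R (Function.update m c w, e) :=
  hR m _ e (fun c' hc' => (Function.update_of_ne (by rintro rfl; exact hc' hc) _ _).symm) h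

open Classical in
-- The outer invariant records the finished rows, the inner one a partial sum over buckets. `R` is a
-- frame property, which survives because only scratch cells are written.
theorem det_estProg {R : (D.Cell → D.Word) × Estimates U → Prop} (hR : Stable R)
    (g : Fin D.width → D.Key → D.Num → D.Num) (f : Fin D.rows → Fin D.width → D.Num)
    (hg : ∀ x, R x → ∀ i b, g b (x.1 (hash i)).2.1 (fstNum (x.1 (val (i, b)))) = f i b) :
    Det (D.estProg g) R (fun x => R x ∧ ∀ i, fstNum (x.1 (est i)) = ∑ b, f i b) := by
  refine (Det.forall (P := fun s x => R x ∧ ∀ i ∈ s, fstNum (x.1 (est i)) = ∑ b, f i b)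
    fun s i => ?_).imp (fun x hx => ⟨hx, by simp⟩) (fun x hx => ⟨hx.1, fun i => hx.2 i trivial⟩)
  have h1 : Det [assign (U := U) (est i) (fun _ : Fin 4 => input) fun _ => D.num 0 0]
      (fun x => R x ∧ ∀ i ∈ s, fstNum (x.1 (est i)) = ∑ b, f i b)
      (fun x => R x ∧ (∀ i' ∈ s, i' ≠ i → fstNum (x.1 (est i')) = ∑ b, f i' b) ∧
        fstNum (x.1 (est i)) = 0) := by
    refine Det.assign fun m e h => ⟨hR.update h.1 (by trivial) _, fun i' hi' hne => ?_, ?_⟩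
    · dsimp only
      rw [Function.update_of_ne (by simpa using hne)]
      exact h.2 i' hi'
    · simp [num, fstNum]
  have h2 := Det.sum (U := U) (r := 4) (f := f i) (P := fun y x =>
      R x ∧ (∀ i' ∈ s, i' ≠ i → fstNum (x.1 (est i')) = ∑ b, f i' b) ∧
        fstNum (x.1 (est i)) = y)
      (body := fun b => [assign (est i) ![est i, hash i, val (i, b), input] fun v =>
        D.num (fstNum (v 0) + g b (v 1).2.1 (fstNum (v 2))) 0]) (fun y b => by
    refine Det.assign fun m e h => ⟨hR.update h.1 (by trivial) _, fun i' hi' hne => ?_, ?_⟩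
    · dsimp only
      rw [Function.update_of_ne (by simpa using hne)]
      exact h.2.1 i' hi' hne
    · have := hg _ h.1 i b
      simp only [num, fstNum] at this h ⊢
      simp [this, h.2.2])
  refine (h1.append h2).imp (fun _ h => h) fun x hx => ⟨hx.1, fun i' hi' => ?_⟩
  by_cases hne : i' = i
  · subst hne; exact hx.2.2
  · exact hx.2.1 i' (hi'.resolve_left hne) hne

open Classical in
-- The ghost value of the outer loop is the accumulator of the fold in `median`, that of the inner
-- loop the pair of rank counts.
theorem det_medianProg {R : (D.Cell → D.Word) × Estimates U → Prop} (hR : Stable R)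
    (v : Fin D.rows → D.Num) :
    Det D.medianProg (fun x => R x ∧ ∀ i, fstNum (x.1 (est i)) = v i)
      (fun x => R x ∧ fstNum (x.1 best) = D.median v) := by
  have h1 : Det [assign (U := U) best (fun _ : Fin 4 => input) fun _ => D.num 0 0]
      (fun x => R x ∧ ∀ i, fstNum (x.1 (est i)) = v i)
      (fun x => R x ∧ (∀ i, fstNum (x.1 (est i)) = v i) ∧ fstNum (x.1 best) = 0) := by
    refine Det.assign fun m e h => ⟨hR.update h.1 (by trivial) _, fun i => ?_, ?_⟩
    · dsimp only
      rw [Function.update_of_ne (by simp)]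
      exact h.2 i
    · simp [num, fstNum]
  refine h1.append (Det.imp (Det.flatMap (g := fun acc i =>
      if D.Central (∑ i', D.rank (v i') (v i)) then v i else acc) (P := fun y x =>
      R x ∧ (∀ i, fstNum (x.1 (est i)) = v i) ∧ fstNum (x.1 best) = y) (fun y i => ?_)
      (enum (Fin D.rows)) 0) (fun _ h => h) fun x hx => ⟨hx.1, hx.2.2⟩)
  have h2 : Det [assign (U := U) cnt (fun _ : Fin 4 => input) fun _ => D.num 0 0]
      (fun x => R x ∧ (∀ i, fstNum (x.1 (est i)) = v i) ∧ fstNum (x.1 best) = y)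
      (fun x => R x ∧ (∀ i, fstNum (x.1 (est i)) = v i) ∧ fstNum (x.1 best) = y ∧
        (fstNum (x.1 cnt), sndNum (x.1 cnt)) = 0) := by
    refine Det.assign fun m e h => ⟨hR.update h.1 (by trivial) _, fun i => ?_, ?_, ?_⟩
    · dsimp only
      rw [Function.update_of_ne (by simp)]
      exact h.2.1 i
    · dsimp only
      rw [Function.update_of_ne (by simp)]
      exact h.2.2
    · simp [num, fstNum, sndNum]
  have h3 := Det.sum (U := U) (r := 4) (f := fun i' => D.rank (v i') (v i)) (P := fun c x =>
      R x ∧ (∀ i, fstNum (x.1 (est i)) = v i) ∧ fstNum (x.1 best) = y ∧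
        (fstNum (x.1 cnt), sndNum (x.1 cnt)) = c)
      (body := fun i' => [assign cnt ![cnt, est i', est i, input] fun v =>
        D.num (fstNum (v 0) + (D.rank (fstNum (v 1)) (fstNum (v 2))).1)
          (sndNum (v 0) + (D.rank (fstNum (v 1)) (fstNum (v 2))).2)]) (fun c i' => by
    refine Det.assign fun m e h => ⟨hR.update h.1 (by trivial) _, fun i => ?_, ?_, ?_⟩
    · dsimp only
      rw [Function.update_of_ne (by simp)]
      exact h.2.1 i
    · dsimp only
      rw [Function.update_of_ne (by simp)]
      exact h.2.2.1
    · rw [← h.2.2.2, ← h.2.1 i', ← h.2.1 i]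
      exact Prod.ext (by simp [num, fstNum]) (by simp [num, fstNum, sndNum]))
  refine (h2.append h3).append (Det.assign fun m e h =>
    ⟨hR.update h.1 (by trivial) _, fun i => ?_, ?_⟩)
  · dsimp only
    rw [Function.update_of_ne (by simp)]
    exact h.2.1 i
  · have e1 := h.2.2.2
    have e2 := h.2.1 i
    have e3 := h.2.2.1
    rw [← e1, ← e2, ← e3]
    simp [num, fstNum, sndNum]

end Sketch

/-- Cells that are not changed by the release of estimates. -/
def SketchCell.Core {d w J : ℕ} : SketchCell d w J → Prop
  | input | clock | hash _ | node _ => True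
  | _ => False

namespace Sketch

open SketchCell StreamCommand

variable {U : Type*} {D : Sketch U}

/-- The contents of a bucket according to the completed nodes. -/
def bucketVal (m : D.Cell → D.Word) (k : Fin D.rows × Fin D.width) : D.Num :=
  ∑ j : Fin D.levels, if Nat.testBit (ZMod.val (fstNum (m clock)) + 1) j then
    sndNum (m (node (k.1, k.2, j))) else 0

open Classical in
theorem det_valProg (m₀ : D.Cell → D.Word) :
    Det D.valProg (fun x => ∀ c, c.Core → x.1 c = m₀ c)
      (fun x => (∀ c, c.Core → x.1 c = m₀ c) ∧
        ∀ k, fstNum (x.1 (val k)) = bucketVal m₀ k) := by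
  refine (Det.forall (P := fun s x => (∀ c, c.Core → x.1 c = m₀ c) ∧
    ∀ k ∈ s, fstNum (x.1 (val k)) = bucketVal m₀ k) fun s k => ?_).imp
    (fun x hx => ⟨hx, by simp⟩) (fun x hx => ⟨hx.1, fun i => hx.2 i trivial⟩)
  have hcore : ∀ (m : D.Cell → D.Word) w, (∀ c, c.Core → m c = m₀ c) →
      ∀ c : D.Cell, c.Core → Function.update m (val k) w c = m₀ c := by
    intro m w h c hc
    rw [Function.update_of_ne (by rintro rfl; exact hc)]
    exact h c hc
  have h1 : Det [assign (U := U) (val k) (fun _ : Fin 4 => input) fun _ => D.num 0 0]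
      (fun x => (∀ c, c.Core → x.1 c = m₀ c) ∧
        ∀ k ∈ s, fstNum (x.1 (val k)) = bucketVal m₀ k)
      (fun x => (∀ c, c.Core → x.1 c = m₀ c) ∧
        (∀ k' ∈ s, k' ≠ k → fstNum (x.1 (val k')) = bucketVal m₀ k') ∧
        fstNum (x.1 (val k)) = 0) := by
    refine Det.assign fun m e h => ⟨hcore m _ h.1, fun k' hk' hne => ?_, ?_⟩
    · dsimp only
      rw [Function.update_of_ne (by simpa using hne)]
      exact h.2 k' hk'
    · simp [num, fstNum]
  have h2 := Det.sum (U := U) (r := 4) (f := fun j : Fin D.levels =>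
      if Nat.testBit (ZMod.val (fstNum (m₀ clock)) + 1) j then
        sndNum (m₀ (node (k.1, k.2, j))) else 0)
      (P := fun y x => (∀ c, c.Core → x.1 c = m₀ c) ∧
        (∀ k' ∈ s, k' ≠ k → fstNum (x.1 (val k')) = bucketVal m₀ k') ∧
        fstNum (x.1 (val k)) = y)
      (body := fun j => [assign (val k) ![val k, clock, node (k.1, k.2, j), input] fun v =>
        D.num (fstNum (v 0) +
          if Nat.testBit (ZMod.val (fstNum (v 1)) + 1) j then sndNum (v 2) else 0) 0])
      (fun y j => by
    refine Det.assign fun m e h => ⟨hcore m _ h.1, fun k' hk' hne => ?_, ?_⟩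
    · dsimp only
      rw [Function.update_of_ne (by simpa using hne)]
      exact h.2.1 k' hk' hne
    · rw [← h.2.2, ← h.1 clock trivial, ← h.1 (node (k.1, k.2, j)) trivial]
      simp [num, fstNum]
      rfl)
  refine (h1.append h2).imp (fun _ h => h) fun x hx => ⟨hx.1, fun k' hk' => ?_⟩
  by_cases hne : k' = k
  · subst hne; exact hx.2.2
  · exact hx.2.1 k' (hk'.resolve_left hne) hne

/-- The memory after the setup. -/
noncomputable def initMem (D : Sketch U) : (Fin D.rows → D.Key) → D.Cell → D.Word :=
  WordInstr.scatter hash (fun _ _ κ => (none, κ, 0, 0)) (enum (Fin D.rows)) fun _ => D.num 0 0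

theorem initMem_hash (κ : Fin D.rows → D.Key) (i : Fin D.rows) :
    (D.initMem κ (hash i)).2.1 = κ i := by
  rw [initMem, WordInstr.scatter_apply_dst _ (fun _ _ h => by simpa using h) _
    (fun _ _ _ _ _ _ => rfl) _ (nodup_enum _)]
  simp [mem_enum]

theorem initMem_clock (κ : Fin D.rows → D.Key) : fstNum (D.initMem κ clock) = 0 := by
  rw [initMem, WordInstr.scatter_apply_of_forall_ne _ _ _ _ _ (by simp)]
  rfl

variable [Fintype U]

/-- The estimates computed from the hash functions and the contents of the buckets. -/
noncomputable def estimates (D : Sketch U) (κ : Fin D.rows → D.Key)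
    (v : Fin D.rows × Fin D.width → D.Num) : Estimates U where
  freq a := D.decode (D.median fun i => ∑ b, D.freqTerm (D.code a) b (κ i) (v (i, b)))
  moment := D.decode (D.median fun i => ∑ b, v (i, b) ^ 2)

open Classical in
-- The frame `R s` holds everything the estimates are computed from, together with the frequencies
-- released for `s`; all of it survives the scratch work for the next element.
theorem det_releaseProg (m₀ : D.Cell → D.Word) :
    Det D.releaseProg (fun x => ∀ c, c.Core → x.1 c = m₀ c)
      (fun x => (∀ c, c.Core → x.1 c = m₀ c) ∧
        x.2 = D.estimates (fun i => (m₀ (hash i)).2.1) (bucketVal m₀)) := by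
  let R : Set U → (D.Cell → D.Word) × Estimates U → Prop := fun s x =>
    (∀ c, c.Core → x.1 c = m₀ c) ∧ (∀ k, fstNum (x.1 (val k)) = bucketVal m₀ k) ∧
      ∀ a ∈ s, x.2.freq a =
        (D.estimates (fun i => (m₀ (hash i)).2.1) (bucketVal m₀)).freq a
  have hR : ∀ s, Stable (R s) := by
    intro s m m' e hm h
    refine ⟨fun c hc => ?_, fun k => ?_, h.2.2⟩
    · rw [← h.1 c hc]
      exact (hm c (by cases c <;> simp_all [Core, Scratch])).symm
    · rw [← h.2.1 k]
      exact congrArg _ (hm _ (by simp [Scratch])).symm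
  have h1 : Det D.valProg (fun x => ∀ c, c.Core → x.1 c = m₀ c) (R ∅) :=
    (det_valProg m₀).imp (fun _ h => h) fun x hx => ⟨hx.1, hx.2, by simp⟩
  refine Det.append (h1.append (Det.forall (P := R) fun s a => ?_)) ?_
  · have h2 := det_estProg (hR s) (D.freqTerm (D.code a))
      (fun i b => D.freqTerm (D.code a) b (m₀ (hash i)).2.1 (bucketVal m₀ (i, b)))
      (fun x hx i b => by rw [hx.2.1, hx.1 (hash i) trivial])
    refine (h2.append (det_medianProg (hR s) _)).append (Det.emitFreq fun m e h => ?_)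
    refine ⟨h.1.1, h.1.2.1, fun a' ha' => ?_⟩
    by_cases hne : a' = a
    · subst hne
      simp only [Function.update_self, h.2, estimates]
    · dsimp only
      rw [Function.update_of_ne hne]
      exact h.1.2.2 a' (ha'.resolve_left hne)
  · have h2 := det_estProg (hR Set.univ) (fun _ _ y => y ^ 2)
      (fun i b => bucketVal m₀ (i, b) ^ 2)
      (fun x hx i b => by rw [hx.2.1])
    refine (h2.append (det_medianProg (hR _) _)).append (Det.emitMoment fun m e h => ?_)
    refine ⟨h.1.1, ?_⟩
    have hf : e.freq = (D.estimates (fun i => (m₀ (hash i)).2.1) (bucketVal m₀)).freq :=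
      funext fun a => h.1.2.2 a trivial
    dsimp only
    rw [hf, h.2, estimates]

/-- What the deterministic part of the program achieves. -/
def Released (m₀ : D.Cell → D.Word) (x : (D.Cell → D.Word) × Estimates U) : Prop :=
  (∀ i, x.1 (hash i) = m₀ (hash i)) ∧ (∀ k, x.1 (node k) = m₀ (node k)) ∧
    fstNum (x.1 clock) = fstNum (m₀ clock) + 1 ∧
    x.2 = D.estimates (fun i => (m₀ (hash i)).2.1) (bucketVal m₀)

/-- Choosing the resulting state abstractly forgets the scratch cells and keeps only what `Released`
records. -/
theorem exists_post (D : Sketch U) :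
    ∃ post : (D.Cell → D.Word) × Estimates U → (D.Cell → D.Word) × Estimates U,
      ∀ x, execList (D.releaseProg ++ [D.tick]) x = PMF.pure (post x) ∧
        Released x.1 (post x) := by
  classical
  suffices h : ∀ x, ∃ y, execList (D.releaseProg ++ [D.tick]) x = PMF.pure y ∧
      Released x.1 y from ⟨fun x => (h x).choose, fun x => (h x).choose_spec⟩
  intro x
  refine ((det_releaseProg x.1).append (Det.assign (Q := Released x.1) fun m e h => ?_)) x
    fun c _ => rfl
  refine ⟨fun i => ?_, fun k => ?_, ?_, h.2⟩
  · dsimp only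
    rw [Function.update_of_ne (by simp)]
    exact h.1 _ trivial
  · dsimp only
    rw [Function.update_of_ne (by simp)]
    exact h.1 _ trivial
  · have := h.1 clock trivial
    simp_all [num, fstNum]

/-- The deterministic part of the program as a function. -/
noncomputable def post (D : Sketch U) :
    (D.Cell → D.Word) × Estimates U → (D.Cell → D.Word) × Estimates U :=
  Classical.choose D.exists_post

theorem execList_post (x : (D.Cell → D.Word) × Estimates U) :
    execList (D.releaseProg ++ [D.tick]) x = PMF.pure (D.post x) :=
  (Classical.choose_spec D.exists_post x).1

theorem released_post (x : (D.Cell → D.Word) × Estimates U) : Released x.1 (D.post x) :=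
  (Classical.choose_spec D.exists_post x).2

/-- The new content of a node as a function of the memory and the noise. -/
def nodeFn (D : Sketch U) (k : D.Node) (m : D.Cell → D.Word) (z : D.Num) : D.Word :=
  D.nodeStep k.2.1 k.2.2 (m (node k)) (m (hash k.1)).2.1 (m input).1
    (ZMod.val (fstNum (m clock))) z

open Classical in
/-- One timestamp as a function of the noise. -/
noncomputable def stepFn (D : Sketch U) (a : Option U) (m : D.Cell → D.Word)
    (z : D.Node → D.Num) : (D.Cell → D.Word) × Estimates U :=
  D.post (WordInstr.scatter node D.nodeFn (enum D.Node)
    (Function.update m input (a.map D.code, default, 0, 0)) z,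
    { freq := fun _ => 0, moment := 0 })

theorem step_eq (a : Option U) (m : D.Cell → D.Word) :
    D.algorithm.step a m = (D.noise.iid D.Node).map (D.stepFn a m) := by
  classical
  have h : ∀ (m : D.Cell → D.Word) (e : Estimates U),
      execList ((enum D.Node).map (fun k => compute (D.nodeInstr k)) ++
        (D.releaseProg ++ [D.tick])) (m, e) = (D.noise.iid D.Node).map fun z =>
          D.post (WordInstr.scatter node D.nodeFn (enum D.Node) m z, e) := by
    intro m e
    rw [execList_append, ← Function.comp_def compute, ← List.map_map, execList_compute,
      WordInstr.execList_map D.noise D.nodeInstr D.nodeFn (fun k m => rfl)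
        (enum D.Node) (nodup_enum _), PMF.map_comp, PMF.bind_map, PMF.map]
    congr 1
    ext1 z
    simp only [Function.comp_apply]
    rw [execList_post]
    rfl
  exact h _ _

theorem setup_eq : WordInstr.execList D.algorithm.setup D.algorithm.start =
    ((PMF.uniformOfFintype D.Key).iid (Fin D.rows)).map D.initMem :=
  WordInstr.execList_map _ _ _ (fun _ _ => rfl) _ (nodup_enum _) _

theorem stepFn_spec (a : Option U) (m : D.Cell → D.Word) (z : D.Node → D.Num) :
    (∀ i, (D.stepFn a m z).1 (hash i) = m (hash i)) ∧
    (∀ k, (D.stepFn a m z).1 (node k) = D.nodeStep k.2.1 k.2.2 (m (node k)) (m (hash k.1)).2.1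
      (a.map D.code) (ZMod.val (fstNum (m clock))) (z k)) ∧
    fstNum ((D.stepFn a m z).1 clock) = fstNum (m clock) + 1 ∧
    (D.stepFn a m z).2 = D.estimates (fun i => (m (hash i)).2.1) (fun k =>
      ∑ j : Fin D.levels, if Nat.testBit (ZMod.val (fstNum (m clock)) + 1) j then
        sndNum ((D.stepFn a m z).1 (node (k.1, k.2, j))) else 0) := by
  classical
  have hother : ∀ c : D.Cell, (∀ k, node k ≠ c) → c ≠ input →
      WordInstr.scatter node D.nodeFn (enum D.Node)
        (Function.update m input (a.map D.code, default, 0, 0)) z c = m c := by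
    intro c hc hi
    rw [WordInstr.scatter_apply_of_forall_ne _ _ _ _ _ hc, Function.update_of_ne hi]
  have hnode : ∀ k, WordInstr.scatter node D.nodeFn (enum D.Node)
        (Function.update m input (a.map D.code, default, 0, 0)) z (node k) =
      D.nodeStep k.2.1 k.2.2 (m (node k)) (m (hash k.1)).2.1
        (a.map D.code) (ZMod.val (fstNum (m clock))) (z k) := by
    intro k
    rw [WordInstr.scatter_apply_dst _ (fun _ _ h => by simpa using h) D.nodeFn
      (fun k m m' x h h' => by
        rw [nodeFn, nodeFn, h, h' (hash k.1) (by simp), h' input (by simp),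
          h' clock (by simp)]) _ (nodup_enum _)]
    simp [mem_enum, nodeFn]
  obtain ⟨h1, h2, h3, h4⟩ := released_post (D := D) (WordInstr.scatter node D.nodeFn
    (enum D.Node) (Function.update m input (a.map D.code, default, 0, 0)) z,
    { freq := fun _ => 0, moment := 0 })
  refine ⟨fun i => ?_, fun k => ?_, ?_, ?_⟩
  · exact (h1 i).trans (hother _ (by simp) (by simp))
  · exact (h2 k).trans (hnode k)
  · exact h3.trans (congrArg (fun w => fstNum w + 1) (hother clock (by simp) (by simp)))
  · refine h4.trans ?_
    congr 1
    · funext i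
      exact congrArg (fun w => w.2.1) (hother (hash i) (by simp) (by simp))
    · funext k
      have hc := congrArg fstNum (hother clock (by simp) (by simp))
      rw [bucketVal]
      dsimp only
      rw [hc]
      refine Finset.sum_congr rfl fun j _ => ?_
      rw [show (D.stepFn a m z).1 _ = _ from h2 _]

end Sketch

/-! ### Noisy dyadic blocks and the coupling of neighbouring streams -/

namespace Sketch

open SketchCell StreamCommand StreamAlgorithm

variable {U : Type*} (D : Sketch U)

/-- The change of a bucket of a row at a timestamp. -/
def change (κ : Fin D.rows → D.Key) (S : ℕ → Option U) (i : Fin D.rows) (b : Fin D.width)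
    (s : ℕ) : ℤ :=
  D.incr (κ i) b ((S s).map D.code)

/-- The noisy sum of the changes over a dyadic block. -/
def noisyBlock (κ : Fin D.rows → D.Key) (S : ℕ → Option U) (z : ℕ → D.Node → D.Num)
    (k : D.Node) (q : ℕ) : D.Num :=
  z (q * 2 ^ (k.2.2 : ℕ)) k +
    ∑ s ∈ Finset.Ico (q * 2 ^ (k.2.2 : ℕ)) ((q + 1) * 2 ^ (k.2.2 : ℕ)),
      (D.change κ S k.1 k.2.1 s : D.Num)

/-- The noisy content of a bucket after `n` timestamps. -/
def noisyBucket (κ : Fin D.rows → D.Key) (S : ℕ → Option U) (z : ℕ → D.Node → D.Num)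
    (n : ℕ) (k : Fin D.rows × Fin D.width) : D.Num :=
  ∑ j : Fin D.levels, if Nat.testBit n j then
    D.noisyBlock κ S z (k.1, k.2, j) (n / 2 ^ (j : ℕ) - 1) else 0

theorem two_pow_le_of_testBit {n j : ℕ} (h : Nat.testBit n j = true) : 2 ^ j ≤ n :=
  Nat.ge_two_pow_of_testBit h

/-- Only the block containing `t₀` sees the changed input, and the noise drawn at the start of that
block can absorb the difference. -/
theorem noisyBlock_congr {κ : Fin D.rows → D.Key} {S S' : ℕ → Option U}
    {z z' : ℕ → D.Node → D.Num} {k : D.Node} {q t₀ : ℕ}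
    (hS : ∀ s, s ≠ t₀ → S s = S' s)
    (hz : z (q * 2 ^ (k.2.2 : ℕ)) k = z' (q * 2 ^ (k.2.2 : ℕ)) k +
      if q = t₀ / 2 ^ (k.2.2 : ℕ) then
        ((D.change κ S' k.1 k.2.1 t₀ - D.change κ S k.1 k.2.1 t₀ : ℤ) : D.Num) else 0) :
    D.noisyBlock κ S z k q = D.noisyBlock κ S' z' k q := by
  have hmem : t₀ ∈ Finset.Ico (q * 2 ^ (k.2.2 : ℕ)) ((q + 1) * 2 ^ (k.2.2 : ℕ)) ↔
      q = t₀ / 2 ^ (k.2.2 : ℕ) := by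
    rw [Finset.mem_Ico, ← Nat.le_div_iff_mul_le (by positivity),
      ← Nat.div_lt_iff_lt_mul (by positivity)]
    omega
  have hc : ∀ s, s ≠ t₀ → D.change κ S k.1 k.2.1 s = D.change κ S' k.1 k.2.1 s := fun s hs => by
    rw [change, change, hS s hs]
  rw [noisyBlock, noisyBlock, hz, add_assoc]
  congr 1
  split_ifs with hq
  · rw [← Finset.add_sum_erase _ _ (hmem.2 hq), ← Finset.add_sum_erase _ _ (hmem.2 hq),
      ← add_assoc]
    congr 1
    · push_cast; ring
    · exact Finset.sum_congr rfl fun s hs => by rw [hc s (Finset.ne_of_mem_erase hs)]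
  · rw [zero_add]
    refine Finset.sum_congr rfl fun s hs => ?_
    rw [hc s]
    rintro rfl
    exact hq (hmem.1 hs)

/-- An input hits a single bucket of a row, so the sensitivity of a row does not grow with the
width. -/
theorem sum_abs_incr_le (hsign : ∀ κ x, |D.sign κ x| ≤ 1) (κ : D.Key)
    (o : Option D.Letter) : ∑ b, |D.incr κ b o| ≤ 1 := by
  cases o with
  | none => simp [incr]
  | some x =>
    rw [Finset.sum_eq_single (D.bucket κ x)]
    · simpa [incr] using hsign κ x
    · intro b _ hb
      simp [incr, Ne.symm hb]
    · simp

/-- The change of the noise that compensates a change of the stream. -/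
def shift (κ : Fin D.rows → D.Key) (S S' : ℕ → Option U) (t₀ : ℕ) (t : ℕ) (k : D.Node) : ℤ :=
  if t = t₀ / 2 ^ (k.2.2 : ℕ) * 2 ^ (k.2.2 : ℕ) then
    D.change κ S k.1 k.2.1 t₀ - D.change κ S' k.1 k.2.1 t₀ else 0

/-- On each level `t₀` lies in one block, so a node is shifted at most at one timestamp. Each of the
two inputs contributes at most 1 per row and level. -/
theorem sum_abs_shift_le (hsign : ∀ κ x, |D.sign κ x| ≤ 1) (κ : Fin D.rows → D.Key)
    (S S' : ℕ → Option U) (t₀ T : ℕ) :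
    ∑ t : Fin T, ∑ k, |D.shift κ S S' t₀ t k| ≤ 2 * D.rows * D.levels := by
  have h1 : ∀ k : D.Node, ∑ t : Fin T, |D.shift κ S S' t₀ t k| ≤
      |D.change κ S k.1 k.2.1 t₀| + |D.change κ S' k.1 k.2.1 t₀| := by
    intro k
    refine le_trans ?_ (abs_sub _ _)
    rw [Fin.sum_univ_eq_sum_range (fun t => |D.shift κ S S' t₀ t k|)]
    simp only [shift, apply_ite abs, abs_zero]
    rw [Finset.sum_ite_eq']
    split_ifs
    · exact le_rfl
    · exact abs_nonneg _
  rw [Finset.sum_comm]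
  refine (Finset.sum_le_sum fun k _ => h1 k).trans ?_
  rw [Fintype.sum_prod_type]
  have h2 : ∀ i : Fin D.rows, ∑ x : Fin D.width × Fin D.levels,
      (|D.change κ S i x.1 t₀| + |D.change κ S' i x.1 t₀|) ≤ 2 * D.levels := by
    intro i
    rw [Fintype.sum_prod_type]
    simp only [Finset.sum_const, Finset.card_univ, Fintype.card_fin, ← Finset.smul_sum,
      Finset.sum_add_distrib]
    have ha := D.sum_abs_incr_le hsign (κ i) ((S t₀).map D.code)
    have hb := D.sum_abs_incr_le hsign (κ i) ((S' t₀).map D.code)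
    simp only [change, nsmul_eq_mul]
    have hc : (0 : ℤ) ≤ D.levels := by positivity
    nlinarith
  refine (Finset.sum_le_sum fun i _ => h2 i).trans ?_
  simp only [Finset.sum_const, Finset.card_univ, Fintype.card_fin, nsmul_eq_mul]
  exact le_of_eq (by ring)

open scoped ENNReal

theorem iid_noise_le {c : ℝ} (hc : ∀ (x : D.Num) (n : ℤ),
      D.noise x ≤ ENNReal.ofReal (Real.exp (c * |n|)) * D.noise (x + n))
    {T : ℕ} (z : Fin T → D.Node → D.Num) (n : Fin T → D.Node → ℤ) :
    (D.noise.iid D.Node).iid (Fin T) z ≤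
      ENNReal.ofReal (Real.exp (c * ((∑ t, ∑ k, |n t k| : ℤ) : ℝ))) *
        (D.noise.iid D.Node).iid (Fin T) (z + fun t k => ((n t k : ℤ) : D.Num)) := by
  have h1 : ENNReal.ofReal (Real.exp (c * ((∑ t, ∑ k, |n t k| : ℤ) : ℝ))) =
      ∏ t, ∏ k, ENNReal.ofReal (Real.exp (c * |n t k|)) := by
    simp only [← ENNReal.ofReal_prod_of_nonneg (fun _ _ => (Real.exp_pos _).le),
      ← Real.exp_sum, ← Finset.mul_sum, Int.cast_sum]
  rw [h1, PMF.iid_apply, PMF.iid_apply, ← Finset.prod_mul_distrib]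
  refine Finset.prod_le_prod' fun t _ => ?_
  rw [PMF.iid_apply, PMF.iid_apply, ← Finset.prod_mul_distrib]
  exact Finset.prod_le_prod' fun k _ => by simpa using hc (z t k) (n t k)

/-- The output history as a function of the hash functions and the noise. -/
noncomputable def history {T : ℕ} (S : ElementStream U T) (κ : Fin D.rows → D.Key)
    (z : Fin T → D.Node → D.Num) (t : Fin T) : Estimates U :=
  D.estimates κ (D.noisyBucket κ (Fin.extend none S) (Fin.extend 0 z) (t + 1))

/-- The coupling behind privacy: with the hash functions fixed, a translation of the noise turns one
stream into the other without any visible trace. -/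
theorem history_shift {T : ℕ} (κ : Fin D.rows → D.Key) (S S' : ElementStream U T)
    (t₀ : Fin T) (hS : ∀ s, s ≠ t₀ → S s = S' s) (z : Fin T → D.Node → D.Num) :
    D.history S κ z = D.history S' κ (z + fun (t : Fin T) k =>
      ((D.shift κ (Fin.extend none S) (Fin.extend none S') t₀ t k : ℤ) : D.Num)) := by
  have hS' : ∀ s : ℕ, s ≠ t₀ → (Fin.extend none S : ℕ → Option U) s = Fin.extend none S' s := by
    intro s hs
    by_cases h : s < T
    · rw [Fin.extend_of_lt _ _ h, Fin.extend_of_lt _ _ h]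
      exact hS _ fun e => hs (by rw [← e])
    · rw [Fin.extend, Fin.extend, dif_neg h, dif_neg h]
  funext t
  rw [history, history]
  congr 1
  funext k
  refine Finset.sum_congr rfl fun j _ => ?_
  split_ifs
  · refine D.noisyBlock_congr hS' ?_
    dsimp only
    generalize ((t : ℕ) + 1) / 2 ^ (j : ℕ) - 1 = q
    have hq : q = t₀ / 2 ^ (j : ℕ) ↔ q * 2 ^ (j : ℕ) = t₀ / 2 ^ (j : ℕ) * 2 ^ (j : ℕ) :=
      (Nat.mul_left_inj (by positivity)).symm
    by_cases h : q * 2 ^ (j : ℕ) < T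
    · rw [Fin.extend_of_lt _ _ h, Fin.extend_of_lt _ _ h]
      simp only [Pi.add_apply, shift, ← hq]
      split_ifs
      · push_cast; ring
      · simp
    -- A block that starts at or after `T` has no actual draw to shift, but it cannot contain `t₀ <
    -- T` either.
    · have hne : ¬ q = t₀ / 2 ^ (j : ℕ) := by
        rw [hq]
        intro e
        exact h (e ▸ (Nat.div_mul_le_self _ _).trans_lt t₀.2)
      rw [Fin.extend, Fin.extend, dif_neg h, dif_neg h, if_neg hne, add_zero]
  · rfl

variable [Fintype U]

variable {D} in
-- The invariant of the tree mechanism after `t` inputs. The running sum is specified only inside a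
-- block, since at a block boundary it is about to be replaced by fresh noise; the completed block
-- only once there is one.
theorem memAt_spec (κ : Fin D.rows → D.Key) (S : ℕ → Option U) (z : ℕ → D.Node → D.Num)
    (t : ℕ) (ht : t < D.modulus) :
    (∀ i, (memAt D.stepFn (D.initMem κ) S z t (hash i)).2.1 = κ i) ∧
    ZMod.val (fstNum (memAt D.stepFn (D.initMem κ) S z t clock)) = t ∧
    (∀ k : D.Node, ¬ 2 ^ (k.2.2 : ℕ) ∣ t →
      fstNum (memAt D.stepFn (D.initMem κ) S z t (node k)) =
        z (t / 2 ^ (k.2.2 : ℕ) * 2 ^ (k.2.2 : ℕ)) k +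
          ∑ s ∈ Finset.Ico (t / 2 ^ (k.2.2 : ℕ) * 2 ^ (k.2.2 : ℕ)) t,
            (D.change κ S k.1 k.2.1 s : D.Num)) ∧
    (∀ k : D.Node, 2 ^ (k.2.2 : ℕ) ≤ t →
      sndNum (memAt D.stepFn (D.initMem κ) S z t (node k)) =
        D.noisyBlock κ S z k (t / 2 ^ (k.2.2 : ℕ) - 1)) := by
  induction t with
  | zero =>
    refine ⟨fun i => initMem_hash κ i, ?_, fun k h => absurd (dvd_zero _) h, fun k h => ?_⟩
    · simp only [memAt, initMem_clock, ZMod.val_zero]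
    · exact absurd h (by simp)
  | succ t ih =>
    obtain ⟨ih1, ih2, ih3, ih4⟩ := ih (by omega)
    obtain ⟨h1, h2, h3, -⟩ := stepFn_spec (S t) (memAt D.stepFn (D.initMem κ) S z t) (z t)
    have hclock : fstNum (memAt D.stepFn (D.initMem κ) S z t clock) = (t : D.Num) := by
      rw [← ih2, ZMod.natCast_zmod_val, ih2]
    -- The running sum after the current input. If a block starts at `t`, the sum before `t` is
    -- empty and only the fresh noise remains.
    have hA : ∀ k : D.Node,
        (if 2 ^ (k.2.2 : ℕ) ∣ t then z t k else
          fstNum (memAt D.stepFn (D.initMem κ) S z t (node k))) +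
            (D.change κ S k.1 k.2.1 t : D.Num) =
        z (t / 2 ^ (k.2.2 : ℕ) * 2 ^ (k.2.2 : ℕ)) k +
          ∑ s ∈ Finset.Ico (t / 2 ^ (k.2.2 : ℕ) * 2 ^ (k.2.2 : ℕ)) (t + 1),
            (D.change κ S k.1 k.2.1 s : D.Num) := by
      intro k
      rw [Finset.sum_Ico_succ_top (Nat.div_mul_le_self _ _), ← add_assoc]
      congr 1
      split_ifs with hd
      · rw [Nat.div_mul_cancel hd]; simp
      · exact ih3 k hd
    simp only [memAt]
    refine ⟨fun i => (congrArg (fun w => w.2.1) (h1 i)).trans (ih1 i), ?_, fun k hk => ?_,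
      fun k hk => ?_⟩
    · rw [h3, hclock, ← Nat.cast_succ, ZMod.val_natCast_of_lt ht]
    · rw [h2, ih2, ih1]
      refine (hA k).trans ?_
      rw [Nat.succ_div_of_not_dvd hk]
    · rw [h2, ih2, ih1]
      simp only [nodeStep, sndNum, num]
      by_cases hd : 2 ^ (k.2.2 : ℕ) ∣ t + 1
      · rw [if_pos hd]
        refine (hA k).trans ?_
        have e : (t + 1) / 2 ^ (k.2.2 : ℕ) = t / 2 ^ (k.2.2 : ℕ) + 1 := Nat.succ_div_of_dvd hd
        rw [noisyBlock, e, Nat.add_sub_cancel, ← e, Nat.div_mul_cancel hd]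
      · rw [if_neg hd, Nat.succ_div_of_not_dvd hd]
        exact ih4 k (Nat.lt_succ_iff.1 (lt_of_le_of_ne hk fun h => hd (by rw [h])))

variable {D} in
theorem outAt_eq (κ : Fin D.rows → D.Key) (S : ℕ → Option U) (z : ℕ → D.Node → D.Num)
    (t : ℕ) (ht : t + 1 < D.modulus) :
    outAt D.stepFn (D.initMem κ) S z t = D.estimates κ (D.noisyBucket κ S z (t + 1)) := by
  obtain ⟨ih1, ih2, -, -⟩ := memAt_spec κ S z t (by omega)
  obtain ⟨-, -, -, ih4⟩ := memAt_spec κ S z (t + 1) ht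
  refine (stepFn_spec (S t) (memAt D.stepFn (D.initMem κ) S z t) (z t)).2.2.2.trans ?_
  simp only [ih1, ih2]
  congr 1
  funext k
  refine Finset.sum_congr rfl fun j _ => ?_
  split_ifs with h
  · exact ih4 (k.1, k.2, j) (two_pow_le_of_testBit h)
  · rfl

/-- The distribution of the hash functions and the noise. -/
noncomputable def seeds (T : ℕ) : PMF ((Fin D.rows → D.Key) × (Fin T → D.Node → D.Num)) :=
  ((PMF.uniformOfFintype D.Key).iid (Fin D.rows)).bind fun κ =>
    ((D.noise.iid D.Node).iid (Fin T)).map fun z => (κ, z)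

/-- This removes the machine: privacy and accuracy become statements about `history`. The bound on
the modulus keeps the clock from wrapping round. -/
theorem outputs_eq {T : ℕ} (hT : T < D.modulus) (S : ElementStream U T) :
    D.algorithm.outputs S = (D.seeds T).map fun x => D.history S x.1 x.2 := by
  have h := run_eq D.algorithm (setup_eq (D := D)) step_eq (Fin.extend none S) 0 T
  have hS : (fun t : Fin T => Fin.extend none S t) = S :=
    funext fun t => Fin.extend_of_lt _ _ t.2
  rw [hS] at h
  rw [outputs, h, seeds, PMF.map_bind, PMF.map_bind]
  congr 1
  funext κ
  rw [PMF.map_comp, PMF.map_comp]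
  congr 1
  funext z t
  exact outAt_eq _ _ _ _ (by omega)

/-! ### Privacy -/

/-- The keys have the same law for both streams, so it suffices to compare for each fixed `κ`. There
`history_shift` reindexes the sum over the noise by a translation, at the price given by
`iid_noise_le`. -/
theorem isDP {T : ℕ} (hT : T < D.modulus) (hsign : ∀ κ x, |D.sign κ x| ≤ 1) {c ε : ℝ}
    (hc0 : 0 ≤ c) (hε : c * (2 * D.rows * D.levels) ≤ ε)
    (hc : ∀ (x : D.Num) (n : ℤ),
      D.noise x ≤ ENNReal.ofReal (Real.exp (c * |n|)) * D.noise (x + n)) :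
    D.algorithm.IsDP T ε := by
  intro S S' hN O
  have hε0 : 0 ≤ ε := le_trans (by positivity) hε
  by_cases hex : ∃ t₀, S t₀ ≠ S' t₀
  swap
  · push Not at hex
    rw [funext hex]
    exact le_mul_of_one_le_left (by simp) (by simpa using hε0)
  obtain ⟨t₀, ht₀⟩ := hex
  have hS : ∀ s, s ≠ t₀ → S s = S' s := fun s hs => by
    by_contra h
    exact hs (hN h ht₀)
  simp only [prob, D.outputs_eq hT, seeds, PMF.map_bind, PMF.map_comp]
  rw [PMF.toOuterMeasure_bind_apply, PMF.toOuterMeasure_bind_apply, ← ENNReal.tsum_mul_left]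
  refine ENNReal.tsum_le_tsum fun κ => ?_
  rw [mul_left_comm]
  gcongr
  rw [PMF.toOuterMeasure_map_apply, PMF.toOuterMeasure_map_apply,
    PMF.toOuterMeasure_apply_fintype, PMF.toOuterMeasure_apply_fintype, Finset.mul_sum]
  let n : Fin T → D.Node → ℤ :=
    fun t k => D.shift κ (Fin.extend none S) (Fin.extend none S') t₀ t k
  refine le_trans (Finset.sum_le_sum fun z _ => ?_)
    (Equiv.sum_comp (Equiv.addRight fun t k => ((n t k : ℤ) : D.Num)) _).le
  classical
  simp only [Set.indicator_apply, Set.mem_preimage, Function.comp_apply, Equiv.coe_addRight]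
  rw [D.history_shift κ S S' t₀ hS z]
  split_ifs
  · refine (D.iid_noise_le hc z n).trans ?_
    gcongr
    refine le_trans ?_ hε
    gcongr
    exact_mod_cast D.sum_abs_shift_le hsign κ _ _ t₀ T
  · simp

end Sketch

/-! ### Noise on a cyclic group -/

namespace ZMod

theorem valMinAbs_intCast_of_two_mul_abs_lt {n : ℕ} [NeZero n] {k : ℤ} (h : 2 * |k| < n) :
    ((k : ℤ) : ZMod n).valMinAbs = k := by
  rw [valMinAbs_spec]
  obtain ⟨h1, h2⟩ := abs_lt.1 (show |2 * k| < n by rwa [abs_mul, abs_two])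
  exact ⟨rfl, by omega, by omega⟩

/-- This supplies the triangle inequality on the cyclic group that `laplace_le` needs. -/
theorem abs_valMinAbs_le_of_intCast_eq {n : ℕ} [NeZero n] {x : ZMod n} {k : ℤ}
    (h : (k : ZMod n) = x) : |x.valMinAbs| ≤ |k| := by
  rw [Int.abs_eq_natAbs, Int.abs_eq_natAbs]
  have hx := natAbs_valMinAbs_le x
  by_contra hlt
  push Not at hlt
  have h2 : 2 * |k| < n := by
    rw [Int.abs_eq_natAbs]
    omega
  rw [← h, valMinAbs_intCast_of_two_mul_abs_lt h2] at hlt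
  exact absurd hlt (lt_irrefl _)

/-- The weights of the discrete Laplace distribution on a cyclic group. -/
noncomputable def laplaceWeight {n : ℕ} (c : ℝ) (x : ZMod n) : ℝ :=
  Real.exp (-(c * |x.valMinAbs|))

theorem laplaceWeight_pos {n : ℕ} (c : ℝ) (x : ZMod n) : 0 < laplaceWeight c x :=
  Real.exp_pos _

theorem sum_laplaceWeight_pos {n : ℕ} [NeZero n] (c : ℝ) :
    0 < ∑ x : ZMod n, laplaceWeight c x :=
  Finset.sum_pos (fun _ _ => laplaceWeight_pos _ _) ⟨0, Finset.mem_univ _⟩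

/-- The discrete Laplace distribution on a cyclic group. -/
noncomputable def laplace (n : ℕ) [NeZero n] (c : ℝ) : PMF (ZMod n) :=
  PMF.ofFintype
    (fun x => ENNReal.ofReal (laplaceWeight c x / ∑ y : ZMod n, laplaceWeight c y)) (by
    rw [← ENNReal.ofReal_sum_of_nonneg fun x _ =>
      (div_pos (laplaceWeight_pos _ _) (sum_laplaceWeight_pos c)).le, ← Finset.sum_div,
      div_self (sum_laplaceWeight_pos c).ne', ENNReal.ofReal_one])

theorem laplace_apply {n : ℕ} [NeZero n] (c : ℝ) (x : ZMod n) : laplace n c x =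
    ENNReal.ofReal (laplaceWeight c x / ∑ y : ZMod n, laplaceWeight c y) := rfl

theorem laplace_le {n : ℕ} [NeZero n] {c : ℝ} (hc : 0 ≤ c) (x : ZMod n) (k : ℤ) :
    laplace n c x ≤ ENNReal.ofReal (Real.exp (c * |k|)) * laplace n c (x + k) := by
  rw [laplace_apply, laplace_apply, ← ENNReal.ofReal_mul (Real.exp_pos _).le, ← mul_div_assoc]
  refine ENNReal.ofReal_le_ofReal ?_
  refine div_le_div_of_nonneg_right ?_ (sum_laplaceWeight_pos c).le
  rw [laplaceWeight, laplaceWeight, ← Real.exp_add, Real.exp_le_exp]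
  have h : |(x + k).valMinAbs| ≤ |x.valMinAbs| + |k| :=
    (abs_valMinAbs_le_of_intCast_eq (k := x.valMinAbs + k) (by push_cast; simp)).trans
      (abs_add_le _ _)
  have h' : ((|(x + k).valMinAbs| : ℤ) : ℝ) ≤ (|x.valMinAbs| : ℤ) + (|k| : ℤ) := by
    exact_mod_cast h
  nlinarith

/-- Truncation towards zero, unlike the floor, at least halves the absolute value on both sides of
zero, and it is at most three-to-one. -/
theorem _root_.Int.tdiv_two_bounds (k : ℤ) :
    2 * |k.tdiv 2| ≤ |k| ∧ 2 * k.tdiv 2 - 1 ≤ k ∧ k ≤ 2 * k.tdiv 2 + 1 := by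
  rcases le_total 0 k with h | h
  · rw [Int.tdiv_eq_ediv_of_nonneg h, abs_of_nonneg h, abs_of_nonneg (by omega)]
    omega
  · obtain ⟨l, rfl⟩ : ∃ l, k = -l := ⟨-k, by simp⟩
    rw [Int.neg_tdiv, Int.tdiv_eq_ediv_of_nonneg (by omega), abs_neg, abs_neg,
      abs_of_nonneg (by omega), abs_of_nonneg (by omega)]
    omega

/-- Halving sends `x` to a point whose weight at parameter `c` is at least the weight of `x` at
parameter `c / 2`, and its fibres have at most three points. The bound is uniform in `n` and `c`. -/
theorem sum_laplaceWeight_half_le {n : ℕ} [NeZero n] {c : ℝ} (hc : 0 ≤ c) :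
    ∑ x : ZMod n, laplaceWeight (c / 2) x ≤ 3 * ∑ x : ZMod n, laplaceWeight c x := by
  classical
  let f : ZMod n → ZMod n := fun x => ((x.valMinAbs.tdiv 2 : ℤ) : ZMod n)
  have hf : ∀ x, (f x).valMinAbs = x.valMinAbs.tdiv 2 := by
    intro x
    have hx := natAbs_valMinAbs_le x
    have hn := NeZero.pos n
    have h2 := (Int.tdiv_two_bounds x.valMinAbs).1
    refine valMinAbs_intCast_of_two_mul_abs_lt ?_
    rw [Int.abs_eq_natAbs, Int.abs_eq_natAbs] at *
    omega
  have h1 : ∀ x, laplaceWeight (c / 2) x ≤ laplaceWeight c (f x) := by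
    intro x
    rw [laplaceWeight, laplaceWeight, hf, Real.exp_le_exp]
    have h2 : (2 : ℝ) * (|x.valMinAbs.tdiv 2| : ℤ) ≤ (|x.valMinAbs| : ℤ) := by
      exact_mod_cast (Int.tdiv_two_bounds x.valMinAbs).1
    nlinarith
  have h2 : ∀ y, (Finset.univ.filter fun x => f x = y).card ≤ 3 := by
    intro y
    have hsub : (Finset.univ.filter fun x => f x = y).image valMinAbs ⊆
        {2 * y.valMinAbs - 1, 2 * y.valMinAbs, 2 * y.valMinAbs + 1} := by
      intro k hk
      simp only [Finset.mem_image, Finset.mem_filter, Finset.mem_univ, true_and] at hk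
      obtain ⟨x, hx, rfl⟩ := hk
      have := hf x
      have hb := (Int.tdiv_two_bounds x.valMinAbs).2
      rw [hx] at this
      simp only [Finset.mem_insert, Finset.mem_singleton]
      omega
    rw [← Finset.card_image_of_injective _ injective_valMinAbs]
    exact (Finset.card_le_card hsub).trans Finset.card_le_three
  calc ∑ x : ZMod n, laplaceWeight (c / 2) x ≤ ∑ x : ZMod n, laplaceWeight c (f x) :=
        Finset.sum_le_sum fun x _ => h1 x
    _ = ∑ y : ZMod n, ∑ x with f x = y, laplaceWeight c (f x) :=
        (Finset.sum_fiberwise _ f _).symm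
    _ ≤ ∑ y : ZMod n, 3 * laplaceWeight c y := by
        refine Finset.sum_le_sum fun y _ => ?_
        rw [Finset.sum_congr rfl fun x hx => by rw [(Finset.mem_filter.1 hx).2],
          Finset.sum_const, nsmul_eq_mul]
        exact mul_le_mul_of_nonneg_right (by exact_mod_cast h2 y) (laplaceWeight_pos _ _).le
    _ = _ := by rw [Finset.mul_sum]

open scoped ENNReal in
-- Tilting by the exponential halves the Laplace parameter, so the moment is a quotient of two
-- normalising sums.
theorem sum_laplace_mul_exp_le {n : ℕ} [NeZero n] {c : ℝ} (hc : 0 ≤ c) :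
    ∑ x : ZMod n, laplace n c x * ENNReal.ofReal (Real.exp (c / 2 * |x.valMinAbs|)) ≤ 3 := by
  have hZ := sum_laplaceWeight_pos (n := n) c
  have h1 : ∀ x : ZMod n, laplace n c x * ENNReal.ofReal (Real.exp (c / 2 * |x.valMinAbs|)) =
      ENNReal.ofReal (laplaceWeight (c / 2) x / ∑ y : ZMod n, laplaceWeight c y) := by
    intro x
    rw [laplace_apply, ← ENNReal.ofReal_mul (div_pos (laplaceWeight_pos _ _) hZ).le,
      div_mul_eq_mul_div, laplaceWeight, laplaceWeight, ← Real.exp_add]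
    congr 3
    ring
  rw [Finset.sum_congr rfl fun x _ => h1 x, ← ENNReal.ofReal_sum_of_nonneg fun x _ =>
    (div_pos (laplaceWeight_pos _ _) hZ).le, ← Finset.sum_div]
  refine ENNReal.ofReal_le_of_le_toReal ?_
  rw [div_le_iff₀ hZ]
  simpa using sum_laplaceWeight_half_le hc

end ZMod

/-! ### Dyadic decomposition -/

/-- The block at a binary digit 1 of `n` lies between the truncations of `n` to multiples of `2 ^ (j
+ 1)` and of `2 ^ j`; at a digit 0 the truncations agree. So the sum telescopes from `n` down to 0.
-/
theorem sum_dyadic_eq (x : ℕ → ℤ) (n J : ℕ) (hn : n < 2 ^ J) :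
    (∑ j : Fin J, if Nat.testBit n j then
      ∑ s ∈ Finset.Ico ((n / 2 ^ (j : ℕ) - 1) * 2 ^ (j : ℕ))
        ((n / 2 ^ (j : ℕ) - 1 + 1) * 2 ^ (j : ℕ)), x s else 0) = ∑ s ∈ Finset.range n, x s := by
  have h : ∀ j, (if Nat.testBit n j then
      ∑ s ∈ Finset.Ico ((n / 2 ^ j - 1) * 2 ^ j) ((n / 2 ^ j - 1 + 1) * 2 ^ j), x s else 0) =
      ∑ s ∈ Finset.range (n / 2 ^ j * 2 ^ j), x s -
        ∑ s ∈ Finset.range (n / 2 ^ (j + 1) * 2 ^ (j + 1)), x s := by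
    intro j
    have hd : n / 2 ^ (j + 1) = n / 2 ^ j / 2 := by rw [pow_succ, Nat.div_div_eq_div_mul]
    rw [Nat.testBit_eq_decide_div_mod_eq, hd]
    generalize n / 2 ^ j = q
    by_cases hq : q % 2 = 1
    · have e1 : q - 1 + 1 = q := by omega
      have e2 : q / 2 * 2 ^ (j + 1) = (q - 1) * 2 ^ j := by
        rw [pow_succ', ← mul_assoc]
        congr 1
        omega
      rw [if_pos (by simpa using hq), e1, e2, Finset.sum_Ico_eq_sub]
      exact Nat.mul_le_mul_right _ (Nat.sub_le _ _)
    · have e2 : q / 2 * 2 ^ (j + 1) = q * 2 ^ j := by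
        rw [pow_succ', ← mul_assoc]
        congr 1
        omega
      rw [if_neg (by simpa using hq), e2, sub_self]
  rw [Finset.sum_congr rfl fun (j : Fin J) _ => h j,
    Fin.sum_univ_eq_sum_range (fun j => ∑ s ∈ Finset.range (n / 2 ^ j * 2 ^ j), x s -
        ∑ s ∈ Finset.range (n / 2 ^ (j + 1) * 2 ^ (j + 1)), x s) J, Finset.sum_range_sub']
  simp [Nat.div_eq_of_lt hn]

/-! ### The noise in a bucket and its tail -/

namespace Sketch

variable {U : Type*} (D : Sketch U)

/-- The exact content of a bucket after `n` timestamps. -/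
def trueBucket (κ : Fin D.rows → D.Key) (S : ℕ → Option U) (n : ℕ)
    (k : Fin D.rows × Fin D.width) : ℤ :=
  ∑ s ∈ Finset.range n, D.change κ S k.1 k.2 s

/-- The noise in a bucket after `n` timestamps. -/
def bucketNoise (z : ℕ → D.Node → D.Num) (n : ℕ) (k : Fin D.rows × Fin D.width) : ℤ :=
  ∑ j : Fin D.levels, if Nat.testBit n j then
    (z ((n / 2 ^ (j : ℕ) - 1) * 2 ^ (j : ℕ)) (k.1, k.2, j)).valMinAbs else 0

theorem noisyBucket_eq (κ : Fin D.rows → D.Key) (S : ℕ → Option U) (z : ℕ → D.Node → D.Num)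
    (n : ℕ) (hn : n < 2 ^ D.levels) (k : Fin D.rows × Fin D.width) :
    D.noisyBucket κ S z n k = ((D.trueBucket κ S n k + D.bucketNoise z n k : ℤ) : D.Num) := by
  rw [trueBucket, ← sum_dyadic_eq _ _ _ hn, bucketNoise, ← Finset.sum_add_distrib, noisyBucket,
    Int.cast_sum]
  refine Finset.sum_congr rfl fun j _ => ?_
  split_ifs
  · rw [noisyBlock, Int.cast_add, ZMod.coe_valMinAbs, Int.cast_sum, add_comm]
  · simp

open scoped ENNReal

/-- Chernoff's method: at most one draw per level enters the bucket, and each has exponential moment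
at most 3. -/
theorem prob_bucketNoise_le {c : ℝ} (hc0 : 0 ≤ c)
    (hc : ∑ x : D.Num, D.noise x * ENNReal.ofReal (Real.exp (c * |x.valMinAbs|)) ≤ 3)
    {T n : ℕ} (hn : n ≤ T) (k : Fin D.rows × Fin D.width) (N : ℝ) :
    ((D.noise.iid D.Node).iid (Fin T)).toOuterMeasure
        {z | N ≤ |D.bucketNoise (Fin.extend 0 z) n k|} ≤
      ENNReal.ofReal (Real.exp (-(c * N)) * 3 ^ D.levels) := by
  classical
  -- The draws that enter the bucket at time `n`; for each level at most one timestamp qualifies.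
  let used : Fin T → D.Node → Prop := fun t k' =>
    (k'.1 = k.1 ∧ k'.2.1 = k.2 ∧ Nat.testBit n k'.2.2) ∧
      (t : ℕ) = (n / 2 ^ (k'.2.2 : ℕ) - 1) * 2 ^ (k'.2.2 : ℕ)
  let g : Fin T → D.Node → D.Num → ℝ≥0∞ := fun t k' x =>
    if used t k' then ENNReal.ofReal (Real.exp (c * |x.valMinAbs|)) else 1
  have hE : ∑ z, ((D.noise.iid D.Node).iid (Fin T)) z * ∏ t, ∏ k', g t k' (z t k') ≤
      3 ^ D.levels := by
    rw [PMF.sum_iid_mul_prod (D.noise.iid D.Node) fun t y => ∏ k', g t k' (y k')]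
    have h1 : ∀ t k', ∑ x, D.noise x * g t k' x ≤ if used t k' then 3 else 1 := by
      intro t k'
      by_cases hu : used t k'
      · simpa [g, hu] using hc
      · simp [g, hu, D.noise.sum_coe]
    calc ∏ t, ∑ y, D.noise.iid D.Node y * ∏ k', g t k' (y k')
        = ∏ t, ∏ k', ∑ x, D.noise x * g t k' x :=
          Finset.prod_congr rfl fun t _ => PMF.sum_iid_mul_prod D.noise (g t)
      _ ≤ ∏ t, ∏ k', (if used t k' then 3 else 1) :=
          Finset.prod_le_prod' fun t _ => Finset.prod_le_prod' fun k' _ => h1 t k'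
      _ = ∏ k', ∏ t, (if used t k' then 3 else 1) := Finset.prod_comm
      _ ≤ ∏ k' : D.Node, (if k'.1 = k.1 ∧ k'.2.1 = k.2 then 3 else 1) := by
          refine Finset.prod_le_prod' fun k' _ => ?_
          rw [Finset.prod_ite, Finset.prod_const_one, mul_one, Finset.prod_const]
          split_ifs with hk
          · refine (pow_le_pow_right₀ (by norm_num) (Finset.card_le_one.2 ?_)).trans
              (pow_one _).le
            intro a ha b hb
            simp only [used, Finset.mem_filter] at ha hb
            exact Fin.ext (ha.2.2.trans hb.2.2.symm)
          · rw [Finset.filter_false_of_mem fun t _ hu => hk ⟨hu.1.1, hu.1.2.1⟩]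
            simp
      _ = 3 ^ D.levels := by
          rw [Finset.prod_ite, Finset.prod_const_one, mul_one, Finset.prod_const]
          congr 1
          rw [show (Finset.univ.filter fun k' : D.Node => k'.1 = k.1 ∧ k'.2.1 = k.2) =
            Finset.univ.image fun j : Fin D.levels => (k.1, k.2, j) by
              ext ⟨a, b, j⟩
              simp [eq_comm], Finset.card_image_of_injective _ fun a b h => by simpa using h]
          simp
  have hM := PMF.mul_toOuterMeasure_le_sum ((D.noise.iid D.Node).iid (Fin T))
    {z | N ≤ |D.bucketNoise (Fin.extend 0 z) n k|} (ENNReal.ofReal (Real.exp (c * N)))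
    (fun z => ∏ t, ∏ k', g t k' (z t k')) (fun z hz => by
      -- A used block lies within the first `n ≤ T` inputs, so `Fin.extend` reads a genuine draw.
      have h0 : ∀ j : Fin D.levels, Nat.testBit n j →
          (n / 2 ^ (j : ℕ) - 1) * 2 ^ (j : ℕ) < T := by
        intro j hj
        have h2 := two_pow_le_of_testBit hj
        have h3 : 0 < n / 2 ^ (j : ℕ) := Nat.div_pos h2 (by positivity)
        calc (n / 2 ^ (j : ℕ) - 1) * 2 ^ (j : ℕ) < n / 2 ^ (j : ℕ) * 2 ^ (j : ℕ) :=
              Nat.mul_lt_mul_of_pos_right (by omega) (by positivity)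
          _ ≤ n := Nat.div_mul_le_self _ _
          _ ≤ T := hn
      have hone : ∀ t k', 1 ≤ g t k' (z t k') := by
        intro t k'
        simp only [g]
        split_ifs
        · rw [ENNReal.one_le_ofReal]
          exact Real.one_le_exp (by positivity)
        · exact le_rfl
      have h1 : ENNReal.ofReal (Real.exp (c * N)) ≤ ∏ j : Fin D.levels,
          if Nat.testBit n j then ENNReal.ofReal (Real.exp (c *
            |((Fin.extend 0 z : ℕ → D.Node → D.Num) ((n / 2 ^ (j : ℕ) - 1) * 2 ^ (j : ℕ))
              (k.1, k.2, j)).valMinAbs|)) else 1 := by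
        rw [show (∏ j : Fin D.levels,
          if Nat.testBit n j then ENNReal.ofReal (Real.exp (c *
            |((Fin.extend 0 z : ℕ → D.Node → D.Num) ((n / 2 ^ (j : ℕ) - 1) * 2 ^ (j : ℕ))
              (k.1, k.2, j)).valMinAbs|)) else 1) = ∏ j : Fin D.levels,
          ENNReal.ofReal (Real.exp (c * |if Nat.testBit n j then
            ((Fin.extend 0 z : ℕ → D.Node → D.Num) ((n / 2 ^ (j : ℕ) - 1) * 2 ^ (j : ℕ))
              (k.1, k.2, j)).valMinAbs else 0|)) from
            Finset.prod_congr rfl fun j _ => by split_ifs <;> simp,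
          ← ENNReal.ofReal_prod_of_nonneg (fun _ _ => (Real.exp_pos _).le), ← Real.exp_sum,
          ← Finset.mul_sum]
        refine ENNReal.ofReal_le_ofReal (Real.exp_le_exp.2 (mul_le_mul_of_nonneg_left ?_ hc0))
        refine le_trans hz ?_
        rw [bucketNoise, ← Int.cast_sum]
        exact_mod_cast Finset.abs_sum_le_sum_abs _ _
      refine h1.trans ?_
      have h2 : ∀ j : Fin D.levels, (if Nat.testBit n j then ENNReal.ofReal (Real.exp (c *
            |((Fin.extend 0 z : ℕ → D.Node → D.Num) ((n / 2 ^ (j : ℕ) - 1) * 2 ^ (j : ℕ))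
              (k.1, k.2, j)).valMinAbs|)) else 1) ≤ ∏ t, g t (k.1, k.2, j) (z t (k.1, k.2, j)) := by
        intro j
        split_ifs with hj
        · refine le_trans (le_of_eq ?_) (Finset.single_le_prod' (fun t _ => hone t (k.1, k.2, j))
            (Finset.mem_univ ⟨_, h0 j hj⟩))
          rw [Fin.extend_of_lt _ _ (h0 j hj)]
          simp [g, used, hj]
        · exact Finset.one_le_prod' fun t _ => hone t _
      refine (Finset.prod_le_prod' fun j _ => h2 j).trans ?_
      rw [Finset.prod_comm]
      refine Finset.prod_le_prod' fun t _ => ?_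
      rw [← Finset.prod_image (s := Finset.univ) (g := fun j : Fin D.levels => (k.1, k.2, j))
        (f := fun k' => g t k' (z t k')) (fun a _ b _ h => by simpa using h)]
      exact Finset.prod_le_univ_prod_of_one_le' fun k' => hone t k')
  have hfin := hM.trans hE
  rw [Real.exp_neg, ENNReal.ofReal_mul (by positivity), ENNReal.ofReal_inv_of_pos (Real.exp_pos _),
    ENNReal.ofReal_pow (by norm_num)]
  rw [mul_comm, ← ENNReal.le_div_iff_mul_le (Or.inl (by simp [Real.exp_pos]))
    (Or.inl ENNReal.ofReal_ne_top), ENNReal.div_eq_inv_mul] at hfin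
  simpa using hfin

end Sketch

/-! ### The median -/

theorem List.foldl_ite_mem {ι α : Type*} (p : ι → Prop) [DecidablePred p] (f : ι → α)
    (l : List ι) (a : α) (h : ∃ i ∈ l, p i) :
    ∃ i, p i ∧ l.foldl (fun acc i => if p i then f i else acc) a = f i := by
  induction l using List.reverseRecOn with
  | nil => simp at h
  | append_singleton l i ih =>
    rw [List.foldl_append, List.foldl_cons, List.foldl_nil]
    by_cases hi : p i
    · exact ⟨i, hi, if_pos hi⟩
    · rw [if_neg hi]
      obtain ⟨i', hi', hp⟩ := h
      rcases List.mem_append.1 hi' with h' | h'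
      · exact ih ⟨i', h', hp⟩
      · rw [List.mem_singleton.1 h'] at hp
        exact absurd hp hi

/-- Every nonempty finite family of integers has a median. -/
theorem exists_central {d : ℕ} (hd : 0 < d) (k : Fin d → ℤ) :
    ∃ i, d < 2 * (Finset.univ.filter fun i' => k i' ≤ k i).card ∧
      d ≤ 2 * (Finset.univ.filter fun i' => k i ≤ k i').card := by
  classical
  have : Nonempty (Fin d) := ⟨⟨0, hd⟩⟩
  -- The median is an index of least value in `A`. The values strictly below it then make up at most
  -- half of the family, for otherwise the largest of them would belong to `A`.
  let A := Finset.univ.filter fun i => d < 2 * (Finset.univ.filter fun i' => k i' ≤ k i).card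
  have hA : A.Nonempty := by
    obtain ⟨i, -, hi⟩ := Finset.exists_max_image Finset.univ k Finset.univ_nonempty
    refine ⟨i, Finset.mem_filter.2 ⟨Finset.mem_univ _, ?_⟩⟩
    rw [Finset.filter_true_of_mem hi]
    simp
    omega
  obtain ⟨i, hi, hmin⟩ := Finset.exists_min_image A k hA
  refine ⟨i, (Finset.mem_filter.1 hi).2, ?_⟩
  have hc := Finset.card_filter_add_card_filter_not (s := Finset.univ) fun i' => k i ≤ k i'
  simp only [Finset.card_univ, Fintype.card_fin, not_le] at hc
  rcases (Finset.univ.filter fun i' => k i' < k i).eq_empty_or_nonempty with h0 | hne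
  · rw [h0, Finset.card_empty] at hc
    omega
  · obtain ⟨i₂, hi₂, hmax⟩ := Finset.exists_max_image _ k hne
    have hlt := (Finset.mem_filter.1 hi₂).2
    have hnot : i₂ ∉ A := fun h => absurd (hmin i₂ h) (not_le.2 hlt)
    have heq : (Finset.univ.filter fun i' => k i' ≤ k i₂) =
        Finset.univ.filter fun i' => k i' < k i := by
      ext i'
      simp only [Finset.mem_filter, Finset.mem_univ, true_and]
      exact ⟨fun h => h.trans_lt hlt, fun h => hmax i' (by simpa using h)⟩
    simp only [A, Finset.mem_filter, Finset.mem_univ, true_and, not_lt, heq] at hnot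
    omega

namespace Sketch

variable {U : Type*} (D : Sketch U)

/-- The program counts in `ZMod modulus`; counts are at most `rows`, so nothing wraps. -/
theorem central_sum_rank_iff (hm : D.rows < D.modulus) (v : Fin D.rows → D.Num)
    (i : Fin D.rows) : D.Central (∑ i', D.rank (v i') (v i)) ↔
      D.rows < 2 * (Finset.univ.filter fun i' => (v i').valMinAbs ≤ (v i).valMinAbs).card ∧
      D.rows ≤ 2 * (Finset.univ.filter fun i' => (v i).valMinAbs ≤ (v i').valMinAbs).card := by
  classical
  have hlt : ∀ s : Finset (Fin D.rows), s.card < D.modulus := fun s =>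
    (s.card_le_univ.trans (by simp)).trans_lt hm
  have h1 : (∑ i', D.rank (v i') (v i)).1 =
      ((Finset.univ.filter fun i' => (v i').valMinAbs ≤ (v i).valMinAbs).card : D.Num) := by
    rw [Prod.fst_sum, Finset.natCast_card_filter]
    refine Finset.sum_congr rfl fun i' _ => ?_
    by_cases h : (v i').valMinAbs ≤ (v i).valMinAbs <;> simp [rank, le, h]
  have h2 : (∑ i', D.rank (v i') (v i)).2 =
      ((Finset.univ.filter fun i' => (v i).valMinAbs ≤ (v i').valMinAbs).card : D.Num) := by
    rw [Prod.snd_sum, Finset.natCast_card_filter]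
    refine Finset.sum_congr rfl fun i' _ => ?_
    by_cases h : (v i).valMinAbs ≤ (v i').valMinAbs <;> simp [rank, le, h]
  rw [Central, h1, h2, ZMod.val_natCast_of_lt (hlt _), ZMod.val_natCast_of_lt (hlt _)]

/-- The median lies between two bounds that hold for more than half of the rows. -/
theorem median_mem_Icc (hm : D.rows < D.modulus) (v : Fin D.rows → D.Num)
    (s : Finset (Fin D.rows)) (hs : D.rows < 2 * s.card) {lo hi : ℤ}
    (h : ∀ i ∈ s, (v i).valMinAbs ∈ Set.Icc lo hi) : (D.median v).valMinAbs ∈ Set.Icc lo hi := by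
  classical
  have hpos : 0 < D.rows := by
    have := s.card_le_univ
    simp only [Fintype.card_fin] at this
    omega
  obtain ⟨i₀, hi₀⟩ := exists_central hpos fun i => (v i).valMinAbs
  obtain ⟨i, hi, he⟩ := List.foldl_ite_mem
    (fun i => D.Central (∑ i', D.rank (v i') (v i))) v (StreamCommand.enum (Fin D.rows)) 0
    ⟨i₀, StreamCommand.mem_enum _, (D.central_sum_rank_iff hm v i₀).2 hi₀⟩
  have he' : D.median v = v i := by rw [← he, median]
  rw [D.central_sum_rank_iff hm] at hi
  rw [he']
  -- A set of more than half of the rows meets every set of at least half of them.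
  have key : ∀ A : Finset (Fin D.rows), D.rows ≤ 2 * A.card → ∃ j ∈ s, j ∈ A := by
    intro A hA
    by_contra hcon
    push Not at hcon
    have hd : Disjoint s A := Finset.disjoint_left.2 hcon
    have := (Finset.card_union_of_disjoint hd).symm.trans_le (Finset.card_le_univ _)
    simp only [Fintype.card_fin] at this
    omega
  obtain ⟨j, hj, hjA⟩ := key _ hi.1.le
  obtain ⟨j', hj', hjA'⟩ := key _ hi.2
  simp only [Finset.mem_filter, Finset.mem_univ, true_and] at hjA hjA'
  exact ⟨(h j hj).1.trans hjA, hjA'.trans (h j' hj').2⟩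

end Sketch

/-! ### Amplification by independent rows -/

namespace PMF

open scoped ENNReal

/-- Markov's inequality for 16 to the number of bad rows: each row contributes a factor of mean at
most 2, while the event forces the product up to `4 ^ d`. -/
theorem prob_half_bad_le {K : Type*} [Fintype K] [Nonempty K] (bad : K → Prop)
    (hbad : 16 * (open Classical in (Finset.univ.filter bad).card) ≤ Fintype.card K) (d : ℕ) :
    ((PMF.uniformOfFintype K).iid (Fin d)).toOuterMeasure
      {κ | d ≤ 2 * (open Classical in (Finset.univ.filter fun i => bad (κ i)).card)} ≤
        ENNReal.ofReal ((1 / 2) ^ d) := by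
  classical
  have hM := PMF.mul_toOuterMeasure_le_sum ((PMF.uniformOfFintype K).iid (Fin d))
    {κ | d ≤ 2 * (Finset.univ.filter fun i => bad (κ i)).card} ((4 : ℝ≥0∞) ^ d)
    (fun κ => ∏ i, if bad (κ i) then 16 else 1) (fun κ hκ => by
      rw [Finset.prod_ite, Finset.prod_const_one, mul_one, Finset.prod_const,
        show (16 : ℝ≥0∞) = 4 ^ 2 by norm_num, ← pow_mul]
      exact pow_le_pow_right₀ (by norm_num) hκ)
  rw [PMF.sum_iid_mul_prod (PMF.uniformOfFintype K) fun _ x => if bad x then 16 else 1,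
    Finset.prod_const, Finset.card_univ, Fintype.card_fin] at hM
  have hE : ∑ x, PMF.uniformOfFintype K x * (if bad x then 16 else 1) ≤ 2 := by
    simp only [PMF.uniformOfFintype_apply]
    rw [← Finset.mul_sum, ← ENNReal.div_eq_inv_mul]
    refine ENNReal.div_le_of_le_mul ?_
    rw [Finset.sum_ite, Finset.sum_const, Finset.sum_const, nsmul_eq_mul, nsmul_eq_mul, mul_one]
    have h2 : (Finset.univ.filter fun x => ¬ bad x).card ≤ Fintype.card K :=
      Finset.card_le_univ _
    have h3 : (Finset.univ.filter bad).card * 16 + (Finset.univ.filter fun x => ¬ bad x).card ≤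
        2 * Fintype.card K := by
      have : (Finset.univ.filter bad).card * 16 ≤ Fintype.card K := by
        rw [mul_comm]; convert hbad
      omega
    exact_mod_cast h3
  have h4 := hM.trans (pow_le_pow_left' hE d)
  rw [mul_comm, ← ENNReal.le_div_iff_mul_le (Or.inl (by simp)) (Or.inl (by simp))] at h4
  convert h4 using 1
  have e : ENNReal.ofReal (1 / 2) = 2 * 4⁻¹ := by
    rw [show (1 / 2 : ℝ) = 2 / 4 by norm_num, ENNReal.ofReal_div_of_pos (by norm_num),
      div_eq_mul_inv]
    norm_num
  rw [ENNReal.ofReal_pow (by norm_num), e, mul_pow, ← ENNReal.inv_pow, ← div_eq_mul_inv]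

end PMF

/-! ### Moments of signed hashing -/

theorem sum_sum_sq {K ι : Type*} [Fintype K] (s : Finset ι) (Y : K → ι → ℝ) :
    ∑ κ, (∑ p ∈ s, Y κ p) ^ 2 = ∑ p ∈ s, ∑ q ∈ s, ∑ κ, Y κ p * Y κ q := by
  simp_rw [sq, Finset.sum_mul_sum]
  rw [Finset.sum_comm]
  exact Finset.sum_congr rfl fun p _ => Finset.sum_comm

/-- Hash functions `h` with signs `g` such that the sign of a point can be flipped without changing
the values at any three other points, and such that two points collide with probability at most
`1 / w`. -/
structure SignedHash {K A B : Type*} [Fintype K] (h : K → A → B) (g : K → A → ℤ) (w : ℕ) :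
    Prop where
  sign_sq : ∀ κ a, g κ a ^ 2 = 1
  flip : ∀ a b₁ b₂ b₃, a ≠ b₁ → a ≠ b₂ → a ≠ b₃ → ∃ τ : Equiv.Perm K, ∀ κ,
    h (τ κ) a = h κ a ∧ g (τ κ) a = -g κ a ∧
      (h (τ κ) b₁ = h κ b₁ ∧ g (τ κ) b₁ = g κ b₁) ∧
      (h (τ κ) b₂ = h κ b₂ ∧ g (τ κ) b₂ = g κ b₂) ∧
      (h (τ κ) b₃ = h κ b₃ ∧ g (τ κ) b₃ = g κ b₃)
  collide : ∀ a b, a ≠ b →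
    w * (open Classical in (Finset.univ.filter fun κ => h κ a = h κ b).card) ≤ Fintype.card K

namespace SignedHash

variable {K A B : Type*} {h : K → A → B} {g : K → A → ℤ} {w : ℕ}

/-- The influence of two points on each other. -/
noncomputable def cross (h : K → A → B) (g : K → A → ℤ) (κ : K) (a b : A) : ℝ :=
  open Classical in if h κ a = h κ b then (g κ a * g κ b : ℤ) else 0

theorem cross_comm (κ : K) (a b : A) : cross h g κ a b = cross h g κ b a := by
  by_cases e : h κ a = h κ b
  · simp [cross, e, mul_comm]
  · simp [cross, e, Ne.symm e]

variable [Fintype K]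

theorem cross_self (H : SignedHash h g w) (κ : K) (a : A) : cross h g κ a a = 1 := by
  rw [cross, if_pos rfl, ← sq, H.sign_sq, Int.cast_one]

theorem cross_sq (H : SignedHash h g w) (κ : K) (a b : A) :
    cross h g κ a b ^ 2 = open Classical in if h κ a = h κ b then 1 else 0 := by
  rw [cross]
  split_ifs
  · norm_cast
    rw [mul_pow, H.sign_sq, H.sign_sq, mul_one]
  · simp

/-- The point `a` occurs once among the four, so flipping its sign negates every product while
merely permuting the keys. -/
theorem sum_cross_mul_cross (H : SignedHash h g w) {a b c d : A} (hab : a ≠ b) (hac : a ≠ c)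
    (had : a ≠ d) : ∑ κ, cross h g κ a b * cross h g κ c d = 0 := by
  obtain ⟨τ, hτ⟩ := H.flip a b c d hab hac had
  have h1 : ∑ κ, cross h g (τ κ) a b * cross h g (τ κ) c d =
      ∑ κ, cross h g κ a b * cross h g κ c d :=
    Equiv.sum_comp τ fun κ => cross h g κ a b * cross h g κ c d
  have h2 : ∀ κ, cross h g (τ κ) a b * cross h g (τ κ) c d =
      -(cross h g κ a b * cross h g κ c d) := by
    intro κ
    obtain ⟨e1, e2, ⟨e3, e4⟩, ⟨e5, e6⟩, e7, e8⟩ := hτ κ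
    have c1 : cross h g (τ κ) a b = -cross h g κ a b := by
      by_cases e : h κ a = h κ b <;> simp [cross, e1, e2, e3, e4, e]
    have c2 : cross h g (τ κ) c d = cross h g κ c d := by
      by_cases e : h κ c = h κ d <;> simp [cross, e5, e6, e7, e8, e]
    rw [c1, c2, neg_mul]
  rw [Finset.sum_congr rfl fun κ _ => h2 κ, Finset.sum_neg_distrib] at h1
  linarith

theorem sum_cross_sq_le (H : SignedHash h g w) (hw : 0 < w) {a b : A} (hab : a ≠ b) :
    ∑ κ, cross h g κ a b ^ 2 ≤ Fintype.card K / w := by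
  classical
  simp only [H.cross_sq]
  rw [le_div_iff₀ (by positivity), Finset.sum_boole, mul_comm]
  have := H.collide a b hab
  have h' : ((w * (Finset.univ.filter fun κ => h κ a = h κ b).card : ℕ) : ℝ) ≤
    Fintype.card K := by
    refine Nat.cast_le.2 ?_
    convert this
  push_cast at h'
  convert h'

variable [Fintype A] [DecidableEq A]

/-- In the expanded square a mixed term with `c ≠ c'` contains the sign of `c` once and averages
out. The diagonal is governed by collision probabilities. -/
theorem sum_sq_freqError_le (H : SignedHash h g w) (hw : 0 < w) (f : A → ℝ) (a : A) :
    ∑ κ, (∑ c ∈ Finset.univ.erase a, cross h g κ a c * f c) ^ 2 ≤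
      Fintype.card K / w * ∑ c, f c ^ 2 := by
  have h1 : ∑ κ, (∑ c ∈ Finset.univ.erase a, cross h g κ a c * f c) ^ 2 =
      ∑ c ∈ Finset.univ.erase a, ∑ c' ∈ Finset.univ.erase a,
        f c * f c' * ∑ κ, cross h g κ c a * cross h g κ a c' := by
    rw [sum_sum_sq]
    refine Finset.sum_congr rfl fun c _ => Finset.sum_congr rfl fun c' _ => ?_
    rw [Finset.mul_sum]
    refine Finset.sum_congr rfl fun κ _ => ?_
    rw [cross_comm κ c a]
    ring
  have h2 : ∀ c ∈ Finset.univ.erase a, ∑ c' ∈ Finset.univ.erase a,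
        f c * f c' * ∑ κ, cross h g κ c a * cross h g κ a c' ≤
      Fintype.card K / w * f c ^ 2 := by
    intro c hc
    have hca : c ≠ a := Finset.ne_of_mem_erase hc
    rw [Finset.sum_eq_single_of_mem c hc]
    · simp only [cross_comm _ a c, ← sq]
      rw [mul_comm]
      exact mul_le_mul_of_nonneg_right (H.sum_cross_sq_le hw hca) (sq_nonneg _)
    · intro c' hc' hne
      rw [H.sum_cross_mul_cross hca hca hne.symm, mul_zero]
  rw [h1, Finset.mul_sum]
  refine (Finset.sum_le_sum h2).trans ?_
  exact Finset.sum_le_sum_of_subset_of_nonneg (Finset.erase_subset _ _) fun c _ _ => by positivity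

/-- Mixed terms vanish unless the two ordered pairs have the same underlying set. A pair matches
itself and its reverse, hence the factor 2. -/
theorem sum_sq_momentError_le (H : SignedHash h g w) (hw : 0 < w) (f : A → ℝ) :
    ∑ κ, (∑ p ∈ Finset.univ.offDiag, cross h g κ p.1 p.2 * (f p.1 * f p.2)) ^ 2 ≤
      2 * (Fintype.card K / w) * (∑ c, f c ^ 2) ^ 2 := by
  have h1 : ∑ κ, (∑ p ∈ Finset.univ.offDiag, cross h g κ p.1 p.2 * (f p.1 * f p.2)) ^ 2 =
      ∑ p ∈ (Finset.univ : Finset A).offDiag, ∑ q ∈ (Finset.univ : Finset A).offDiag,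
        (f p.1 * f p.2) * (f q.1 * f q.2) *
          ∑ κ, cross h g κ p.1 p.2 * cross h g κ q.1 q.2 := by
    rw [sum_sum_sq]
    refine Finset.sum_congr rfl fun c _ => Finset.sum_congr rfl fun c' _ => ?_
    rw [Finset.mul_sum]
    refine Finset.sum_congr rfl fun κ _ => ?_
    ring
  have h2 : ∀ p ∈ (Finset.univ : Finset A).offDiag, ∑ q ∈ (Finset.univ : Finset A).offDiag,
        (f p.1 * f p.2) * (f q.1 * f q.2) *
          ∑ κ, cross h g κ p.1 p.2 * cross h g κ q.1 q.2 ≤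
      2 * (Fintype.card K / w) * (f p.1 ^ 2 * f p.2 ^ 2) := by
    rintro ⟨a, b⟩ hp
    have hab : a ≠ b := (Finset.mem_offDiag.1 hp).2.2
    have hsub : ({(a, b), (b, a)} : Finset (A × A)) ⊆ Finset.univ.offDiag := by
      intro q hq
      simp only [Finset.mem_insert, Finset.mem_singleton] at hq
      rcases hq with rfl | rfl
      · exact hp
      · simp [Ne.symm hab]
    rw [← Finset.sum_subset hsub]
    · rw [Finset.sum_pair (by simp [hab])]
      simp only [cross_comm _ b a, ← sq]
      have := H.sum_cross_sq_le hw hab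
      nlinarith [mul_nonneg (sq_nonneg (f a)) (sq_nonneg (f b)),
        mul_le_mul_of_nonneg_left this (mul_nonneg (sq_nonneg (f a)) (sq_nonneg (f b)))]
    · rintro ⟨c, d⟩ hq hnot
      have hcd : c ≠ d := (Finset.mem_offDiag.1 hq).2.2
      simp only [Finset.mem_insert, Finset.mem_singleton, Prod.mk.injEq, not_or, not_and] at hnot
      by_cases hac : a = c ∨ a = d
      · have hbc : b ≠ c ∧ b ≠ d := by
          constructor <;> rintro rfl <;> rcases hac with rfl | rfl <;> simp_all
        simp only [cross_comm _ a b]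
        rw [H.sum_cross_mul_cross hab.symm hbc.1 hbc.2, mul_zero]
      · rw [not_or] at hac
        rw [H.sum_cross_mul_cross hab hac.1 hac.2, mul_zero]
  rw [h1]
  refine (Finset.sum_le_sum h2).trans ?_
  rw [← Finset.mul_sum, sq (∑ c, f c ^ 2), Finset.sum_mul_sum, ← Finset.sum_product']
  refine mul_le_mul_of_nonneg_left ?_ (by positivity)
  exact Finset.sum_le_sum_of_subset_of_nonneg (by intro; simp) fun c _ _ => by positivity

end SignedHash

/-- Chebyshev's inequality for a uniformly random index. -/
theorem card_filter_lt_abs_le {K : Type*} [Fintype K] (X : K → ℝ) {b V : ℝ} (hb : 0 ≤ b)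
    (hX : ∑ κ, X κ ^ 2 ≤ V) (hV : 16 * V ≤ Fintype.card K * b ^ 2) :
    16 * (open Classical in (Finset.univ.filter fun κ => b < |X κ|).card) ≤ Fintype.card K := by
  classical
  have h1 : ((Finset.univ.filter fun κ => b < |X κ|).card : ℝ) * b ^ 2 ≤ V := by
    refine le_trans ?_ hX
    rw [← nsmul_eq_mul, ← Finset.sum_const]
    refine (Finset.sum_le_sum fun κ hκ => ?_).trans
      (Finset.sum_le_sum_of_subset_of_nonneg (Finset.filter_subset _ _) fun κ _ _ => sq_nonneg _)
    rw [← sq_abs (X κ)]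
    exact pow_le_pow_left₀ hb (Finset.mem_filter.1 hκ).2.le 2
  -- The threshold is 0 while the stream is still empty; then the second moment vanishes and so does
  -- every `X κ`.
  rcases hb.eq_or_lt with rfl | hb
  · have hz : ∀ κ, X κ = 0 := by
      have h0 : ∑ κ, X κ ^ 2 = 0 :=
        le_antisymm (hX.trans (by nlinarith)) (Finset.sum_nonneg fun _ _ => sq_nonneg _)
      intro κ
      have := (Finset.sum_eq_zero_iff_of_nonneg fun _ _ => sq_nonneg _).1 h0 κ (Finset.mem_univ _)
      exact pow_eq_zero_iff (two_ne_zero) |>.1 this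
    simp [hz]
  · have h2 : ((16 * (Finset.univ.filter fun κ => b < |X κ|).card : ℕ) : ℝ) ≤
        (Fintype.card K : ℕ) := by
      push_cast
      refine le_of_mul_le_mul_right ?_ (pow_pos hb 2)
      nlinarith
    exact_mod_cast h2

/-! ### Accuracy -/

namespace Sketch

open SignedHash StreamAlgorithm

variable {U : Type*} (D : Sketch U)

/-- The number of occurrences of `a` among the first `n` inputs. -/
noncomputable def count (S : ℕ → Option U) (n : ℕ) (a : U) : ℝ :=
  open Classical in ((Finset.range n).filter fun s => S s = some a).card

theorem freq_eq_count {T : ℕ} (S : ElementStream U T) (t : Fin T) (a : U) :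
    (S.freq t a : ℝ) = count (Fin.extend none S) (t + 1) a := by
  classical
  rw [ElementStream.freq, count, Nat.cast_inj]
  refine Finset.card_bij (fun i _ => (i : ℕ)) ?_ ?_ ?_
  · intro i hi
    obtain ⟨h1, h2⟩ := (Finset.mem_filter.1 hi).2
    refine Finset.mem_filter.2 ⟨Finset.mem_range.2 (Nat.lt_succ_of_le h1), ?_⟩
    rw [Fin.extend_of_lt _ _ i.2]
    exact h2
  · exact fun i _ j _ h => Fin.ext h
  · intro s hs
    obtain ⟨h1, h2⟩ := Finset.mem_filter.1 hs
    have hs' : s < T := by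
      have := Finset.mem_range.1 h1
      omega
    rw [Fin.extend_of_lt _ _ hs'] at h2
    refine ⟨⟨s, hs'⟩, Finset.mem_filter.2 ⟨Finset.mem_univ _, ?_, h2⟩, rfl⟩
    exact Nat.lt_succ_iff.1 (Finset.mem_range.1 h1)

theorem abs_incr_le (hsign : ∀ κ x, |D.sign κ x| ≤ 1) (κ : D.Key) (b : Fin D.width)
    (o : Option D.Letter) : |D.incr κ b o| ≤ 1 := by
  cases o with
  | none => simp [incr]
  | some x =>
    simp only [incr]
    split_ifs
    · exact hsign κ x
    · simp

theorem abs_trueBucket_le (hsign : ∀ κ x, |D.sign κ x| ≤ 1) (κ : Fin D.rows → D.Key)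
    (S : ℕ → Option U) (n : ℕ) (k : Fin D.rows × Fin D.width) :
    |D.trueBucket κ S n k| ≤ n := by
  refine (Finset.abs_sum_le_sum_abs _ _).trans ?_
  refine (Finset.sum_le_sum fun s _ => D.abs_incr_le hsign _ _ _).trans ?_
  simp

variable {D} in
theorem abs_median_sub_le (hm : D.rows < D.modulus) (v : Fin D.rows → D.Num)
    (s : Finset (Fin D.rows)) (hs : D.rows < 2 * s.card) {x r : ℝ}
    (h : ∀ i ∈ s, |((v i).valMinAbs : ℝ) - x| ≤ r) : |((D.median v).valMinAbs : ℝ) - x| ≤ r := by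
  have h' := D.median_mem_Icc hm v s hs (lo := ⌈x - r⌉) (hi := ⌊x + r⌋) fun i hi => by
    have := abs_le.1 (h i hi)
    exact ⟨Int.ceil_le.2 (by linarith), Int.le_floor.2 (by linarith)⟩
  rw [abs_le]
  have h1 := Int.ceil_le.1 h'.1
  have h2 := Int.le_floor.1 h'.2
  constructor <;> linarith

variable {D} in
theorem sum_freqTerm (x : D.Letter) (κ : D.Key) (y : Fin D.width → D.Num) :
    ∑ b, D.freqTerm x b κ (y b) = D.sign κ x * y (D.bucket κ x) := by
  simp [freqTerm]

variable [Fintype U]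

theorem trueBucket_eq (κ : Fin D.rows → D.Key) (S : ℕ → Option U) (n : ℕ)
    (k : Fin D.rows × Fin D.width) : (D.trueBucket κ S n k : ℝ) =
      ∑ a, if D.bucket (κ k.1) (D.code a) = k.2 then
        D.sign (κ k.1) (D.code a) * count S n a else 0 := by
  classical
  have h : ∀ s, (D.change κ S k.1 k.2 s : ℝ) = ∑ a, if S s = some a then
      (if D.bucket (κ k.1) (D.code a) = k.2 then (D.sign (κ k.1) (D.code a) : ℝ) else 0)
        else 0 := by
    intro s
    rw [change]
    cases hs : S s with
    | none => simp [incr]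
    | some x =>
      simp only [Option.some.injEq, Finset.sum_ite_eq, Finset.mem_univ, if_true, Option.map_some,
        incr]
      split_ifs <;> simp
  rw [trueBucket, Int.cast_sum, Finset.sum_congr rfl fun s _ => h s, Finset.sum_comm]
  refine Finset.sum_congr rfl fun a _ => ?_
  rw [← Finset.sum_filter, Finset.sum_const, nsmul_eq_mul, count]
  split_ifs
  · rw [mul_comm]
  · rw [mul_zero]

/-- The hash functions as functions of the elements of the universe. -/
abbrev bucketOf (κ : D.Key) (a : U) : Fin D.width := D.bucket κ (D.code a)

/-- The signs as functions of the elements of the universe. -/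
abbrev signOf (κ : D.Key) (a : U) : ℤ := D.sign κ (D.code a)

variable {D}

/-- The term of `a` itself has coefficient 1; the rest is the collision error bounded by
`sum_sq_freqError_le`. -/
theorem sign_mul_trueBucket [DecidableEq U] (H : SignedHash D.bucketOf D.signOf D.width)
    (κ : Fin D.rows → D.Key) (S : ℕ → Option U) (n : ℕ) (i : Fin D.rows) (a : U) :
    (D.signOf (κ i) a : ℝ) * D.trueBucket κ S n (i, D.bucketOf (κ i) a) = count S n a +
      ∑ c ∈ Finset.univ.erase a, cross D.bucketOf D.signOf (κ i) a c * count S n c := by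
  classical
  have h1 : count S n a = cross D.bucketOf D.signOf (κ i) a a * count S n a := by
    rw [H.cross_self, one_mul]
  rw [h1, Finset.add_sum_erase _ (fun c => cross D.bucketOf D.signOf (κ i) a c * count S n c)
    (Finset.mem_univ a), trueBucket_eq, Finset.mul_sum]
  refine Finset.sum_congr rfl fun c _ => ?_
  by_cases e : D.bucketOf (κ i) a = D.bucketOf (κ i) c
  · rw [cross, if_pos e, if_pos e.symm]
    push_cast; ring
  · rw [cross, if_neg e, if_neg (Ne.symm e)]
    ring

theorem sum_trueBucket_sq [DecidableEq U] (H : SignedHash D.bucketOf D.signOf D.width)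
    (κ : Fin D.rows → D.Key) (S : ℕ → Option U) (n : ℕ) (i : Fin D.rows) :
    ∑ b, (D.trueBucket κ S n (i, b) : ℝ) ^ 2 = ∑ c, count S n c ^ 2 +
      ∑ p ∈ Finset.univ.offDiag, cross D.bucketOf D.signOf (κ i) p.1 p.2 *
        (count S n p.1 * count S n p.2) := by
  classical
  have h1 : ∑ c, count S n c ^ 2 = ∑ p ∈ (Finset.univ : Finset U).diag,
      cross D.bucketOf D.signOf (κ i) p.1 p.2 * (count S n p.1 * count S n p.2) := by
    rw [Finset.sum_diag]
    exact Finset.sum_congr rfl fun c _ => by rw [H.cross_self, one_mul, sq]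
  rw [h1, ← Finset.sum_union (Finset.disjoint_diag_offDiag _), Finset.diag_union_offDiag,
    Finset.sum_product]
  simp only [trueBucket_eq, sq, Finset.sum_mul_sum]
  rw [Finset.sum_comm]
  refine Finset.sum_congr rfl fun a _ => ?_
  rw [Finset.sum_comm]
  refine Finset.sum_congr rfl fun c _ => ?_
  rw [Finset.sum_eq_single (D.bucketOf (κ i) a)]
  · by_cases e : D.bucketOf (κ i) a = D.bucketOf (κ i) c
    · rw [cross, if_pos e, if_pos rfl, if_pos e.symm]
      push_cast; ring
    · rw [cross, if_neg e, if_pos rfl, if_neg (Ne.symm e)]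
      ring
  · intro b _ hb
    rw [if_neg (Ne.symm hb), zero_mul]
  · simp

/-- In a good row the error is collision plus noise. Signed buckets stay below `2 * T` in absolute
value, so `4 * T < modulus` rules out wrapping. -/
theorem abs_freq_sub_le (H : SignedHash D.bucketOf D.signOf D.width)
    [DecidableEq U] (hsign : ∀ κ x, |D.sign κ x| ≤ 1)
    (hm : D.rows < D.modulus) {T n : ℕ} (hn : n < 2 ^ D.levels) (hnT : n ≤ T)
    (κ : Fin D.rows → D.Key) (S : ℕ → Option U) (z : ℕ → D.Node → D.Num) {N B : ℝ} (a : U)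
    (hN : N ≤ T) (hmod : 4 * (T : ℝ) < D.modulus)
    (hnoise : ∀ k, |(D.bucketNoise z n k : ℝ)| < N)
    (hrows : D.rows < 2 * (open Classical in (Finset.univ.filter fun i =>
      |∑ c ∈ Finset.univ.erase a, cross D.bucketOf D.signOf (κ i) a c * count S n c| ≤ B).card)) :
    |((D.median fun i => ∑ b, D.freqTerm (D.code a) b (κ i)
      (D.noisyBucket κ S z n (i, b))).valMinAbs : ℝ) - count S n a| ≤ B + N := by
  classical
  refine abs_median_sub_le hm _ _ hrows fun i hi => ?_
  have hgood := (Finset.mem_filter.1 hi).2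
  rw [sum_freqTerm, D.noisyBucket_eq κ S z n hn, ← Int.cast_mul]
  have hs1 : |(D.signOf (κ i) a : ℝ)| ≤ 1 := by exact_mod_cast hsign (κ i) (D.code a)
  have hν := hnoise (i, D.bucketOf (κ i) a)
  have htb : |(D.trueBucket κ S n (i, D.bucketOf (κ i) a) : ℝ)| ≤ n := by
    exact_mod_cast D.abs_trueBucket_le hsign κ S n _
  have hnT' : (n : ℝ) ≤ T := by exact_mod_cast hnT
  have hbound : |(D.signOf (κ i) a : ℝ) * (D.trueBucket κ S n (i, D.bucketOf (κ i) a) +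
      D.bucketNoise z n (i, D.bucketOf (κ i) a))| < 2 * T := by
    rw [abs_mul]
    have h3 := abs_add_le (D.trueBucket κ S n (i, D.bucketOf (κ i) a) : ℝ)
      (D.bucketNoise z n (i, D.bucketOf (κ i) a))
    nlinarith [abs_nonneg ((D.trueBucket κ S n (i, D.bucketOf (κ i) a) : ℝ) +
      D.bucketNoise z n (i, D.bucketOf (κ i) a))]
  rw [ZMod.valMinAbs_intCast_of_two_mul_abs_lt]
  · have h4 := sign_mul_trueBucket H κ S n i a
    push_cast
    rw [mul_add, h4, add_right_comm, add_assoc, add_sub_cancel_left, add_comm]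
    refine (abs_add_le _ _).trans (add_le_add hgood ?_)
    rw [abs_mul]
    nlinarith [abs_nonneg (D.bucketNoise z n (i, D.bucketOf (κ i) a) : ℝ)]
  · have : ((2 * |D.signOf (κ i) a * (D.trueBucket κ S n (i, D.bucketOf (κ i) a) +
      D.bucketNoise z n (i, D.bucketOf (κ i) a))| : ℤ) : ℝ) < (D.modulus : ℤ) := by
      push_cast
      linarith
    exact_mod_cast this

/-- Write a bucket as `C + ν`. The cross term `2Cν` is split into `η / 3 * C ^ 2` and `3 / η * ν ^
2`, the source of an extra factor `1 / η`. The relative error is then `η / 3` from collisions and at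
most `7 / 6 * η / 3` from the cross terms, below `η` in total. -/
theorem abs_moment_sub_le (H : SignedHash D.bucketOf D.signOf D.width)
    [DecidableEq U] (hsign : ∀ κ x, |D.sign κ x| ≤ 1)
    (hm : D.rows < D.modulus) {T n : ℕ} (hn : n < 2 ^ D.levels) (hnT : n ≤ T)
    (κ : Fin D.rows → D.Key) (S : ℕ → Option U) (z : ℕ → D.Node → D.Num) {N η : ℝ}
    (hη : 0 < η) (hη' : η < 1 / 2)
    (hN : N ≤ T) (hmod : 8 * (D.width * (T : ℝ) ^ 2) < D.modulus)
    (hnoise : ∀ k, |(D.bucketNoise z n k : ℝ)| < N)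
    (hrows : D.rows < 2 * (open Classical in (Finset.univ.filter fun i =>
      |∑ p ∈ Finset.univ.offDiag, cross D.bucketOf D.signOf (κ i) p.1 p.2 *
        (count S n p.1 * count S n p.2)| ≤ η / 3 * ∑ c, count S n c ^ 2).card)) :
    |((D.median fun i => ∑ b, D.noisyBucket κ S z n (i, b) ^ 2).valMinAbs : ℝ) -
      ∑ c, count S n c ^ 2| ≤ η * ∑ c, count S n c ^ 2 + 4 / η * (D.width * N ^ 2) := by
  classical
  refine abs_median_sub_le hm _ _ hrows fun i hi => ?_
  have hgood := (Finset.mem_filter.1 hi).2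
  have hnT' : (n : ℝ) ≤ T := by exact_mod_cast hnT
  have hcast : ∑ b, D.noisyBucket κ S z n (i, b) ^ 2 = ((∑ b,
      (D.trueBucket κ S n (i, b) + D.bucketNoise z n (i, b)) ^ 2 : ℤ) : D.Num) := by
    push_cast
    refine Finset.sum_congr rfl fun b _ => ?_
    rw [D.noisyBucket_eq κ S z n hn]
    push_cast
    rfl
  have htb : ∀ b, |(D.trueBucket κ S n (i, b) : ℝ)| ≤ n := fun b => by
    exact_mod_cast D.abs_trueBucket_le hsign κ S n (i, b)
  have hle : ∑ b, ((D.trueBucket κ S n (i, b) : ℝ) + D.bucketNoise z n (i, b)) ^ 2 ≤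
      D.width * (2 * T) ^ 2 := by
    refine (Finset.sum_le_card_nsmul _ _ ((2 * (T : ℝ)) ^ 2) fun b _ => ?_).trans ?_
    · refine sq_le_sq' ?_ ?_
      · have h1 := (abs_le.1 (htb b)).1
        have h2 := (abs_lt.1 (hnoise (i, b))).1
        linarith
      · have h1 := (abs_le.1 (htb b)).2
        have h2 := (abs_lt.1 (hnoise (i, b))).2
        linarith
    · simp
  rw [hcast, ZMod.valMinAbs_intCast_of_two_mul_abs_lt]
  · have h4 := sum_trueBucket_sq H κ S n i
    set F := ∑ c, count S n c ^ 2 with hF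
    have hF0 : 0 ≤ F := Finset.sum_nonneg fun _ _ => sq_nonneg _
    set E := ∑ p ∈ Finset.univ.offDiag, cross D.bucketOf D.signOf (κ i) p.1 p.2 *
        (count S n p.1 * count S n p.2) with hE
    have hterm : ∀ b, |((D.trueBucket κ S n (i, b) : ℝ) + D.bucketNoise z n (i, b)) ^ 2 -
        (D.trueBucket κ S n (i, b) : ℝ) ^ 2| ≤
          η / 3 * (D.trueBucket κ S n (i, b) : ℝ) ^ 2 + (1 + 3 / η) * N ^ 2 := by
      intro b
      have hν := hnoise (i, b)
      generalize (D.trueBucket κ S n (i, b) : ℝ) = C at *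
      generalize (D.bucketNoise z n (i, b) : ℝ) = ν at *
      have hν2 : ν ^ 2 ≤ N ^ 2 := by
        rw [← sq_abs ν]
        exact pow_le_pow_left₀ (abs_nonneg _) hν.le 2
      have hAM : 2 * |C * ν| ≤ η / 3 * C ^ 2 + 3 / η * ν ^ 2 := by
        have h := sq_nonneg (η / 3 * |C| - |ν|)
        rw [abs_mul]
        have e : η / 3 * C ^ 2 + 3 / η * ν ^ 2 - 2 * (|C| * |ν|) =
            3 / η * (η / 3 * |C| - |ν|) ^ 2 := by
          rw [← sq_abs C, ← sq_abs ν]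
          field_simp
          ring
        have : 0 ≤ 3 / η * (η / 3 * |C| - |ν|) ^ 2 := by positivity
        linarith
      have h3 : 3 / η * ν ^ 2 ≤ 3 / η * N ^ 2 := mul_le_mul_of_nonneg_left hν2 (by positivity)
      calc |(C + ν) ^ 2 - C ^ 2| = |2 * (C * ν) + ν ^ 2| := by ring_nf
        _ ≤ |2 * (C * ν)| + |ν ^ 2| := abs_add_le _ _
        _ = 2 * |C * ν| + ν ^ 2 := by rw [abs_mul, abs_two, abs_of_nonneg (sq_nonneg ν)]
        _ ≤ _ := by linarith
    have hsum : |∑ b, ((D.trueBucket κ S n (i, b) : ℝ) + D.bucketNoise z n (i, b)) ^ 2 -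
        ∑ b, (D.trueBucket κ S n (i, b) : ℝ) ^ 2| ≤
          η / 3 * ∑ b, (D.trueBucket κ S n (i, b) : ℝ) ^ 2 + D.width * ((1 + 3 / η) * N ^ 2) := by
      rw [← Finset.sum_sub_distrib]
      refine (Finset.abs_sum_le_sum_abs _ _).trans ((Finset.sum_le_sum fun b _ => hterm b).trans ?_)
      rw [Finset.sum_add_distrib, ← Finset.mul_sum]
      simp
    rw [h4] at hsum
    push_cast
    have h5 := abs_le.1 hsum
    have h6 := abs_le.1 hgood
    have h7 : (1 + 3 / η) * N ^ 2 ≤ 4 / η * N ^ 2 := by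
      refine mul_le_mul_of_nonneg_right ?_ (sq_nonneg _)
      have e1 : 1 ≤ 1 / η := by rw [le_div_iff₀ hη]; linarith
      have e2 : 4 / η = 1 / η + 3 / η := by ring
      linarith
    have h8 : (D.width : ℝ) * ((1 + 3 / η) * N ^ 2) ≤ 4 / η * (D.width * N ^ 2) := by
      rw [mul_left_comm (4 / η)]
      exact mul_le_mul_of_nonneg_left h7 (by positivity)
    -- `E ≤ η / 3 * F ≤ F / 6`, because `η < 1 / 2`.
    have h9 : η / 3 * (F + E) ≤ η / 3 * (7 / 6 * F) := by
      refine mul_le_mul_of_nonneg_left ?_ (by positivity)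
      nlinarith
    have h10 : 0 ≤ η * F := by positivity
    rw [abs_le]
    constructor <;> nlinarith
  · have : ((2 * |∑ b, (D.trueBucket κ S n (i, b) + D.bucketNoise z n (i, b)) ^ 2| : ℤ) : ℝ) <
        (D.modulus : ℤ) := by
      push_cast
      rw [abs_of_nonneg (Finset.sum_nonneg fun _ _ => sq_nonneg _)]
      nlinarith
    exact_mod_cast this

end Sketch

/-! ### The union bound over all failure events -/

namespace Sketch

open SignedHash StreamAlgorithm
open scoped ENNReal

variable {U : Type*} {D : Sketch U}

theorem prob_seeds_fst {T : ℕ} (s : Set (Fin D.rows → D.Key)) :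
    (D.seeds T).toOuterMeasure {x | x.1 ∈ s} =
      ((PMF.uniformOfFintype D.Key).iid (Fin D.rows)).toOuterMeasure s := by
  rw [show {x : (Fin D.rows → D.Key) × (Fin T → D.Node → D.Num) | x.1 ∈ s} = Prod.fst ⁻¹' s
    from rfl, ← PMF.toOuterMeasure_map_apply, seeds, PMF.map_bind]
  simp only [Function.comp_def, PMF.map]
  simp

theorem prob_seeds_snd {T : ℕ} (s : Set (Fin T → D.Node → D.Num)) :
    (D.seeds T).toOuterMeasure {x | x.2 ∈ s} =
      ((D.noise.iid D.Node).iid (Fin T)).toOuterMeasure s := by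
  rw [show {x : (Fin D.rows → D.Key) × (Fin T → D.Node → D.Num) | x.2 ∈ s} = Prod.snd ⁻¹' s
    from rfl, ← PMF.toOuterMeasure_map_apply, seeds, PMF.map_bind]
  simp only [Function.comp_def, PMF.map]
  simp

theorem prob_iUnion_le {α ι : Type*} [Fintype ι] (p : PMF α) (s : ι → Set α) {b : ℝ}
    (h : ∀ i, p.toOuterMeasure (s i) ≤ ENNReal.ofReal b) :
    p.toOuterMeasure (⋃ i, s i) ≤ ENNReal.ofReal (Fintype.card ι * b) := by
  refine (MeasureTheory.measure_iUnion_fintype_le _ _).trans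
    ((Finset.sum_le_sum fun i _ => h i).trans ?_)
  rw [Finset.sum_const, nsmul_eq_mul, ENNReal.ofReal_mul (by positivity), ENNReal.ofReal_natCast]
  rfl

theorem rows_lt_of_not_half_bad {d : ℕ} {bad : Fin d → Prop}
    (h : ¬ d ≤ 2 * (open Classical in (Finset.univ.filter bad).card)) {good : Fin d → Prop}
    (hgood : ∀ i, ¬ bad i → good i) :
    d < 2 * (open Classical in (Finset.univ.filter good).card) := by
  classical
  have h1 := Finset.card_filter_add_card_filter_not (s := Finset.univ) bad
  have h2 : (Finset.univ.filter fun i => ¬ bad i).card ≤ (Finset.univ.filter good).card :=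
    Finset.card_le_card fun i hi =>
      Finset.mem_filter.2 ⟨Finset.mem_univ _, hgood i (Finset.mem_filter.1 hi).2⟩
  simp only [Finset.card_univ, Fintype.card_fin] at h1
  rw [not_le] at h
  have h3 : 2 * (Finset.univ.filter bad).card < d := by convert h
  have h4 : d < 2 * (Finset.univ.filter good).card := by omega
  convert h4

variable [Fintype U]

/-- The constant is 288 = 16 · 2 · 3²: failure rate 1/16 per row, the factor 2 in the second moment,
and the tolerance `η / 3`. Half of `ξ` is spent on the noise and half on the hashing. -/
theorem accurate [DecidableEq U] (H : SignedHash D.bucketOf D.signOf D.width)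
    (hsign : ∀ κ x, |D.sign κ x| ≤ 1) (hm : D.rows < D.modulus) {T : ℕ}
    (hT : T < D.modulus) (hlev : T < 2 ^ D.levels) {η ξ N c : ℝ} (hη : 0 < η) (hη' : η < 1 / 2)
    (hw : 288 ≤ D.width * η ^ 2) (hc0 : 0 ≤ c)
    (hc : ∑ x : D.Num, D.noise x * ENNReal.ofReal (Real.exp (c * |x.valMinAbs|)) ≤ 3)
    (hdec : ∀ x, D.decode x = x.valMinAbs)
    (hN : N ≤ T) (hmod4 : 4 * (T : ℝ) < D.modulus)
    (hmod : 8 * (D.width * (T : ℝ) ^ 2) < D.modulus)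
    (hξN : T * (D.rows * D.width) * (Real.exp (-(c * N)) * 3 ^ D.levels) ≤ ξ / 2)
    (hξd : (T * Fintype.card U + T) * (1 / 2 : ℝ) ^ D.rows ≤ ξ / 2) (S : ElementStream U T) :
    ENNReal.ofReal (1 - ξ) ≤ D.algorithm.prob S {out | ∀ t : Fin T,
      (∀ a : U, |(S.freq t a : ℝ) - (out t).freq a| ≤ η * S.l2norm t + N) ∧
      |(out t).moment - S.l2norm t ^ 2| ≤ η * S.l2norm t ^ 2 + 4 / η * (D.width * N ^ 2)} := by
  classical
  set S' : ℕ → Option U := Fin.extend none S with hS'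
  have hF : ∀ t, S.l2norm t ^ 2 = ∑ c, count S' (t + 1) c ^ 2 := by
    intro t
    rw [ElementStream.l2norm, Real.sq_sqrt
      (by rw [ElementStream.secondMoment]; exact Finset.sum_nonneg fun _ _ => sq_nonneg _),
      ElementStream.secondMoment]
    exact Finset.sum_congr rfl fun a _ => by rw [freq_eq_count]
  have hw0 : (0 : ℝ) < D.width := by
    by_contra h
    have : (D.width : ℝ) * η ^ 2 ≤ 0 := mul_nonpos_of_nonpos_of_nonneg (not_lt.1 h) (sq_nonneg _)
    linarith
  have hw0' : 0 < D.width := by exact_mod_cast hw0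
  have hl2 : ∀ t, 0 ≤ S.l2norm t := fun t => Real.sqrt_nonneg _
  -- the rows that fail
  let badF : Fin T → U → D.Key → Prop := fun t a κ => η * S.l2norm t <
    |∑ c ∈ Finset.univ.erase a, cross D.bucketOf D.signOf κ a c * count S' (t + 1) c|
  let badM : Fin T → D.Key → Prop := fun t κ => η / 3 * S.l2norm t ^ 2 <
    |∑ p ∈ Finset.univ.offDiag, cross D.bucketOf D.signOf κ p.1 p.2 *
        (count S' (t + 1) p.1 * count S' (t + 1) p.2)|
  have hKw : (Fintype.card D.Key : ℝ) / D.width ≤ Fintype.card D.Key * (η ^ 2 / 288) := by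
    rw [div_le_iff₀ hw0]
    have : (0 : ℝ) ≤ Fintype.card D.Key := by positivity
    nlinarith
  have hbadF : ∀ t a, 16 * (Finset.univ.filter (badF t a)).card ≤ Fintype.card D.Key := by
    intro t a
    have := card_filter_lt_abs_le (fun κ => ∑ c ∈ Finset.univ.erase a,
      cross D.bucketOf D.signOf κ a c * count S' (t + 1) c) (b := η * S.l2norm t)
      (mul_nonneg hη.le (hl2 t)) (H.sum_sq_freqError_le hw0' (count S' (t + 1)) a) (by
        rw [← hF, mul_pow]
        have h := mul_le_mul_of_nonneg_right hKw (sq_nonneg (S.l2norm t))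
        have h2 : (0 : ℝ) ≤ Fintype.card D.Key * (η ^ 2 * S.l2norm t ^ 2) := by positivity
        linarith)
    convert this
  have hbadM : ∀ t, 16 * (Finset.univ.filter (badM t)).card ≤ Fintype.card D.Key := by
    intro t
    have := card_filter_lt_abs_le (fun κ => ∑ p ∈ Finset.univ.offDiag,
      cross D.bucketOf D.signOf κ p.1 p.2 * (count S' (t + 1) p.1 * count S' (t + 1) p.2))
      (b := η / 3 * S.l2norm t ^ 2) (by positivity)
      (H.sum_sq_momentError_le hw0' (count S' (t + 1))) (by
        rw [← hF]
        have h := mul_le_mul_of_nonneg_right hKw (sq_nonneg (S.l2norm t ^ 2))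
        have h2 : (0 : ℝ) ≤ Fintype.card D.Key * (η ^ 2 * (S.l2norm t ^ 2) ^ 2) := by positivity
        nlinarith)
    convert this
  -- the failure events
  let E1 : Fin T × (Fin D.rows × Fin D.width) → Set (Fin T → D.Node → D.Num) := fun p =>
    {z | N ≤ |D.bucketNoise (Fin.extend 0 z) (p.1 + 1) p.2|}
  let E2 : Fin T × U → Set (Fin D.rows → D.Key) := fun p =>
    {κ | D.rows ≤ 2 * (Finset.univ.filter fun i => badF p.1 p.2 (κ i)).card}
  let E3 : Fin T → Set (Fin D.rows → D.Key) := fun t =>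
    {κ | D.rows ≤ 2 * (Finset.univ.filter fun i => badM t (κ i)).card}
  have h1 : (D.seeds T).toOuterMeasure (⋃ p, {x | x.2 ∈ E1 p}) ≤ ENNReal.ofReal (ξ / 2) := by
    refine (prob_iUnion_le _ _ (b := Real.exp (-(c * N)) * 3 ^ D.levels) fun p => ?_).trans
      (ENNReal.ofReal_le_ofReal (le_trans (le_of_eq ?_) hξN))
    · rw [prob_seeds_snd]
      exact D.prob_bucketNoise_le hc0 hc p.1.2 p.2 N
    · simp
  have h2 : (D.seeds T).toOuterMeasure (⋃ p, {x | x.1 ∈ E2 p}) ≤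
      ENNReal.ofReal (T * Fintype.card U * (1 / 2 : ℝ) ^ D.rows) := by
    refine (prob_iUnion_le _ _ (b := (1 / 2 : ℝ) ^ D.rows) fun p => ?_).trans
      (ENNReal.ofReal_le_ofReal (le_of_eq ?_))
    · rw [prob_seeds_fst]
      convert PMF.prob_half_bad_le (badF p.1 p.2) (by convert hbadF p.1 p.2) D.rows
    · simp
  have h3 : (D.seeds T).toOuterMeasure (⋃ p, {x | x.1 ∈ E3 p}) ≤
      ENNReal.ofReal (T * (1 / 2 : ℝ) ^ D.rows) := by
    refine (prob_iUnion_le _ _ (b := (1 / 2 : ℝ) ^ D.rows) fun p => ?_).trans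
      (ENNReal.ofReal_le_ofReal (le_of_eq ?_))
    · rw [prob_seeds_fst]
      convert PMF.prob_half_bad_le (badM p) (by convert hbadM p) D.rows
    · simp
  rw [prob, D.outputs_eq hT, PMF.toOuterMeasure_map_apply]
  set G := (fun x : (Fin D.rows → D.Key) × (Fin T → D.Node → D.Num) =>
      D.history S x.1 x.2) ⁻¹' {out | ∀ t : Fin T,
      (∀ a : U, |(S.freq t a : ℝ) - (out t).freq a| ≤ η * S.l2norm t + N) ∧
      |(out t).moment - S.l2norm t ^ 2| ≤ η * S.l2norm t ^ 2 + 4 / η * (D.width * N ^ 2)} with hG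
  have hsub : Gᶜ ⊆ (⋃ p, {x | x.2 ∈ E1 p}) ∪ ((⋃ p, {x | x.1 ∈ E2 p}) ∪
      ⋃ p, {x | x.1 ∈ E3 p}) := by
    rw [Set.compl_subset_comm]
    intro x hx t
    simp only [Set.mem_compl_iff, Set.mem_union, Set.mem_iUnion, not_or, not_exists] at hx
    obtain ⟨hx1, hx2, hx3⟩ := hx
    have hnoise : ∀ k, |(D.bucketNoise (Fin.extend 0 x.2) (t + 1) k : ℝ)| < N := by
      intro k
      have := hx1 (t, k)
      simpa [E1] using this
    have ht : (t : ℕ) + 1 ≤ T := t.2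
    simp only [history, estimates, hdec]
    refine ⟨fun a => ?_, ?_⟩
    · rw [freq_eq_count, abs_sub_comm]
      refine abs_freq_sub_le H hsign hm (ht.trans_lt hlev) ht x.1 S' _ a hN hmod4 hnoise ?_
      exact rows_lt_of_not_half_bad (bad := fun i => badF t a (x.1 i))
        (fun h => hx2 (t, a) (show _ ≤ _ by convert h)) fun i hi => not_lt.1 hi
    · rw [hF]
      refine abs_moment_sub_le H hsign hm (ht.trans_lt hlev) ht x.1 S' _ hη hη' hN hmod hnoise ?_
      rw [← hF]
      exact rows_lt_of_not_half_bad (bad := fun i => badM t (x.1 i))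
        (fun h => hx3 t (show _ ≤ _ by convert h)) fun i hi => not_lt.1 hi
  have hbad : (D.seeds T).toOuterMeasure Gᶜ ≤ ENNReal.ofReal ξ := by
    refine (MeasureTheory.measure_mono hsub).trans ((MeasureTheory.measure_union_le _ _).trans
      ((add_le_add h1 ((MeasureTheory.measure_union_le _ _).trans (add_le_add h2 h3))).trans ?_))
    rw [← ENNReal.ofReal_add (by positivity) (by positivity), ← add_mul]
    have hξ0 : 0 ≤ ξ / 2 := le_trans (by positivity) hξd
    rw [← ENNReal.ofReal_add hξ0 (by positivity)]
    exact ENNReal.ofReal_le_ofReal (by linarith)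
  have hξ0 : 0 ≤ ξ / 2 := le_trans (by positivity) hξd
  have htot := (D.seeds T).toOuterMeasure_add_compl G
  rw [ENNReal.ofReal_sub _ (by linarith), ENNReal.ofReal_one, ← htot]
  exact tsub_le_iff_right.2 (by gcongr)

/-- If every release is zero then every property of the zero history holds with probability one. -/
theorem prob_of_decode_eq_zero {T : ℕ} (hT : T < D.modulus) (hdec : ∀ x, D.decode x = 0)
    (S : ElementStream U T) (O : Set (Fin T → Estimates U))
    (hO : (fun _ => ⟨fun _ => 0, 0⟩) ∈ O) : D.algorithm.prob S O = 1 := by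
  rw [prob, D.outputs_eq hT, PMF.toOuterMeasure_map_apply, PMF.toOuterMeasure_apply_eq_one_iff]
  intro x _
  rw [Set.mem_preimage]
  have : D.history S x.1 x.2 = fun _ => ⟨fun _ => 0, 0⟩ := by
    funext t
    simp only [history, estimates, hdec]
  rwa [this]

end Sketch

/-! ### Hashing by random cubic polynomials -/

/-- The value at `x` of the cubic polynomial with the coefficients `κ`. -/
def cubicEval {F : Type*} [Field F] (κ : Fin 4 → F) (x : F) : F :=
  ∑ i, κ i * x ^ (i : ℕ)

/-- Lagrange interpolation by the normalised product of linear factors, in which the `yᵢ` may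
coincide. -/
theorem exists_cubic {F : Type*} [Field F] {x y₁ y₂ y₃ : F} (h₁ : x ≠ y₁) (h₂ : x ≠ y₂)
    (h₃ : x ≠ y₃) : ∃ v : Fin 4 → F, cubicEval v x = 1 ∧ cubicEval v y₁ = 0 ∧
      cubicEval v y₂ = 0 ∧ cubicEval v y₃ = 0 := by
  have hc : (x - y₁) * (x - y₂) * (x - y₃) ≠ 0 :=
    mul_ne_zero (mul_ne_zero (sub_ne_zero.2 h₁) (sub_ne_zero.2 h₂)) (sub_ne_zero.2 h₃)
  set c := ((x - y₁) * (x - y₂) * (x - y₃))⁻¹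
  have he : ∀ u, cubicEval ![-(y₁ * y₂ * y₃) * c, (y₁ * y₂ + y₁ * y₃ + y₂ * y₃) * c,
      -(y₁ + y₂ + y₃) * c, c] u = (u - y₁) * (u - y₂) * (u - y₃) * c := by
    intro u
    simp only [cubicEval, Fin.sum_univ_four]
    simp
    ring
  refine ⟨![-(y₁ * y₂ * y₃) * c, (y₁ * y₂ + y₁ * y₃ + y₂ * y₃) * c, -(y₁ + y₂ + y₃) * c, c],
    ?_, ?_, ?_, ?_⟩
  · rw [he]
    exact mul_inv_cancel₀ hc
  all_goals rw [he]; ring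

theorem cubicEval_add_mul {F : Type*} [Field F] (κ v : Fin 4 → F) (c u : F) :
    cubicEval (fun i => κ i + c * v i) u = cubicEval κ u + c * cubicEval v u := by
  simp only [cubicEval, Finset.mul_sum, ← Finset.sum_add_distrib]
  exact Finset.sum_congr rfl fun i _ => by ring

/-- A permutation of the values at one point lifts to the cubic polynomials, without changing the
values at three other points. -/
theorem exists_perm_cubic {F : Type*} [Field F] {x y₁ y₂ y₃ : F} (h₁ : x ≠ y₁)
    (h₂ : x ≠ y₂) (h₃ : x ≠ y₃) (φ : Equiv.Perm F) :
    ∃ τ : Equiv.Perm (Fin 4 → F), ∀ κ, cubicEval (τ κ) x = φ (cubicEval κ x) ∧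
      cubicEval (τ κ) y₁ = cubicEval κ y₁ ∧ cubicEval (τ κ) y₂ = cubicEval κ y₂ ∧
      cubicEval (τ κ) y₃ = cubicEval κ y₃ := by
  obtain ⟨v, hx, hy₁, hy₂, hy₃⟩ := exists_cubic h₁ h₂ h₃
  -- Adding a multiple of the interpolating cubic moves the value at `x` alone, so lifting the
  -- inverse permutation undoes the lift.
  let lift : Equiv.Perm F → (Fin 4 → F) → Fin 4 → F :=
    fun φ κ i => κ i + (φ (cubicEval κ x) - cubicEval κ x) * v i
  have hlift : ∀ φ κ, cubicEval (lift φ κ) x = φ (cubicEval κ x) := by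
    intro φ κ
    rw [cubicEval_add_mul, hx, mul_one, add_sub_cancel]
  have hinv : ∀ φ ψ : Equiv.Perm F, (∀ u, ψ (φ u) = u) → ∀ κ, lift ψ (lift φ κ) = κ := by
    intro φ ψ h κ
    funext i
    change lift φ κ i + (ψ (cubicEval (lift φ κ) x) - cubicEval (lift φ κ) x) * v i = κ i
    rw [hlift, h]
    change κ i + (φ (cubicEval κ x) - cubicEval κ x) * v i + _ = _
    ring
  refine ⟨⟨lift φ, lift φ.symm, hinv _ _ fun u => by simp, hinv _ _ fun u => by simp⟩,
    fun κ => ⟨hlift φ κ, ?_, ?_, ?_⟩⟩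
  · exact (cubicEval_add_mul _ _ _ _).trans (by rw [hy₁, mul_zero, add_zero])
  · exact (cubicEval_add_mul _ _ _ _).trans (by rw [hy₂, mul_zero, add_zero])
  · exact (cubicEval_add_mul _ _ _ _).trans (by rw [hy₃, mul_zero, add_zero])

/-- The sign encoded by a truth value. -/
def boolSign (b : Bool) : ℤ := if b then 1 else -1

/-- A field element is read as bucket, sign and remainder. Toggling the sign coordinate of the value
at one point gives `flip`. Translating its bucket coordinate shows that all `w` differences of two
buckets are equally frequent, which gives `collide`. -/
theorem signedHash_cubic {F A R : Type*} [Field F] [Fintype F] {w : ℕ} [NeZero w]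
    (e : F ≃ Fin w × Bool × R) (ι : A → F) (hι : Function.Injective ι) :
    SignedHash (fun (κ : Fin 4 → F) a => (e (cubicEval κ (ι a))).1)
      (fun κ a => boolSign (e (cubicEval κ (ι a))).2.1) w where
  sign_sq κ a := by
    cases (e (cubicEval κ (ι a))).2.1 <;> simp [boolSign]
  flip a b₁ b₂ b₃ h₁ h₂ h₃ := by
    let ψ : Fin w × Bool × R → Fin w × Bool × R := fun p => (p.1, !p.2.1, p.2.2)
    have hψ : ∀ p, ψ (ψ p) = p := fun p => by simp [ψ]
    obtain ⟨τ, hτ⟩ := exists_perm_cubic (hι.ne h₁) (hι.ne h₂) (hι.ne h₃)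
      ((e.trans ⟨ψ, ψ, hψ, hψ⟩).trans e.symm)
    refine ⟨τ, fun κ => ?_⟩
    obtain ⟨t0, t1, t2, t3⟩ := hτ κ
    simp only [t0, t1, t2, t3, Equiv.trans_apply, Equiv.apply_symm_apply, and_self, and_true]
    refine ⟨rfl, ?_⟩
    change boolSign (!(e (cubicEval κ (ι a))).2.1) = _
    cases (e (cubicEval κ (ι a))).2.1 <;> simp [boolSign]
  collide a b hab := by
    classical
    have hshift : ∀ k : Fin w, (Finset.univ.filter fun κ : Fin 4 → F =>
        (e (cubicEval κ (ι a))).1 = (e (cubicEval κ (ι b))).1).card =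
        (Finset.univ.filter fun κ : Fin 4 → F =>
        (e (cubicEval κ (ι a))).1 - (e (cubicEval κ (ι b))).1 = k).card := by
      intro k
      obtain ⟨τ, hτ⟩ := exists_perm_cubic (hι.ne hab) (hι.ne hab) (hι.ne hab)
        ((e.trans (Equiv.prodCongr (Equiv.addRight k) (Equiv.refl _))).trans e.symm)
      refine Finset.card_bij (fun κ _ => τ κ) (fun κ hκ => ?_) (fun _ _ _ _ h => τ.injective h)
        (fun κ hκ => ⟨τ.symm κ, ?_, by simp⟩)
      · obtain ⟨t0, t1, -, -⟩ := hτ κ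
        simp only [Finset.mem_filter, Finset.mem_univ, true_and] at hκ ⊢
        simp [t0, t1, hκ]
      · obtain ⟨t0, t1, -, -⟩ := hτ (τ.symm κ)
        simp only [Finset.mem_filter, Finset.mem_univ, true_and,
          Equiv.apply_symm_apply] at hκ t0 t1 ⊢
        rw [t0, t1] at hκ
        simp at hκ
        have h := hκ
        rw [add_sub_right_comm, add_eq_right, sub_eq_zero] at h
        exact h
    have hsum : ∑ k : Fin w, (Finset.univ.filter fun κ : Fin 4 → F =>
        (e (cubicEval κ (ι a))).1 - (e (cubicEval κ (ι b))).1 = k).card =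
        Fintype.card (Fin 4 → F) := by
      rw [← Finset.card_univ]
      exact (Finset.card_eq_sum_card_fiberwise fun _ _ => Finset.mem_coe.2 (Finset.mem_univ _)).symm
    rw [← Finset.sum_congr rfl fun k _ => hshift k, Finset.sum_const, Finset.card_univ,
      Fintype.card_fin, smul_eq_mul] at hsum
    refine le_of_eq (Eq.trans ?_ (hsum.trans ?_))
    · congr!
    · congr!

/-! ### The sketch with cubic hashing and discrete Laplace noise -/

/-- With a width that is a power of two, a field of characteristic 2 splits exactly, so buckets and
signs are unbiased; the last `q` bits make room for the injection of `U`. -/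
theorem exists_field_equiv (U : Type*) [Fintype U] (j q : ℕ) (hq : Fintype.card U ≤ 2 ^ q) :
    ∃ (F : Type) (_ : Field F) (_ : Fintype F) (ι : U → F)
      (_ : F ≃ Fin (2 ^ j) × Bool × Fin (2 ^ q)), Function.Injective ι := by
  have : Fact (Nat.Prime 2) := ⟨Nat.prime_two⟩
  have hc : Nat.card (GaloisField 2 (j + 1 + q)) = 2 ^ (j + 1 + q) :=
    GaloisField.card 2 _ (by omega)
  have : Fintype (GaloisField 2 (j + 1 + q)) := Fintype.ofFinite _
  rw [Nat.card_eq_fintype_card] at hc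
  obtain ⟨ι⟩ := Function.Embedding.nonempty_of_card_le
    (show Fintype.card U ≤ Fintype.card (GaloisField 2 (j + 1 + q)) from
      hc ▸ hq.trans (Nat.pow_le_pow_right two_pos (by omega)))
  refine ⟨GaloisField 2 (j + 1 + q), inferInstance, this, ι, Fintype.equivOfCardEq ?_, ι.injective⟩
  rw [hc]
  simp only [Fintype.card_prod, Fintype.card_fin, Fintype.card_bool]
  ring

namespace Sketch


/-- The sketch that hashes by random cubic polynomials and adds discrete Laplace noise. -/
noncomputable def cubic {U : Type*} {F R : Type} [Field F] [Fintype F] {w : ℕ}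
    (e : F ≃ Fin w × Bool × R) (ι : U → F) (d J m : ℕ) [NeZero m] (c : ℝ)
    (decode : ZMod m → ℝ) : Sketch U where
  Key := Fin 4 → F
  Letter := F
  keyInhabited := ⟨0⟩
  rows := d
  width := w
  levels := J
  modulus := m
  code := ι
  bucket κ x := (e (cubicEval κ x)).1
  sign κ x := boolSign (e (cubicEval κ x)).2.1
  noise := ZMod.laplace m c
  decode := decode

theorem abs_boolSign_le (b : Bool) : |boolSign b| ≤ 1 := by
  cases b <;> simp [boolSign]

theorem cubic_isDP {U : Type*} [Fintype U] {F R : Type} [Field F] [Fintype F] {w : ℕ}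
    (e : F ≃ Fin w × Bool × R) (ι : U → F) {T d J m : ℕ} [NeZero m] (hT : T < m) {c ε : ℝ}
    (hc : 0 ≤ c) (hε : c * (2 * d * J) ≤ ε) (decode : ZMod m → ℝ) :
    (cubic e ι d J m c decode).algorithm.IsDP T ε :=
  isDP _ hT (fun _ _ => abs_boolSign_le _) hc hε (ZMod.laplace_le hc)

theorem cubic_wordBits_le {U : Type*} [Fintype U] {F R : Type} [Field F] [Fintype F] {w : ℕ}
    (e : F ≃ Fin w × Bool × R) (ι : U → F) {d J m : ℕ} [NeZero m] (c : ℝ)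
    (decode : ZMod m → ℝ) : (cubic e ι d J m c decode).algorithm.wordBits ≤
      Nat.clog 2 (2 * Fintype.card F ^ 5 * m ^ 2) := by
  refine Nat.clog_mono_right 2 ?_
  have h : Fintype.card (cubic e ι d J m c decode).algorithm.Word =
      (Fintype.card F + 1) * (Fintype.card F ^ 4 * (m * m)) := by
    change Fintype.card (Option F × (Fin 4 → F) × ZMod m × ZMod m) = _
    simp [ZMod.card]
  rw [h]
  have : 0 < Fintype.card F := Fintype.card_pos
  calc (Fintype.card F + 1) * (Fintype.card F ^ 4 * (m * m))
      ≤ (2 * Fintype.card F) * (Fintype.card F ^ 4 * (m * m)) :=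
        Nat.mul_le_mul_right _ (by omega)
    _ = _ := by ring

end Sketch

/-! ### Trivial bounds, and accuracy when the noise exceeds the stream length -/

theorem ElementStream.freq_le {U : Type*} {T : ℕ} (S : ElementStream U T) (t : Fin T) (a : U) :
    S.freq t a ≤ T := by
  classical
  rw [freq]
  exact (Finset.card_le_univ _).trans (Fintype.card_fin T).le

theorem ElementStream.sum_freq_le {U : Type*} [Fintype U] {T : ℕ} (S : ElementStream U T)
    (t : Fin T) : ∑ a, S.freq t a ≤ T := by
  classical
  simp only [freq]
  rw [← Finset.card_biUnion]
  · exact (Finset.card_le_univ _).trans (Fintype.card_fin T).le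
  · intro a _ b _ hab
    refine Finset.disjoint_left.2 fun i hi hj => hab ?_
    have h1 := (Finset.mem_filter.1 hi).2.2
    have h2 := (Finset.mem_filter.1 hj).2.2
    exact Option.some_injective _ (h1.symm.trans h2)

theorem ElementStream.l2norm_sq_le {U : Type*} [Fintype U] {T : ℕ} (S : ElementStream U T)
    (t : Fin T) : S.l2norm t ^ 2 ≤ (T : ℝ) ^ 2 := by
  rw [l2norm, Real.sq_sqrt (by rw [secondMoment]; exact Finset.sum_nonneg fun _ _ => sq_nonneg _),
    secondMoment]
  refine (Finset.sum_sq_le_sq_sum_of_nonneg fun _ _ => Nat.cast_nonneg _).trans ?_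
  gcongr
  exact_mod_cast S.sum_freq_le t

namespace Sketch

/-- The release rule: numbers are read as small integers, unless the noise exceeds the length of
the stream, in which case nothing of value can be released. -/
noncomputable def readOut (m T : ℕ) (N : ℝ) (x : ZMod m) : ℝ :=
  open Classical in if N ≤ T then x.valMinAbs else 0

/-- If `N > T`, releasing zeros is accurate enough: frequencies are at most `T < N`, and the moment
is at most `T ^ 2 ≤ N ^ 2`. Hence the modulus, and with it the word length, need not depend on the
noise level. -/
theorem cubic_accurate {U : Type*} [Fintype U] {F R : Type} [Field F] [Fintype F] {w : ℕ}
    (e : F ≃ Fin w × Bool × R) (ι : U → F) (hι : Function.Injective ι) {T d J m : ℕ} [NeZero m]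
    (hm : d < m) (hT : T < m) (hlev : T < 2 ^ J) {η ξ N c : ℝ} (hη : 0 < η) (hη' : η < 1 / 2)
    (hw : 288 ≤ w * η ^ 2) (hc0 : 0 ≤ c) (hmod4 : 4 * (T : ℝ) < m)
    (hmod : 8 * (w * (T : ℝ) ^ 2) < m)
    (hξN : T * (d * w) * (Real.exp (-(c / 2 * N)) * 3 ^ J) ≤ ξ / 2)
    (hξd : (T * Fintype.card U + T) * (1 / 2 : ℝ) ^ d ≤ ξ / 2) (S : ElementStream U T) :
    ENNReal.ofReal (1 - ξ) ≤
      (cubic e ι d J m c (readOut m T N)).algorithm.prob S {out | ∀ t : Fin T,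
        (∀ a : U, |(S.freq t a : ℝ) - (out t).freq a| ≤ η * S.l2norm t + N) ∧
        |(out t).moment - S.l2norm t ^ 2| ≤ η * S.l2norm t ^ 2 + 4 / η * (w * N ^ 2)} := by
  classical
  have hw1 : (1 : ℝ) ≤ w := by
    have : (w : ℝ) ≠ 0 := by
      intro h
      rw [h] at hw
      linarith
    exact_mod_cast Nat.one_le_iff_ne_zero.2 (by exact_mod_cast this)
  have : NeZero w := ⟨by rintro rfl; norm_num at hw1⟩
  by_cases hN : N ≤ T
  · exact accurate (D := cubic e ι d J m c (readOut m T N)) (signedHash_cubic e ι hι)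
      (fun _ _ => abs_boolSign_le _) hm hT hlev hη hη' hw (div_nonneg hc0 two_pos.le)
      (ZMod.sum_laplace_mul_exp_le hc0) (fun x => if_pos hN) hN hmod4 hmod hξN hξd S
  · rw [prob_of_decode_eq_zero (D := cubic e ι d J m c (readOut m T N)) hT (fun x => if_neg hN)]
    · have hξ0 : 0 ≤ ξ / 2 := le_trans (by positivity) hξd
      exact ENNReal.ofReal_le_one.2 (by linarith)
    · have hl : ∀ t, 0 ≤ S.l2norm t := fun t => Real.sqrt_nonneg _
      refine fun t => ⟨fun a => ?_, ?_⟩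
      · have h1 : (S.freq t a : ℝ) ≤ T := by exact_mod_cast S.freq_le t a
        rw [sub_zero, Nat.abs_cast]
        have := mul_nonneg hη.le (hl t)
        linarith
      · have h1 := S.l2norm_sq_le t
        have h2 : (T : ℝ) ^ 2 ≤ N ^ 2 := by
          have : (0 : ℝ) ≤ T := by positivity
          exact pow_le_pow_left₀ this (not_le.1 hN).le 2
        have h3 : N ^ 2 ≤ w * N ^ 2 := le_mul_of_one_le_left (sq_nonneg _) hw1
        have h4 : w * N ^ 2 ≤ 4 / η * (w * N ^ 2) :=
          le_mul_of_one_le_left (by positivity) ((one_le_div hη).2 (by linarith))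
        have h5 : 0 ≤ η * S.l2norm t ^ 2 := by positivity
        rw [zero_sub, abs_neg, abs_of_nonneg (sq_nonneg _)]
        linarith

end Sketch

/-! ### The choice of the parameters -/

theorem exists_two_pow {x : ℝ} (hx : 1 ≤ x) : ∃ k : ℕ, x < 2 ^ k ∧ (2 : ℝ) ^ k ≤ 2 * x := by
  obtain ⟨k, h1, h2⟩ := exists_nat_pow_near hx one_lt_two
  exact ⟨k + 1, h2, by rw [pow_succ]; linarith⟩

theorem log_four_gt : (1.386 : ℝ) < Real.log 4 := by
  rw [show (4 : ℝ) = 2 ^ 2 by norm_num, Real.log_pow]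
  have := Real.log_two_gt_d9
  norm_num
  linarith

theorem log_two_pow_le {k : ℕ} {y : ℝ} (h : (2 : ℝ) ^ k ≤ y) :
    k * Real.log 2 ≤ Real.log y := by
  rw [← Real.log_pow]
  exact Real.log_le_log (by positivity) h

theorem rows_le {x L : ℝ} {d : ℕ} (hx : 4 ≤ x) (hL : L = Real.log x)
    (hd : (2 : ℝ) ^ d ≤ 2 * (4 * x)) : (d : ℝ) ≤ 4 * L := by
  have h1 := log_two_pow_le hd
  rw [show 2 * (4 * x) = 2 ^ 3 * x by ring, Real.log_mul (by norm_num) (by linarith),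
    Real.log_pow, ← hL] at h1
  have h2 : Real.log 4 ≤ L := hL ▸ Real.log_le_log (by norm_num) hx
  have h3 := log_four_gt
  have h4 := Real.log_two_gt_d9
  have h5 := Real.log_two_lt_d9
  push_cast at h1
  nlinarith

theorem levels_le {T J : ℕ} (hT : 2 ≤ T) (hJ : (2 : ℝ) ^ J ≤ 2 * T) :
    J * Real.log 2 ≤ 2 * Real.log T ∧ (J : ℝ) ≤ 3 * Real.log T := by
  have hT' : (2 : ℝ) ≤ T := by exact_mod_cast hT
  have h1 := log_two_pow_le hJ
  rw [Real.log_mul (by norm_num) (by linarith)] at h1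
  have h2 : Real.log 2 ≤ Real.log T := Real.log_le_log (by norm_num) hT'
  have h4 := Real.log_two_gt_d9
  exact ⟨by linarith, by nlinarith⟩

theorem noise_exponent_le {T J d w : ℕ} {L η ξ : ℝ} (hT : 2 ≤ T) (hd0 : 0 < d) (hw0 : 0 < w)
    (hη : 0 < η) (hη' : η < 1 / 2) (hξ : 0 < ξ) (hξ' : ξ < 1 / 2) (hL : 1 ≤ L)
    (hJ : J * Real.log 2 ≤ 2 * Real.log T) (hd : (d : ℝ) ≤ 4 * L) (hw : (w : ℝ) * η ^ 2 ≤ 576) :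
    J * Real.log 3 + Real.log (2 * d * w * T / ξ) ≤
      19 * (Real.log T * Real.log (L / (ξ * η))) := by
  have hT' : (2 : ℝ) ≤ T := by exact_mod_cast hT
  have hd0' : (0 : ℝ) < d := by exact_mod_cast hd0
  have hw0' : (0 : ℝ) < w := by exact_mod_cast hw0
  have l2 := Real.log_two_gt_d9
  have l2' := Real.log_two_lt_d9
  have hT2 : Real.log 2 ≤ Real.log T := Real.log_le_log (by norm_num) hT'
  have h3 : J * Real.log 3 ≤ 4 * Real.log T := by
    have : Real.log 3 ≤ 2 * Real.log 2 := by
      rw [show 2 * Real.log 2 = Real.log (2 ^ 2) by rw [Real.log_pow]; norm_num]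
      exact Real.log_le_log (by norm_num) (by norm_num)
    have hJ0 : (0 : ℝ) ≤ J := by positivity
    nlinarith
  have hξη : ξ * η ≤ 1 / 4 := by nlinarith
  have hξη0 : 0 < ξ * η := mul_pos hξ hη
  have hq : 4 ≤ L / (ξ * η) := by
    rw [le_div_iff₀ hξη0]
    linarith
  have hℓ : 1.386 ≤ Real.log (L / (ξ * η)) :=
    log_four_gt.le.trans (Real.log_le_log (by norm_num) hq)
  have h4 : Real.log (2 * d * w * T / ξ) ≤
      Real.log T + 13 * Real.log 2 + 2 * Real.log (L / (ξ * η)) := by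
    -- Inserting the bounds on `d` and `w`: 2 · 4 · 576 = 4608 < 2¹³, and `L ≤ L ^ 2`.
    have e : 2 * (d : ℝ) * w * T / ξ ≤ T * 2 ^ 13 * (L / (ξ * η)) ^ 2 := by
      rw [div_pow, ← mul_div_assoc, div_le_div_iff₀ hξ (by positivity)]
      have h5 : (d : ℝ) * (w * η ^ 2) ≤ 4 * L * 576 := by gcongr
      have h6 : 2 * (d * (w * η ^ 2)) * ξ ≤ 2 ^ 13 * L ^ 2 := by
        have h7 : 0 ≤ (d : ℝ) * (w * η ^ 2) := by positivity
        nlinarith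
      have h8 := mul_le_mul_of_nonneg_left h6 (show 0 ≤ (T : ℝ) * ξ by positivity)
      linarith
    refine (Real.log_le_log (by positivity) e).trans (le_of_eq ?_)
    rw [Real.log_mul (by positivity) (by positivity), Real.log_mul (by positivity) (by positivity),
      Real.log_pow, Real.log_pow]
    push_cast
    ring
  set ℓ := Real.log (L / (ξ * η))
  set y := Real.log T
  have hy : 0.693 ≤ y := by linarith
  -- Both logarithms are bounded below, so their sum is absorbed by their product.
  have h9 : 0 ≤ (y - 0.693) * (ℓ - 1.386) := mul_nonneg (by linarith) (by linarith)
  linarith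

/-- The noise level comes out with exponent 2; this weakens it to the exponent 5/2 of the theorem.
-/
theorem sq_le_rpow {y : ℝ} (hy : 1 / 4 ≤ y) : y ^ 2 ≤ 2 * y ^ (5 / 2 : ℝ) := by
  have hy0 : 0 < y := by linarith
  rw [show (5 / 2 : ℝ) = 2 + 1 / 2 by norm_num, Real.rpow_add hy0, ← Real.sqrt_eq_rpow,
    Real.rpow_two]
  have : 1 / 2 ≤ Real.sqrt y := Real.le_sqrt_of_sq_le (by linarith)
  nlinarith [sq_nonneg y]

theorem noise_le {J d ε L y ℓ M N : ℝ} (hε : 0 < ε) (hd0 : 0 ≤ d) (hJ0 : 0 ≤ J) (hL : 0 ≤ L)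
    (hℓ : 0 ≤ ℓ) (hy : 1 / 4 ≤ y) (hd : d ≤ 4 * L) (hJ : J ≤ 3 * y) (hM : M ≤ 19 * (y * ℓ))
    (hN : N = 4 * d * J / ε * M) : N ≤ 1824 * (L / ε * y ^ (5 / 2 : ℝ) * ℓ) := by
  have h1 : d * J ≤ 4 * L * (3 * y) := by gcongr
  have h2 : 4 * d * J / ε * M ≤ 4 * (4 * L * (3 * y)) / ε * (19 * (y * ℓ)) := by
    have : 4 * d * J / ε ≤ 4 * (4 * L * (3 * y)) / ε := 
      div_le_div_of_nonneg_right (by linarith) hε.le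
    have h0 : 0 ≤ 4 * d * J / ε := by positivity
    calc _ ≤ 4 * d * J / ε * (19 * (y * ℓ)) := by gcongr
      _ ≤ _ := by gcongr
  have h3 : L / ε * ℓ * y ^ 2 ≤ L / ε * ℓ * (2 * y ^ (5 / 2 : ℝ)) := by
    gcongr
    exact sq_le_rpow hy
  have h4 : 4 * (4 * L * (3 * y)) / ε * (19 * (y * ℓ)) = 912 * (L / ε * ℓ * y ^ 2) := by ring
  rw [hN]
  linarith

/-- The width contributes `1 / η ^ 2` and the splitting of the cross terms another `1 / η`; 2304 = 4
· 576. -/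
theorem moment_error_le {w N η ε L y ℓ : ℝ} (hη : 0 < η) (hy : 0 ≤ y) (hN0 : 0 ≤ N)
    (hw : w * η ^ 2 ≤ 576) (hN : N ≤ 1824 * (L / ε * y ^ (5 / 2 : ℝ) * ℓ)) :
    4 / η * (w * N ^ 2) ≤
      2304 * 1824 ^ 2 * (L ^ 2 / (ε ^ 2 * η ^ 3) * y ^ 5 * ℓ ^ 2) := by
  have h1 : N ^ 2 ≤ 1824 ^ 2 * (L ^ 2 / ε ^ 2 * y ^ 5 * ℓ ^ 2) := by
    refine (pow_le_pow_left₀ hN0 hN 2).trans (le_of_eq ?_)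
    have : (y ^ (5 / 2 : ℝ)) ^ 2 = y ^ 5 := by
      rw [← Real.rpow_natCast, ← Real.rpow_mul hy, ← Real.rpow_natCast]
      norm_num
    rw [mul_pow, mul_pow, mul_pow, this, div_pow]
  have h2 : 4 / η * (w * N ^ 2) = 4 / η ^ 3 * ((w * η ^ 2) * N ^ 2) := by
    field_simp
  rw [h2]
  calc 4 / η ^ 3 * ((w * η ^ 2) * N ^ 2)
      ≤ 4 / η ^ 3 * (576 * (1824 ^ 2 * (L ^ 2 / ε ^ 2 * y ^ 5 * ℓ ^ 2))) := by gcongr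
    _ = _ := by
      rw [← div_div]
      ring

theorem space_le {d w J η L y : ℝ} (hd0 : 1 ≤ d) (hw0 : 1 ≤ w) (hJ0 : 1 ≤ J) (hη : 0 < η)
    (hd : d ≤ 4 * L) (hJ : J ≤ 3 * y) (hw : w * η ^ 2 ≤ 576) :
    4 + (d + d + (d * w + d * (w * J))) ≤ 55296 * (L / η ^ 2 * y) := by
  have h1 : 1 ≤ w * J := one_le_mul_of_one_le_of_one_le hw0 hJ0
  have h2 : d ≤ d * (w * J) := le_mul_of_one_le_right (by linarith) h1
  have h3 : d * w ≤ d * (w * J) := by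
    gcongr
    exact le_mul_of_one_le_right (by linarith) hJ0
  have h4 : d * (w * J) ≤ 4 * L * (576 / η ^ 2 * (3 * y)) := by
    have : w ≤ 576 / η ^ 2 := (le_div_iff₀ (by positivity)).2 hw
    have hL : 0 ≤ L := by linarith
    gcongr
  have h5 : 4 * L * (576 / η ^ 2 * (3 * y)) = 6912 * (L / η ^ 2 * y) := by ring
  linarith

/-- Since `log 2 > 1 / 2`, changing the base costs a factor 2, and the rounding up costs at most `2
* Real.log B`. -/
theorem clog_two_le {k : ℕ} {B : ℝ} (hB : 2 ≤ B) {r : ℕ} (hk : (k : ℝ) ≤ B ^ r) :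
    (Nat.clog 2 k : ℝ) ≤ (2 * r + 2) * Real.log B := by
  have hl : Real.log 2 ≤ Real.log B := Real.log_le_log (by norm_num) hB
  have l2 := Real.log_two_gt_d9
  have h0 : 0 ≤ Real.log B := by linarith
  rcases Nat.eq_zero_or_pos (Nat.clog 2 k) with hz | hpos
  · rw [hz]
    push_cast
    positivity
  · have h1 : 2 ^ (Nat.clog 2 k - 1) < k :=
      Nat.lt_of_not_le fun h => by
        have := (Nat.clog_le_iff_le_pow one_lt_two).2 h
        omega
    have h2 : (2 : ℝ) ^ (Nat.clog 2 k - 1) ≤ B ^ r :=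
      le_trans (by exact_mod_cast h1.le) hk
    have h3 := log_two_pow_le h2
    rw [Real.log_pow, Nat.cast_sub hpos, Nat.cast_one] at h3
    have h4 : 0 ≤ r * Real.log B := by positivity
    nlinarith

theorem two_mul_pow_mul_sq_le {f m B : ℝ} (hf0 : 0 ≤ f) (hm0 : 0 ≤ m) (hB : 8 ≤ B)
    (hf : f ≤ B ^ 6) (hm : m ≤ B ^ 7) : 2 * f ^ 5 * m ^ 2 ≤ B ^ 45 := by
  calc 2 * f ^ 5 * m ^ 2 ≤ B * (B ^ 6) ^ 5 * (B ^ 7) ^ 2 := by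
        gcongr
        linarith
    _ = B ^ 45 := by ring

theorem field_card_le {w q n η B : ℝ} (hη : 0 < η) (hq0 : 0 ≤ q) (hw : w * η ^ 2 ≤ 576)
    (hq : q ≤ 2 * n) (hB : 8 ≤ B) (hn : n / η ≤ B) (h1 : 1 / η ≤ B) :
    w * (2 * q) ≤ B ^ 6 := by
  have h0 : 0 < 1 / η := by positivity
  have h2 : w ≤ 576 * (1 / η) * (1 / η) := by
    rw [show 576 * (1 / η) * (1 / η) = 576 / η ^ 2 by field_simp]
    exact (le_div_iff₀ (by positivity)).2 hw
  have h3 : q * (1 / η) ≤ 2 * B := by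
    have : q * (1 / η) ≤ 2 * n * (1 / η) := by gcongr
    have e : 2 * n * (1 / η) = 2 * (n / η) := by ring
    linarith
  calc w * (2 * q) ≤ 576 * (1 / η) * (1 / η) * (2 * q) := by gcongr
    _ = 1152 * ((1 / η) * (q * (1 / η))) := by ring
    _ ≤ 8 ^ 4 / 2 * (B * (2 * B)) := by
        gcongr
        norm_num
    _ = 8 ^ 4 * B ^ 2 := by ring
    _ ≤ B ^ 4 * B ^ 2 := by gcongr
    _ = B ^ 6 := by ring

theorem modulus_le {w T d η B : ℝ} (hη : 0 < η) (hT0 : 0 ≤ T) (hw : w * η ^ 2 ≤ 576)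
    (hB : 8 ≤ B) (h1 : T / η ≤ B) (h2 : T ≤ B) (h3 : d ≤ 8 * B) :
    8 * (w * T ^ 2) + 4 * T + d + 1 ≤ B ^ 7 := by
  have h4 : w * T ^ 2 ≤ 576 * B ^ 2 := by
    calc w * T ^ 2 = w * η ^ 2 * (T / η) ^ 2 := by field_simp
      _ ≤ 576 * B ^ 2 := by gcongr
  have h5 : (8 : ℝ) ^ 5 * B ^ 2 ≤ B ^ 5 * B ^ 2 := by gcongr
  have h6 : B ^ 5 * B ^ 2 = B ^ 7 := by ring
  nlinarith

theorem StreamAlgorithm.prob_mono {U : Type*} {r T : ℕ} (A : StreamAlgorithm U r)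
    (S : ElementStream U T) {O O' : Set (Fin T → Estimates U)} (h : O ⊆ O') :
    A.prob S O ≤ A.prob S O' :=
  MeasureTheory.measure_mono h

/-- Field size and modulus are polynomial in `B`: 45 = 1 + 5 · 6 + 2 · 7, and 92 = 2 · 45 + 2. -/
theorem word_bits_le {f m d w q : ℕ} {T n η ξ : ℝ} (hη : 0 < η) (hη' : η < 1 / 2)
    (hξ : 0 < ξ) (hξ' : ξ < 1 / 2) (hx4 : 4 ≤ T * n / ξ) (hn1 : 1 ≤ n) (hT : 2 ≤ T)
    (hw : w * η ^ 2 ≤ 576) (hq : (2 : ℝ) ^ q ≤ 2 * n) (hd : (2 : ℝ) ^ d ≤ 2 * (4 * (T * n / ξ)))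
    (hf : (f : ℝ) = w * (2 * 2 ^ q)) (hm : (m : ℝ) = 8 * (w * T ^ 2) + 4 * T + d + 1) :
    (Nat.clog 2 (2 * f ^ 5 * m ^ 2) : ℝ) ≤ 92 * Real.log (T * n / (ξ * η)) := by
  set x : ℝ := T * n / ξ with hx
  set B : ℝ := T * n / (ξ * η) with hB
  have hBx : B = x * (1 / η) := by
    rw [hB, hx]
    field_simp
  have hη2 : 2 ≤ 1 / η := (le_div_iff₀ hη).2 (by linarith)
  have hB8 : 8 ≤ B := by
    rw [hBx]
    nlinarith
  have hxB : x ≤ B := hBx ▸ le_mul_of_one_le_right (by linarith) (by linarith)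
  have hTnx : T * n ≤ x := by
    rw [hx, le_div_iff₀ hξ]
    have : 0 ≤ T * n := by positivity
    nlinarith
  have hTx : T ≤ x := (le_mul_of_one_le_right (by linarith) hn1).trans hTnx
  have hnx : n ≤ x := (le_mul_of_one_le_left (by linarith) (by linarith)).trans hTnx
  have hdiv : ∀ z : ℝ, z ≤ x → z / η ≤ B := by
    intro z hz
    rw [hBx, mul_one_div]
    gcongr
  have hcard : (f : ℝ) ≤ B ^ 6 := by
    rw [hf]
    exact field_card_le hη (by positivity) hw hq hB8 (hdiv n hnx) (hdiv 1 (by linarith))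
  have hmod : (m : ℝ) ≤ B ^ 7 := by
    rw [hm]
    refine modulus_le hη (by linarith) hw hB8 (hdiv T hTx) (hTx.trans hxB) ?_
    have : (d : ℝ) ≤ 2 ^ d := by exact_mod_cast (Nat.lt_two_pow_self (n := d)).le
    linarith
  have hk : ((2 * f ^ 5 * m ^ 2 : ℕ) : ℝ) ≤ B ^ 45 := by
    push_cast
    exact two_mul_pow_mul_sq_le (Nat.cast_nonneg _) (Nat.cast_nonneg _) hB8 hcard hmod
  refine (clog_two_le (by linarith) hk).trans (le_of_eq ?_)
  norm_num

theorem exists_private_sketch (U : Type*) [Fintype U] [Nonempty U] {T : ℕ} {ε η ξ L : ℝ}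
    (hT : 2 ≤ T) (hε : 0 < ε) (hη : 0 < η) (hη' : η < 1 / 2) (hξ : 0 < ξ) (hξ' : ξ < 1 / 2)
    (hL : L = Real.log (T / ξ) + Real.log (Fintype.card U)) :
    ∃ (A : StreamAlgorithm U 4) (w : ℕ) (N : ℝ), A.IsDP T ε ∧ 0 ≤ N ∧
      (w : ℝ) * η ^ 2 ≤ 576 ∧
      N ≤ 1824 * (L / ε * Real.log T ^ (5 / 2 : ℝ) * Real.log (L / (ξ * η))) ∧
      (∀ S : ElementStream U T, ENNReal.ofReal (1 - ξ) ≤ A.prob S {out | ∀ t : Fin T,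
        (∀ a : U, |(S.freq t a : ℝ) - (out t).freq a| ≤ η * S.l2norm t + N) ∧
        |(out t).moment - S.l2norm t ^ 2| ≤ η * S.l2norm t ^ 2 + 4 / η * (w * N ^ 2)}) ∧
      (A.space : ℝ) ≤ 55296 * (L / η ^ 2 * Real.log T) ∧
      (A.wordBits : ℝ) ≤ 92 * Real.log (T * Fintype.card U / (ξ * η)) := by
  set n := Fintype.card U with hn
  have hn1 : (1 : ℝ) ≤ n := by exact_mod_cast (Fintype.card_pos : 0 < Fintype.card U)
  have hT' : (2 : ℝ) ≤ T := by exact_mod_cast hT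
  set x : ℝ := T * n / ξ with hx
  have hx4 : 4 ≤ x := by
    rw [hx, le_div_iff₀ hξ]
    nlinarith
  have hLx : L = Real.log x := by
    rw [hL, ← Real.log_mul (by positivity) (by positivity), hx]
    congr 1
    ring
  have hL1 : 1 ≤ L := by
    have := Real.log_le_log (by norm_num) hx4
    have := log_four_gt
    linarith
  -- `2 ^ d > 4 * T * n / ξ` pays for the `T * n + T` hashing events with `ξ / 2`.
  obtain ⟨d, hd1, hd2⟩ := exists_two_pow (x := 4 * x) (by linarith)
  obtain ⟨J, hJ1, hJ2⟩ := exists_two_pow (x := (T : ℝ)) (by linarith)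
  obtain ⟨q, hq1, hq2⟩ := exists_two_pow hn1
  obtain ⟨j, hj1, hj2⟩ := exists_two_pow (x := 288 / η ^ 2)
    ((one_le_div (by positivity)).2 (by nlinarith))
  obtain ⟨F, _, _, ι, e, hι⟩ := exists_field_equiv U j q (by exact_mod_cast hq1.le)
  have hd0 : 0 < d := by
    rcases Nat.eq_zero_or_pos d with rfl | h
    · norm_num at hd1
      linarith
    · exact h
  have hJ0 : 0 < J := by
    rcases Nat.eq_zero_or_pos J with rfl | h
    · norm_num at hJ1
      linarith
    · exact h
  have hd4 := rows_le hx4 hLx hd2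
  obtain ⟨hJlog, hJ3⟩ := levels_le hT hJ2
  obtain ⟨w, hw⟩ : ∃ w, w = 2 ^ j := ⟨_, rfl⟩
  have hwj : (w : ℝ) = 2 ^ j := by rw [hw]; push_cast; rfl
  rw [← hwj] at hj1 hj2
  rw [← hw] at e
  have hw0 : 0 < w := hw ▸ by positivity
  have hw288 : 288 ≤ w * η ^ 2 := ((div_lt_iff₀ (by positivity)).1 hj1).le
  have hw576 : (w : ℝ) * η ^ 2 ≤ 576 := by
    rw [← mul_div_assoc, le_div_iff₀ (by positivity)] at hj2
    linarith
  have hd0' : (0 : ℝ) < d := by exact_mod_cast hd0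
  have hJ0' : (0 : ℝ) < J := by exact_mod_cast hJ0
  have hw0' : (0 : ℝ) < w := by exact_mod_cast hw0
  -- `c` spends the privacy budget over the sensitivity `2 * d * J`, and `N` solves `c / 2 * N = M`;
  -- with this `M` the noise part of the union bound is exactly `ξ / 2`.
  set M : ℝ := J * Real.log 3 + Real.log (2 * d * w * T / ξ) with hM
  set N : ℝ := 4 * d * J / ε * M with hN
  set c : ℝ := ε / (2 * d * J) with hc
  -- The sum exceeds each required lower bound: for squared buckets, for single buckets and the
  -- clock, and for the rank counts.
  obtain ⟨m, hm⟩ : ∃ m, m = 8 * (w * T ^ 2) + 4 * T + d + 1 := ⟨_, rfl⟩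
  have : NeZero m := ⟨by omega⟩
  have hmr : (m : ℝ) = 8 * (w * T ^ 2) + 4 * T + d + 1 := by rw [hm]; push_cast; ring
  have hc0 : 0 ≤ c := by positivity
  have hM0 : 0 ≤ M := by
    have h3 : 0 ≤ Real.log 3 := Real.log_nonneg (by norm_num)
    have h4 : 0 ≤ Real.log (2 * d * w * T / ξ) := by
      refine Real.log_nonneg ((one_le_div hξ).2 ?_)
      have h5 : (1 : ℝ) ≤ d * w := by exact_mod_cast Nat.mul_pos hd0 hw0
      nlinarith
    positivity
  have hN0 : 0 ≤ N := by positivity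
  have hcN : c / 2 * N = M := by
    rw [hc, hN]
    field_simp
    norm_num
  have hℓ0 : 0 ≤ Real.log (L / (ξ * η)) := by
    refine Real.log_nonneg ((one_le_div (by positivity)).2 ?_)
    nlinarith
  have hy : 1 / 4 ≤ Real.log T := by
    have := Real.log_le_log (by norm_num) hT'
    have := Real.log_two_gt_d9
    linarith
  refine ⟨(Sketch.cubic e ι d J m c (Sketch.readOut m T N)).algorithm, w, N,
    Sketch.cubic_isDP e ι (by omega) hc0 (le_of_eq ?_) _, hN0, hw576, ?_, fun S => ?_, ?_, ?_⟩
  · rw [hc]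
    field_simp
  · exact noise_le hε hd0'.le hJ0'.le (by linarith) hℓ0 hy hd4 hJ3
      (noise_exponent_le hT hd0 hw0 hη hη' hξ hξ' hL1 hJlog hd4 hw576) hN
  · refine Sketch.cubic_accurate e ι hι (by omega) (by omega) (by exact_mod_cast hJ1) hη hη' hw288
      hc0 ?_ ?_ ?_ ?_ S
    · rw [hmr]
      have : 0 ≤ (w : ℝ) * T ^ 2 := by positivity
      linarith
    · rw [hmr]
      linarith
    · rw [hcN, hM, neg_add, Real.exp_add, Real.exp_neg, Real.exp_neg,
        Real.exp_log (by positivity), mul_comm (J : ℝ), Real.exp_mul, Real.exp_log (by norm_num),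
        Real.rpow_natCast]
      refine le_of_eq ?_
      field_simp
    · rw [one_div, inv_pow, ← div_eq_mul_inv, div_le_iff₀ (by positivity)]
      have h1 : 4 * (T * n) ≤ 2 ^ d * ξ := by
        have := hd1.le
        rwa [hx, ← mul_div_assoc, div_le_iff₀ hξ] at this
      have h2 : (T : ℝ) ≤ T * n := le_mul_of_one_le_right (by linarith) hn1
      linarith
  · have h : (Sketch.cubic e ι d J m c (Sketch.readOut m T N)).algorithm.space =
        4 + (d + d + (d * w + d * (w * J))) := SketchCell.card d w J
    rw [h]
    push_cast
    exact space_le (by exact_mod_cast hd0) (by exact_mod_cast hw0) (by exact_mod_cast hJ0) hη hd4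
      hJ3 hw576
  · refine le_trans (Nat.cast_le.2 (Sketch.cubic_wordBits_le e ι c _)) ?_
    refine word_bits_le hη hη' hξ hξ' hx4 hn1 hT' hw576 hq2 hd2 ?_ hmr
    rw [Fintype.card_congr e]
    simp only [Fintype.card_prod, Fintype.card_fin, Fintype.card_bool]
    push_cast
    rfl

theorem mainTheorem5 :
    ∃ (C : ℝ) (r : ℕ), ∀ (U : Type*) [Fintype U] [Nonempty U] (T : ℕ) (ε η ξ : ℝ),
      2 ≤ T → 0 < ε → 0 < η → η < 1 / 2 → 0 < ξ → ξ < 1 / 2 →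
      ∃ A : StreamAlgorithm U r,
        A.IsDP T ε ∧
        (∀ S : ElementStream U T,
          ENNReal.ofReal (1 - ξ) ≤ A.prob S {out | ∀ t : Fin T,
            (∀ a : U, |(S.freq t a : ℝ) - (out t).freq a| ≤ η * S.l2norm t +
              C * ((Real.log (T / ξ) + Real.log (Fintype.card U)) / ε * Real.log T ^ (5 / 2 : ℝ) *
                Real.log ((Real.log (T / ξ) + Real.log (Fintype.card U)) / (ξ * η)))) ∧
            |(out t).moment - S.l2norm t ^ 2| ≤ η * S.l2norm t ^ 2 +
              C * ((Real.log (T / ξ) + Real.log (Fintype.card U)) ^ 2 / (ε ^ 2 * η ^ 3) *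
                Real.log T ^ 5 *
                Real.log ((Real.log (T / ξ) + Real.log (Fintype.card U)) / (ξ * η)) ^ 2)}) ∧
        (A.space : ℝ) ≤
          C * ((Real.log (T / ξ) + Real.log (Fintype.card U)) / η ^ 2 * Real.log T) ∧
        (A.wordBits : ℝ) ≤ C * Real.log (T * Fintype.card U / (ξ * η)) := by
  refine ⟨2304 * 1824 ^ 2, 4, fun U _ _ T ε η ξ hT hε hη hη' hξ hξ' => ?_⟩
  obtain ⟨A, w, N, hdp, hN0, hw, hN, hacc, hspace, hbits⟩ :=
    exists_private_sketch U hT hε hη hη' hξ hξ' rfl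
  have hy : 0 ≤ Real.log T := Real.log_natCast_nonneg T
  -- Enlarging the constant needs `0 ≤ C`, which is read off from `0 ≤ z ≤ b * C` with `b > 0`.
  have scale : ∀ {z b C : ℝ}, 0 ≤ z → z ≤ b * C → 0 < b → b ≤ 2304 * 1824 ^ 2 →
      z ≤ 2304 * 1824 ^ 2 * C := by
    intro z b C hz hzb hb hb'
    have hC : 0 ≤ C := nonneg_of_mul_nonneg_right (hz.trans hzb) hb
    exact hzb.trans (mul_le_mul_of_nonneg_right hb' hC)
  refine ⟨A, hdp, fun S => (hacc S).trans (A.prob_mono S fun out hout t => ⟨fun a => ?_, ?_⟩),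
    scale (Nat.cast_nonneg _) hspace (by norm_num) (by norm_num),
    scale (Nat.cast_nonneg _) hbits (by norm_num) (by norm_num)⟩
  · exact ((hout t).1 a).trans
      (add_le_add_right (scale hN0 hN (by norm_num) (by norm_num)) _)
  · exact (hout t).2.trans (add_le_add_right (moment_error_le hη hy hN0 hw hN) _)
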